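/- Let $k$ be an algebraically closed field of characteristic $0$ and $n\ge 1$. Let $Q$ be a finite quiver with vertex set $Q_0$, $S=k^{Q_0}$ with idempotents $e_i$, and let $V$ be the $S$-bimodule with basis the arrows, so that $kQ=T_SV$; paths are composed from right to left, so an arrow $i\to j$ lies in $e_jVe_i$. Let $M\subseteq V\otimes_S V$ be a sub-bimodule and let $\Lambda=T_SV/\langle M\rangle=kQ/\langle M\rangle$, graded by path length. (Every basic finite-dimensional algebra $T_SV/\langle M\rangle$ with $S$ semisimple has this form.) Assume that * $\Lambda$ is Koszul: the graded left module $S=\Lambda/\Lambda_+$ has a graded projective resolution $\cdots\to P^1\to P^0\to S\to 0$ with $P^l$ generated in degree $l$; * $\Lambda$ is $n$-representation-infinite: it is finite-dimensional of global dimension $n$, and $\mathbb S_n^{-l}(\Lambda)$ has cohomology only in degree $0$ for all $l\ge 0$, where $\mathbb S_n^{-1}=\mathbf R\mathrm{Hom}_\Lambda(D\Lambda,-)[n]$ and $D=\mathrm{Hom}_k(-,k)$. Let $\Pi(\Lambda)=T_\Lambda\mathrm{Ext}^n_\Lambda(D\Lambda,\Lambda)$ be its $(n+1)$-preprojective algebra,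 and $\Lambda^e=\Lambda\otimes_k\Lambda^{op}$. Put $K_l=\bigcap_\mu V^{\otimes\mu}\otimes_S M\otimes_S V^{\otimes(l-\mu-2)}\subseteq V^{\otimes_S l}$ (so $K_0=S$, $K_1=V$). Let $\mathcal B_n$ and $\mathcal B_{n-1}$ be $k$-bases of $K_n$ and $K_{n-1}$ such that every element $q$ is a linear combination of paths with a common source $s(q)$ and a common target $t(q)$. 1. For $q\in\mathcal B_n$ there are unique elements $\delta^{\mathcal L}_pq\in e_{s(p)}V$ and unique elements $\delta^{\mathcal R}_pq\in Ve_{t(p)}$, $p\in\mathcal B_{n-1}$, with $$q=\sum_{p}p\otimes\delta^{\mathcal L}_pq=\sum_p\delta^{\mathcal R}_pq\otimes p .$$ 2. There is an isomorphism of $\Lambda$-bimodules $$\mathrm{Ext}^n_{\Lambda^e}(\Lambda,\Lambda^e)\;\cong\;\Bigl(\bigoplus_{q\in\mathcal B_n}\Lambda e_{s(q)}\otimes_k e_{t(q)}\Lambda\Bigr)\Big/\langle I\rangle ,$$ where $\langle I\rangle$ is the sub-bimodule generated by the elements $$\sum_{q\in\mathcal B_n}\bigl(e_{s(q)}\otimes\delta^{\mathcal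 R}_pq+(-1)^n\,\delta^{\mathcal L}_pq\otimes e_{t(q)}\bigr)_q ,\qquad p\in\mathcal B_{n-1}.$$ Moreover $\langle I\rangle$ is the image of the dual Koszul differential $\mathrm{Hom}_{\Lambda^e}(f,\Lambda^e)$, where $f$ is the Koszul bimodule differential $$f:\bigoplus_{q\in\mathcal B_n}\Lambda e_{t(q)}\otimes_k e_{s(q)}\Lambda\to\bigoplus_{p\in\mathcal B_{n-1}}\Lambda e_{t(p)}\otimes_k e_{s(p)}\Lambda,$$ $$f\bigl((e_{t(q)}\otimes e_{s(q)})_q\bigr)=\sum_p\bigl(\delta^{\mathcal R}_pq\otimes e_{s(p)}+(-1)^n e_{t(p)}\otimes\delta^{\mathcal L}_pq\bigr)_p ,$$ and $\phi\in\mathrm{Hom}_{\Lambda^e}(\bigoplus_q\Lambda e_{t(q)}\otimes_k e_{s(q)}\Lambda,\Lambda^e)$ is identified with the element of $\bigoplus_q\Lambda e_{s(q)}\otimes_k e_{t(q)}\Lambda$ obtained from the values $\phi((e_{t(q)}\otimes e_{s(q)})_q)\in e_{t(q)}\Lambda\otimes_k\Lambda e_{s(q)}$ by exchanging the two tensor factors.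 3. The quiver of $\Pi(\Lambda)$ is the quiver $\tilde Q$ obtained from $Q$ by adding an arrow $a_q:t(q)\to s(q)$ for each $q\in\mathcal B_n$: there is an isomorphism of $k$-algebras $$k\tilde Q\big/\langle M,\ r_p\ (p\in\mathcal B_{n-1})\rangle\;\cong\;\Pi(\Lambda),\qquad r_p=\sum_{q\in\mathcal B_n}a_q\,(\delta^{\mathcal R}_pq)+(-1)^n\sum_{q\in\mathcal B_n}(\delta^{\mathcal L}_pq)\,a_q ,$$ which restricts to the canonical map $kQ\to\Lambda\subseteq\Pi(\Lambda)$ and sends every $a_q$ into $\mathrm{Ext}^n_\Lambda(D\Lambda,\Lambda)$, and all the relations (those in $M$ and the $r_p$) are quadratic, i.e. linear combinations of paths of length $2$ in $\tilde Q$. -/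

import Mathlib

universe u

open CategoryTheory MulOpposite
open scoped TensorProduct

noncomputable section

namespace HigherPreproj

/-! ### Tensor algebras of bimodules and quotients by relations -/

section TensorAlgebraOfBimodule

variable (k : Type u) [Field k] (S : Type u) [Ring S] [Algebra k S]
  (V : Type u) [AddCommGroup V] [Module S V] [Module Sᵐᵒᵖ V]

/-- The defining relations of `T_S V` on the free `k`-algebra on the symbols `s ∈ S`, `v ∈ V`. -/
inductive TensorRel : FreeAlgebra k (S ⊕ V) → FreeAlgebra k (S ⊕ V) → Prop
  | scalar (c : k) :
      TensorRel (FreeAlgebra.ι k (Sum.inl (algebraMap k S c))) (algebraMap k _ c)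
  | base_add (s t : S) :
      TensorRel (FreeAlgebra.ι k (Sum.inl (s + t)))
        (FreeAlgebra.ι k (Sum.inl s) + FreeAlgebra.ι k (Sum.inl t))
  | base_mul (s t : S) :
      TensorRel (FreeAlgebra.ι k (Sum.inl (s * t)))
        (FreeAlgebra.ι k (Sum.inl s) * FreeAlgebra.ι k (Sum.inl t))
  | gen_add (v w : V) :
      TensorRel (FreeAlgebra.ι k (Sum.inr (v + w)))
        (FreeAlgebra.ι k (Sum.inr v) + FreeAlgebra.ι k (Sum.inr w))
  | smul_left (s : S) (v : V) :
      TensorRel (FreeAlgebra.ι k (Sum.inr (s • v)))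
        (FreeAlgebra.ι k (Sum.inl s) * FreeAlgebra.ι k (Sum.inr v))
  | smul_right (s : S) (v : V) :
      TensorRel (FreeAlgebra.ι k (Sum.inr (op s • v)))
        (FreeAlgebra.ι k (Sum.inr v) * FreeAlgebra.ι k (Sum.inl s))

/-- The tensor algebra `T_S V` of an `S`-bimodule `V` over a `k`-algebra `S`: the universal
`k`-algebra with an algebra map from `S` and an `S`-bimodule map from `V`. -/
def BimodTensorAlgebra : Type u := RingQuot (TensorRel k S V)

instance : Ring (BimodTensorAlgebra k S V) := inferInstanceAs (Ring (RingQuot (TensorRel k S V)))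

instance : Algebra k (BimodTensorAlgebra k S V) :=
  inferInstanceAs (Algebra k (RingQuot (TensorRel k S V)))

namespace BimodTensorAlgebra

/-- The quotient map from the free algebra. -/
def ofFree : FreeAlgebra k (S ⊕ V) →ₐ[k] BimodTensorAlgebra k S V :=
  RingQuot.mkAlgHom k (TensorRel k S V)

variable {k S V} in
theorem ofFree_rel {x y : FreeAlgebra k (S ⊕ V)} (h : TensorRel k S V x y) :
    ofFree k S V x = ofFree k S V y :=
  RingQuot.mkAlgHom_rel k h

/-- The structure map `S → T_S V`. -/
def base : S →ₐ[k] BimodTensorAlgebra k S V where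
  toFun s := ofFree k S V (FreeAlgebra.ι k (Sum.inl s))
  map_one' := by
    have h := ofFree_rel (TensorRel.scalar (k := k) (S := S) (V := V) 1)
    rw [map_one, map_one, map_one] at h
    exact h
  map_mul' s t := by
    rw [ofFree_rel (TensorRel.base_mul s t), map_mul]
  map_zero' := by
    have h := ofFree_rel (TensorRel.scalar (k := k) (S := S) (V := V) 0)
    rw [map_zero, map_zero, map_zero] at h
    exact h
  map_add' s t := by
    rw [ofFree_rel (TensorRel.base_add s t), map_add]
  commutes' c := by
    rw [ofFree_rel (TensorRel.scalar c), AlgHom.commutes]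

/-- The structure map `V → T_S V`. -/
def gen : V →+ BimodTensorAlgebra k S V :=
  AddMonoidHom.mk' (fun v => ofFree k S V (FreeAlgebra.ι k (Sum.inr v))) fun v w => by
    rw [ofFree_rel (TensorRel.gen_add v w), map_add]

variable {k S V} in
/-- The universal property of `T_S V`. -/
def lift {R : Type u} [Ring R] [Algebra k R] (f : S →ₐ[k] R) (g : V →+ R)
    (hl : ∀ s v, g (s • v) = f s * g v) (hr : ∀ s v, g (op s • v) = g v * f s) :
    BimodTensorAlgebra k S V →ₐ[k] R :=
  RingQuot.liftAlgHom k ⟨FreeAlgebra.lift k (Sum.elim f g), by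
    intro x y h
    cases h <;> simp [hl, hr]⟩

end BimodTensorAlgebra

end TensorAlgebraOfBimodule

section QuotientByRelations

variable {k : Type u} [Field k] {T : Type u} [Ring T] [Algebra k T]

/-- The quotient `T/⟨X⟩` of a `k`-algebra `T` by the two-sided ideal generated by `X`. -/
def QuotAlg (X : Set T) : Type u := RingQuot fun x y : T => x ∈ X ∧ y = 0

instance (X : Set T) : Ring (QuotAlg X) :=
  inferInstanceAs (Ring (RingQuot fun x y : T => x ∈ X ∧ y = 0))

instance (X : Set T) : Algebra k (QuotAlg X) :=
  inferInstanceAs (Algebra k (RingQuot fun x y : T => x ∈ X ∧ y = 0))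

variable (k) in
/-- The projection `T → T/⟨X⟩`. -/
def QuotAlg.mk (X : Set T) : T →ₐ[k] QuotAlg X :=
  RingQuot.mkAlgHom k fun x y : T => x ∈ X ∧ y = 0

end QuotientByRelations

/-! ### Quivers and path algebras -/

/-- A quiver with vertex set `I`. -/
structure QuiverOn (I : Type u) where
  /-- the arrows -/
  Arrow : Type u
  /-- the source of an arrow -/
  src : Arrow → I
  /-- the target of an arrow -/
  tgt : Arrow → I

section PathAlgebra

variable (k : Type u) [Field k] {I : Type u} (Q : QuiverOn I)

/-- The space `V` of formal linear combinations of the arrows of a quiver with finitely many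
arrows, written as functions on the arrows. -/
def ArrowSpace : Type u := Q.Arrow → k

instance : AddCommGroup (ArrowSpace k Q) := inferInstanceAs (AddCommGroup (Q.Arrow → k))

/-- The left action of `S = k^I` on `V`: for an arrow `a : i → j`, `e_j a = a`. -/
instance : Module (I → k) (ArrowSpace k Q) where
  smul s v := fun a => s (Q.tgt a) * v a
  one_smul v := funext fun a => one_mul (v a)
  mul_smul s t v := funext fun a => mul_assoc (s (Q.tgt a)) (t (Q.tgt a)) (v a)
  smul_zero s := funext fun a => mul_zero (s (Q.tgt a))
  smul_add s v w := funext fun a => mul_add (s (Q.tgt a)) (v a) (w a)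
  add_smul s t v := funext fun a => add_mul (s (Q.tgt a)) (t (Q.tgt a)) (v a)
  zero_smul v := funext fun a => zero_mul (v a)

/-- The right action of `S = k^I` on `V`: for an arrow `a : i → j`, `a e_i = a`. -/
instance : Module (I → k)ᵐᵒᵖ (ArrowSpace k Q) where
  smul s v := fun a => v a * unop s (Q.src a)
  one_smul v := funext fun a => mul_one (v a)
  mul_smul s t v := funext fun a =>
    (mul_assoc (v a) (unop t (Q.src a)) (unop s (Q.src a))).symm
  smul_zero s := funext fun a => zero_mul (unop s (Q.src a))
  smul_add s v w := funext fun a => add_mul (v a) (w a) (unop s (Q.src a))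
  add_smul s t v := funext fun a => mul_add (v a) (unop s (Q.src a)) (unop t (Q.src a))
  zero_smul v := funext fun a => mul_zero (v a)

/-- The path algebra `kQ = T_S V` of a finite quiver. A product `y * x` is the path `x` followed
by the path `y`. -/
abbrev PathAlgebra : Type u := BimodTensorAlgebra k (I → k) (ArrowSpace k Q)

open Classical in
/-- The idempotent `e_i` of the path algebra. -/
def vertex (i : I) : PathAlgebra k Q :=
  BimodTensorAlgebra.base k (I → k) (ArrowSpace k Q) (Pi.single i 1)

open Classical in
/-- An arrow, as an element of the path algebra. -/
def arrow (a : Q.Arrow) : PathAlgebra k Q :=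
  BimodTensorAlgebra.gen k (I → k) (ArrowSpace k Q) (Pi.single a (1 : k) : Q.Arrow → k)

/-- The subspace `V ⊆ T_S V`. -/
def arrowSpan : Submodule k (PathAlgebra k Q) :=
  Submodule.span k (Set.range (BimodTensorAlgebra.gen k (I → k) (ArrowSpace k Q)))

/-- The subspace `V^{⊗_S l} ⊆ T_S V` (with `V^{⊗_S 0} = S`). -/
def pathSpan (l : ℕ) : Submodule k (PathAlgebra k Q) :=
  Subalgebra.toSubmodule (BimodTensorAlgebra.base k (I → k) (ArrowSpace k Q)).range *
    arrowSpan k Q ^ l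

variable {k Q}

/-- `M` is an `S`-subbimodule of `V ⊗_S V`. -/
def IsQuadratic (M : Submodule k (PathAlgebra k Q)) : Prop :=
  M ≤ arrowSpan k Q ^ 2 ∧ ∀ i, ∀ x ∈ M, vertex k Q i * x ∈ M ∧ x * vertex k Q i ∈ M

/-- `K_l = ⋂_μ V^{⊗ μ} ⊗ M ⊗ V^{⊗ (l - μ - 2)} ⊆ V^{⊗ l}`; so `K_0 = S` and `K_1 = V`. -/
def koszulSpace (M : Submodule k (PathAlgebra k Q)) (l : ℕ) : Submodule k (PathAlgebra k Q) :=
  pathSpan k Q l ⊓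
    ⨅ (μ : ℕ) (_ : μ + 2 ≤ l), arrowSpan k Q ^ μ * M * arrowSpan k Q ^ (l - μ - 2)

/-- The algebra `Λ = T_S V/⟨M⟩ = kQ/⟨M⟩`. -/
abbrev QuiverAlgebra (M : Submodule k (PathAlgebra k Q)) : Type u :=
  QuotAlg (M : Set (PathAlgebra k Q))

/-- The projection `kQ → Λ`. -/
def toQuiverAlgebra (M : Submodule k (PathAlgebra k Q)) :
    PathAlgebra k Q →ₐ[k] QuiverAlgebra M :=
  QuotAlg.mk k (M : Set (PathAlgebra k Q))

/-- The grading of `Λ` by path length. -/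
def lengthGrading (M : Submodule k (PathAlgebra k Q)) (l : ℕ) : Submodule k (QuiverAlgebra M) :=
  (pathSpan k Q l).map (toQuiverAlgebra M).toLinearMap

end PathAlgebra

/-! ### Koszul algebras -/

section Koszul

variable {k : Type u} [Field k] {A : Type u} [Ring A] [Algebra k A]

/-- The left ideal `A_+ = ⨁_{m ≥ 1} A_m` of a positively graded algebra. -/
def augIdeal (𝒜 : ℕ → Submodule k A) : Submodule A A :=
  Submodule.span A (⋃ m : ℕ, (𝒜 (m + 1) : Set A))

/-- A positively graded algebra `A` is Koszul if the graded left module `S = A/A_+`, concentrated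
in degree `0`, has a graded projective resolution `⋯ → P 1 → P 0 → S → 0` with `P l` generated in
degree `l`. -/
def IsKoszul (𝒜 : ℕ → Submodule k A) : Prop :=
  ∃ (P : ℕ → ModuleCat.{u} A) (𝒢 : ∀ l, ℤ → AddSubgroup (P l))
    (d : ∀ l, P (l + 1) →ₗ[A] P l) (ε : P 0 →ₗ[A] A ⧸ augIdeal 𝒜),
    (∀ l, DirectSum.IsInternal (𝒢 l)) ∧
    (∀ l m i, ∀ a ∈ 𝒜 m, ∀ x ∈ 𝒢 l i, a • x ∈ 𝒢 l (m + i)) ∧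
    (∀ l i, ∀ x ∈ 𝒢 (l + 1) i, d l x ∈ 𝒢 l i) ∧
    (∀ i, i ≠ 0 → ∀ x ∈ 𝒢 0 i, ε x = 0) ∧
    (∀ l, Module.Projective A (P l)) ∧
    Function.Surjective ε ∧
    Function.Exact (d 0) ε ∧
    (∀ l, Function.Exact (d (l + 1)) (d l)) ∧
    (∀ l : ℕ, Submodule.span A (𝒢 l l : Set (P l)) = ⊤)

end Koszul

/-! ### The bimodule `DA` and the inverse Serre functor -/

section Serre

variable (k : Type u) [Field k] (A : Type u) [Ring A] [Algebra k A]

/-- The `A`-bimodule `DA = Hom_k(A, k)`, with `(a ξ b)(x) = ξ(b x a)`. -/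
def LinDual : Type u := A →ₗ[k] k

instance : AddCommGroup (LinDual k A) := inferInstanceAs (AddCommGroup (A →ₗ[k] k))

instance : Module A (LinDual k A) where
  smul a ξ := LinearMap.comp (show A →ₗ[k] k from ξ) (LinearMap.mulRight k a)
  one_smul ξ := LinearMap.ext fun x => congrArg (show A →ₗ[k] k from ξ) (mul_one x)
  mul_smul a b ξ := LinearMap.ext fun x =>
    congrArg (show A →ₗ[k] k from ξ) (mul_assoc x a b).symm
  smul_zero _ := rfl
  smul_add _ _ _ := rfl
  add_smul a b ξ := LinearMap.ext fun x =>
    (congrArg (show A →ₗ[k] k from ξ) (mul_add x a b)).trans (map_add (show A →ₗ[k] k from ξ) _ _)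
  zero_smul ξ := LinearMap.ext fun x =>
    (congrArg (show A →ₗ[k] k from ξ) (mul_zero x)).trans (map_zero (show A →ₗ[k] k from ξ))

instance : Module Aᵐᵒᵖ (LinDual k A) where
  smul a ξ := LinearMap.comp (show A →ₗ[k] k from ξ) (LinearMap.mulLeft k (unop a))
  one_smul ξ := LinearMap.ext fun x => congrArg (show A →ₗ[k] k from ξ) (one_mul x)
  mul_smul a b ξ := LinearMap.ext fun x =>
    congrArg (show A →ₗ[k] k from ξ) (mul_assoc (unop b) (unop a) x)
  smul_zero _ := rfl
  smul_add _ _ _ := rfl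
  add_smul a b ξ := LinearMap.ext fun x =>
    (congrArg (show A →ₗ[k] k from ξ) (add_mul (unop a) (unop b) x)).trans
      (map_add (show A →ₗ[k] k from ξ) _ _)
  zero_smul ξ := LinearMap.ext fun x =>
    (congrArg (show A →ₗ[k] k from ξ) (zero_mul x)).trans (map_zero (show A →ₗ[k] k from ξ))

instance : SMulCommClass Aᵐᵒᵖ A (LinDual k A) where
  smul_comm a b ξ := LinearMap.ext fun x =>
    congrArg (show A →ₗ[k] k from ξ) (mul_assoc (unop a) x b)

/-- The endomorphism `ξ ↦ ξ b` of the left `A`-module `DA`. -/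
def rightMulDual (b : A) : LinDual k A →ₗ[A] LinDual k A :=
  Module.toModuleEnd A (S := Aᵐᵒᵖ) (LinDual k A) (op b)

/-- `Hom_A(DA, N)` for a left `A`-module `N`. -/
def HomFromDual (N : Type u) [AddCommGroup N] [Module A N] : Type u := LinDual k A →ₗ[A] N

instance (N : Type u) [AddCommGroup N] [Module A N] : AddCommGroup (HomFromDual k A N) :=
  inferInstanceAs (AddCommGroup (LinDual k A →ₗ[A] N))

/-- The left `A`-module structure `(a f)(ξ) = f(ξ a)`. -/
instance (N : Type u) [AddCommGroup N] [Module A N] : Module A (HomFromDual k A N) where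
  smul a f := LinearMap.comp (show LinDual k A →ₗ[A] N from f) (rightMulDual k A a)
  one_smul f := LinearMap.ext fun ξ =>
    congrArg (show LinDual k A →ₗ[A] N from f) (one_smul Aᵐᵒᵖ ξ)
  mul_smul a b f := LinearMap.ext fun ξ =>
    congrArg (show LinDual k A →ₗ[A] N from f) (mul_smul (op b) (op a) ξ)
  smul_zero _ := rfl
  smul_add _ _ _ := rfl
  add_smul a b f := LinearMap.ext fun ξ =>
    (congrArg (show LinDual k A →ₗ[A] N from f) (add_smul (op a) (op b) ξ)).trans
      (map_add (show LinDual k A →ₗ[A] N from f) _ _)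
  zero_smul f := LinearMap.ext fun ξ =>
    (congrArg (show LinDual k A →ₗ[A] N from f) (zero_smul Aᵐᵒᵖ ξ)).trans
      (map_zero (show LinDual k A →ₗ[A] N from f))

/-- The functor `Hom_A(DA, -)` on left `A`-modules. -/
def homFromDual : ModuleCat.{u} A ⥤ ModuleCat.{u} A where
  obj N := ModuleCat.of A (HomFromDual k A N)
  map g := ModuleCat.ofHom
    { toFun := fun f => LinearMap.comp g.hom (show LinDual k A →ₗ[A] _ from f)
      map_add' := fun _ _ => LinearMap.comp_add _ _ _
      map_smul' := fun _ _ => rfl }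
  map_id _ := rfl
  map_comp _ _ := rfl

instance : (homFromDual k A).Additive where
  map_add {_ _ f g} := by
    ext x
    rfl

variable {A} in
/-- `Y` is a model of `𝕊_n⁻¹ X = RHom_A(DA, X)[n]`: it is computed by applying `Hom_A(DA, -)` to a
bounded below complex of injectives quasi-isomorphic to `X`. -/
def IsInvSerre (n : ℕ) (X Y : CochainComplex (ModuleCat.{u} A) ℤ) : Prop :=
  ∃ (J : CochainComplex (ModuleCat.{u} A) ℤ) (φ : X ⟶ J),
    QuasiIso φ ∧ (∀ i, Injective (J.X i)) ∧ (∃ b : ℤ, J.IsStrictlyGE b) ∧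
    Nonempty (Y ≅ (((homFromDual k A).mapHomologicalComplex _).obj J)⟦(n : ℤ)⟧)

/-- The (left) global dimension. -/
def globalDimension : WithBot ℕ∞ := ⨆ N : ModuleCat.{u} A, projectiveDimension N

/-- A finite-dimensional algebra `A` of global dimension `n` is `n`-representation-infinite if
every `𝕊_n^{-l}(A)`, `l ≥ 0`, has cohomology in degree `0` only. -/
def IsRepresentationInfinite (n : ℕ) : Prop :=
  FiniteDimensional k A ∧ globalDimension A = n ∧
    ∃ X : ℕ → CochainComplex (ModuleCat.{u} A) ℤ,
      Nonempty (X 0 ≅ (CochainComplex.singleFunctor (ModuleCat.{u} A) 0).obj (ModuleCat.of A A)) ∧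
      (∀ l, IsInvSerre k n (X l) (X (l + 1))) ∧
      ∀ l, ∀ i : ℤ, i ≠ 0 → (X l).ExactAt i

end Serre

/-! ### Bimodule structures on Ext groups -/

section ExtActions

variable {R : Type u} [Ring R] (X Y : Type u) [AddCommGroup X] [Module R X] [AddCommGroup Y]
  [Module R Y] (n : ℕ) (B : Type u) [Ring B]

/-- `Ext^n_R(X, Y)` for left `R`-modules. -/
abbrev ExtGroup : Type u :=
  CategoryTheory.Abelian.Ext (ModuleCat.of R X) (ModuleCat.of R Y) n

/-- An action of `B` on `Y` by `R`-linear maps induces an action on `Ext^n_R(X, Y)`. -/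
abbrev extModuleRight (ρ : B →+* Module.End R Y) : Module B (ExtGroup (R := R) X Y n) where
  smul b x := x.comp (Abelian.Ext.mk₀ (ModuleCat.ofHom (ρ b))) (add_zero n)
  one_smul x := by
    change x.comp (Abelian.Ext.mk₀ (ModuleCat.ofHom (ρ 1))) (add_zero n) = x
    rw [map_one]
    exact Abelian.Ext.comp_mk₀_id x
  mul_smul b c x := by
    change x.comp (Abelian.Ext.mk₀ (ModuleCat.ofHom (ρ (b * c)))) (add_zero n) =
      (x.comp (Abelian.Ext.mk₀ (ModuleCat.ofHom (ρ c))) (add_zero n)).comp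
        (Abelian.Ext.mk₀ (ModuleCat.ofHom (ρ b))) (add_zero n)
    rw [Abelian.Ext.comp_assoc_of_third_deg_zero, Abelian.Ext.mk₀_comp_mk₀, map_mul]
    rfl
  smul_zero b := Abelian.Ext.zero_comp _ _ _ _ (add_zero n)
  smul_add b x y := Abelian.Ext.add_comp _ _ _ _
  add_smul b c x := by
    change x.comp (Abelian.Ext.mk₀ (ModuleCat.ofHom (ρ (b + c)))) (add_zero n) =
      x.comp (Abelian.Ext.mk₀ (ModuleCat.ofHom (ρ b))) (add_zero n) +
        x.comp (Abelian.Ext.mk₀ (ModuleCat.ofHom (ρ c))) (add_zero n)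
    rw [map_add, ModuleCat.ofHom_add, Abelian.Ext.mk₀_add, Abelian.Ext.comp_add]
  zero_smul x := by
    change x.comp (Abelian.Ext.mk₀ (ModuleCat.ofHom (ρ 0))) (add_zero n) = 0
    rw [map_zero, ModuleCat.ofHom_zero, Abelian.Ext.mk₀_zero, Abelian.Ext.comp_zero]

/-- A right action of `B` on `X` by `R`-linear maps induces a left action on `Ext^n_R(X, Y)`. -/
abbrev extModuleLeft (ρ : Bᵐᵒᵖ →+* Module.End R X) : Module B (ExtGroup (R := R) X Y n) where
  smul b x := (Abelian.Ext.mk₀ (ModuleCat.ofHom (ρ (op b)))).comp x (zero_add n)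
  one_smul x := by
    change (Abelian.Ext.mk₀ (ModuleCat.ofHom (ρ 1))).comp x (zero_add n) = x
    rw [map_one]
    exact Abelian.Ext.mk₀_id_comp x
  mul_smul b c x := by
    change (Abelian.Ext.mk₀ (ModuleCat.ofHom (ρ (op c * op b)))).comp x (zero_add n) =
      (Abelian.Ext.mk₀ (ModuleCat.ofHom (ρ (op b)))).comp
        ((Abelian.Ext.mk₀ (ModuleCat.ofHom (ρ (op c)))).comp x (zero_add n)) (zero_add n)
    rw [Abelian.Ext.mk₀_comp_mk₀_assoc, map_mul]
    rfl
  smul_zero b := Abelian.Ext.comp_zero _ _ _ _ (zero_add n)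
  smul_add b x y := Abelian.Ext.comp_add _ _ _ _
  add_smul b c x := by
    change (Abelian.Ext.mk₀ (ModuleCat.ofHom (ρ (op b + op c)))).comp x (zero_add n) =
      (Abelian.Ext.mk₀ (ModuleCat.ofHom (ρ (op b)))).comp x (zero_add n) +
        (Abelian.Ext.mk₀ (ModuleCat.ofHom (ρ (op c)))).comp x (zero_add n)
    rw [map_add, ModuleCat.ofHom_add, Abelian.Ext.mk₀_add, Abelian.Ext.add_comp]
  zero_smul x := by
    change (Abelian.Ext.mk₀ (ModuleCat.ofHom (ρ (op 0)))).comp x (zero_add n) = 0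
    rw [op_zero, map_zero, ModuleCat.ofHom_zero, Abelian.Ext.mk₀_zero, Abelian.Ext.zero_comp]

end ExtActions

section PreprojectiveAlgebra

variable (k : Type u) [Field k] (A : Type u) [Ring A] [Algebra k A] (n : ℕ)

/-- `Ext^n_A(DA, A)`, for left `A`-modules. -/
def DualExt : Type u := ExtGroup (R := A) (LinDual k A) A n

instance : AddCommGroup (DualExt k A n) :=
  inferInstanceAs (AddCommGroup (ExtGroup (R := A) (LinDual k A) A n))

/-- The left action of `A` on `Ext^n_A(DA, A)` comes from the right action on `DA`. -/
instance : Module A (DualExt k A n) :=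
  extModuleLeft (LinDual k A) A n A (Module.toModuleEnd A (S := Aᵐᵒᵖ) (LinDual k A))

/-- The right action of `A` on `Ext^n_A(DA, A)` comes from the right action on `A`. -/
instance : Module Aᵐᵒᵖ (DualExt k A n) :=
  extModuleRight (LinDual k A) A n Aᵐᵒᵖ (Module.toModuleEnd A (S := Aᵐᵒᵖ) A)

/-- The `(n+1)`-preprojective algebra `Π(A) = T_A Ext^n_A(DA, A)`. -/
abbrev Preprojective : Type u := BimodTensorAlgebra k A (DualExt k A n)

/-- The enveloping algebra `A^e = A ⊗_k A^op`; a left `A^e`-module is an `A`-bimodule, with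
`(a ⊗ op b) x = a x b`. -/
abbrev Env : Type u := A ⊗[k] Aᵐᵒᵖ

/-- `A` as an `A`-bimodule, that is, as a left `A^e`-module. -/
def EnvSelf : Type u := A

instance : AddCommGroup (EnvSelf A) := inferInstanceAs (AddCommGroup A)

instance : Module (Env k A) (EnvSelf A) :=
  letI : Module (A ⊗[k] Aᵐᵒᵖ) A := TensorProduct.Algebra.module
  inferInstanceAs (Module (A ⊗[k] Aᵐᵒᵖ) A)

/-- `Ext^n_{A^e}(A, A^e)`, where `A^e` has the bimodule structure `a (x ⊗ op y) b = a x ⊗ op (y b)`. -/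
def EnvExt : Type u := ExtGroup (R := Env k A) (EnvSelf A) (Env k A) n

instance : AddCommGroup (EnvExt k A n) :=
  inferInstanceAs (AddCommGroup (ExtGroup (R := Env k A) (EnvSelf A) (Env k A) n))

/-- `a ↦ (z ↦ z (1 ⊗ op a))`, the left action of `A` on `A^e` for the inner bimodule structure
`a ∗ (x ⊗ op y) ∗ b = x b ⊗ op (a y)`. -/
def innerLeft : A →+* Module.End (Env k A) (Env k A) where
  toFun a := Module.toModuleEnd (Env k A) (S := (Env k A)ᵐᵒᵖ) (Env k A) (op (1 ⊗ₜ[k] op a))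
  map_one' := map_one (Module.toModuleEnd (Env k A) (S := (Env k A)ᵐᵒᵖ) (Env k A))
  map_mul' a b := by
    rw [← map_mul, ← op_mul, Algebra.TensorProduct.tmul_mul_tmul, mul_one, op_mul]
  map_zero' := by rw [MulOpposite.op_zero, TensorProduct.tmul_zero, MulOpposite.op_zero, map_zero]
  map_add' a b := by rw [MulOpposite.op_add, TensorProduct.tmul_add, MulOpposite.op_add, map_add]

/-- `op b ↦ (z ↦ z (b ⊗ 1))`, the right action of `A` on `A^e` for the inner bimodule
structure. -/
def innerRight : Aᵐᵒᵖ →+* Module.End (Env k A) (Env k A) where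
  toFun b := Module.toModuleEnd (Env k A) (S := (Env k A)ᵐᵒᵖ) (Env k A) (op (unop b ⊗ₜ[k] 1))
  map_one' := map_one (Module.toModuleEnd (Env k A) (S := (Env k A)ᵐᵒᵖ) (Env k A))
  map_mul' a b := by
    rw [← map_mul, ← op_mul, Algebra.TensorProduct.tmul_mul_tmul, mul_one, unop_mul]
  map_zero' := by rw [MulOpposite.unop_zero, TensorProduct.zero_tmul, MulOpposite.op_zero, map_zero]
  map_add' a b := by rw [MulOpposite.unop_add, TensorProduct.add_tmul, MulOpposite.op_add, map_add]

instance : Module A (EnvExt k A n) :=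
  extModuleRight (EnvSelf A) (Env k A) n A (innerLeft k A)

instance : Module Aᵐᵒᵖ (EnvExt k A n) :=
  extModuleRight (EnvSelf A) (Env k A) n Aᵐᵒᵖ (innerRight k A)

variable {A} in
/-- The projective bimodule `A x ⊗_k y A`, as the left ideal `A^e (x ⊗ op y)` of `A^e`. -/
abbrev projBimod (x y : A) : Submodule (Env k A) (Env k A) :=
  Submodule.span (Env k A) {x ⊗ₜ[k] op y}

variable {A} in
/-- The generator `x ⊗ y` of `A x ⊗_k y A`. -/
def projGen (x y : A) : projBimod k x y := ⟨x ⊗ₜ[k] op y, Submodule.mem_span_singleton_self _⟩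

/-- The flip `a ⊗ op b ↦ b ⊗ op a` of `A^e`. -/
def envFlip : Env k A →ₗ[k] Env k A :=
  (TensorProduct.map (opLinearEquiv k).symm.toLinearMap (opLinearEquiv k).toLinearMap).comp
    (TensorProduct.comm k A Aᵐᵒᵖ).toLinearMap

end PreprojectiveAlgebra

/-! ### The new arrows and relations -/

section Construction

variable {k : Type u} [Field k] {I : Type u} {Q : QuiverOn I}

/-- A `k`-basis `q` of a space of linear combinations of paths, each `q b` being a combination of
paths `s b → t b`. -/
structure IsPathBasis (W : Submodule k (PathAlgebra k Q)) {B : Type u}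
    (q : B → PathAlgebra k Q) (s t : B → I) : Prop where
  linearIndependent : LinearIndependent k q
  span_eq : Submodule.span k (Set.range q) = W
  homogeneous : ∀ b, vertex k Q (t b) * q b * vertex k Q (s b) = q b

/-- `δL c b = δ^L_{p_c} q_b`, i.e. `q_b = ∑_c p_c ⊗ δL c b` with `δL c b ∈ e_{s(p_c)} V`. -/
def IsLeftDerivative {B C : Type u} [Fintype C] (q : B → PathAlgebra k Q)
    (p : C → PathAlgebra k Q) (sp : C → I) (δL : C → B → PathAlgebra k Q) : Prop :=
  ∀ b, (∀ c, δL c b ∈ arrowSpan k Q ∧ vertex k Q (sp c) * δL c b = δL c b) ∧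
    q b = ∑ c, p c * δL c b

/-- `δR c b = δ^R_{p_c} q_b`, i.e. `q_b = ∑_c δR c b ⊗ p_c` with `δR c b ∈ V e_{t(p_c)}`. -/
def IsRightDerivative {B C : Type u} [Fintype C] (q : B → PathAlgebra k Q)
    (p : C → PathAlgebra k Q) (tp : C → I) (δR : C → B → PathAlgebra k Q) : Prop :=
  ∀ b, (∀ c, δR c b ∈ arrowSpan k Q ∧ δR c b * vertex k Q (tp c) = δR c b) ∧
    q b = ∑ c, δR c b * p c

section Ext

variable (M : Submodule k (PathAlgebra k Q))

/-- The image of `e_i` in `Λ`. -/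
def idem (i : I) : QuiverAlgebra M := toQuiverAlgebra M (vertex k Q i)

/-- The bimodule `⨁_b Λ e_{x b} ⊗_k e_{y b} Λ` (for a finite index type). -/
def sumBimod {B : Type u} (x y : B → I) : Type u :=
  ∀ b, projBimod k (idem M (x b)) (idem M (y b))

instance {B : Type u} (x y : B → I) : AddCommGroup (sumBimod M x y) :=
  inferInstanceAs (AddCommGroup (∀ b, projBimod k (idem M (x b)) (idem M (y b))))

instance {B : Type u} (x y : B → I) : Module (Env k (QuiverAlgebra M)) (sumBimod M x y) :=
  inferInstanceAs (Module (Env k (QuiverAlgebra M))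
    (∀ b, projBimod k (idem M (x b)) (idem M (y b))))

variable {B C : Type u} (n : ℕ) (δL δR : C → B → PathAlgebra k Q)

/-- The differential `f` of the Koszul bimodule complex, from `⨁_q Λ e_{t q} ⊗ e_{s q} Λ` to
`⨁_p Λ e_{t p} ⊗ e_{s p} Λ`, on the generator `(e_{t q} ⊗ e_{s q})_q`: the component at `p` is
`δ^R_p q ⊗ e_{s p} + (-1)^n e_{t p} ⊗ δ^L_p q`. -/
def koszulDiff (sp tp : C → I) (b : B) : sumBimod M tp sp := fun c =>
  (toQuiverAlgebra M (δR c b) ⊗ₜ[k] (1 : (QuiverAlgebra M)ᵐᵒᵖ) +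
    (-1) ^ n • ((1 : QuiverAlgebra M) ⊗ₜ[k] op (toQuiverAlgebra M (δL c b)))) •
    projGen k (idem M (tp c)) (idem M (sp c))

/-- The element of `⨁_q Λ e_{s q} ⊗ e_{t q} Λ` attached to `p`: its component at `q` is
`e_{s q} ⊗ δ^R_p q + (-1)^n δ^L_p q ⊗ e_{t q}`. -/
def dualKoszulElement (sq tq : B → I) (c : C) : sumBimod M sq tq := fun b =>
  ((1 : QuiverAlgebra M) ⊗ₜ[k] op (toQuiverAlgebra M (δR c b)) +
    (-1) ^ n • (toQuiverAlgebra M (δL c b) ⊗ₜ[k] (1 : (QuiverAlgebra M)ᵐᵒᵖ))) •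
    projGen k (idem M (sq b)) (idem M (tq b))

/-- The subbimodule of `⨁_q Λ e_{s q} ⊗ e_{t q} Λ` generated by the elements attached to the `p`. -/
def dualKoszulSubmodule (sq tq : B → I) :
    Submodule (Env k (QuiverAlgebra M)) (sumBimod M sq tq) :=
  Submodule.span _ (Set.range (dualKoszulElement M n δL δR sq tq))

end Ext

/-- The quiver obtained from `Q` by adding an arrow `a_b : t b → s b` for each `b`. -/
def extendQuiver (Q : QuiverOn I) {B : Type u} (s t : B → I) : QuiverOn I where
  Arrow := Q.Arrow ⊕ B
  src := Sum.elim Q.src t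
  tgt := Sum.elim Q.tgt s

variable {B C : Type u} (sq tq : B → I)

/-- The inclusion of arrow spaces induced by the inclusion of `Q` in the extended quiver. -/
def inclArrow : ArrowSpace k Q →+ ArrowSpace k (extendQuiver Q sq tq) :=
  AddMonoidHom.mk' (fun v : Q.Arrow → k => (Sum.elim v 0 : Q.Arrow ⊕ B → k)) fun v w => by
    funext a
    rcases a with a | b
    · rfl
    · exact (add_zero (0 : k)).symm

/-- The inclusion of path algebras induced by the inclusion of `Q` in the extended quiver. -/
def inclPath : PathAlgebra k Q →ₐ[k] PathAlgebra k (extendQuiver Q sq tq) :=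
  BimodTensorAlgebra.lift (BimodTensorAlgebra.base k (I → k) _)
    ((BimodTensorAlgebra.gen k (I → k) (ArrowSpace k (extendQuiver Q sq tq))).comp
      (inclArrow sq tq))
    (by
      intro s v
      have h := BimodTensorAlgebra.ofFree_rel (TensorRel.smul_left (k := k) s
        (inclArrow sq tq v))
      rw [map_mul] at h
      refine Eq.trans (congrArg (BimodTensorAlgebra.gen k (I → k) _) ?_) h
      funext a
      rcases a with a | b
      · rfl
      · exact (mul_zero _).symm)
    (by
      intro s v
      have h := BimodTensorAlgebra.ofFree_rel (TensorRel.smul_right (k := k) s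
        (inclArrow sq tq v))
      rw [map_mul] at h
      refine Eq.trans (congrArg (BimodTensorAlgebra.gen k (I → k) _) ?_) h
      funext a
      rcases a with a | b
      · rfl
      · exact (zero_mul _).symm)

/-- The new arrow `a_b`, in the path algebra of the extended quiver. -/
def newArrow (b : B) : PathAlgebra k (extendQuiver Q sq tq) :=
  arrow k (extendQuiver Q sq tq) (Sum.inr b)

/-- The new relation attached to `p`: `∑_q a_q (δ^R_p q) + (-1)^n ∑_q (δ^L_p q) a_q`. -/
def newRelation [Fintype B] (n : ℕ) (δL δR : C → B → PathAlgebra k Q) (c : C) :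
    PathAlgebra k (extendQuiver Q sq tq) :=
  ∑ b, newArrow sq tq b * inclPath sq tq (δR c b) +
    (-1) ^ n * ∑ b, inclPath sq tq (δL c b) * newArrow sq tq b

/-- The relations of `Λ` together with the new relations. -/
def allRelations [Fintype B] (M : Submodule k (PathAlgebra k Q)) (n : ℕ)
    (δL δR : C → B → PathAlgebra k Q) : Set (PathAlgebra k (extendQuiver Q sq tq)) :=
  inclPath sq tq '' (M : Set (PathAlgebra k Q)) ∪ Set.range (newRelation sq tq n δL δR)

end Construction

end HigherPreproj

end

open HigherPreproj

noncomputable section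

namespace HigherPreproj

/-! ### Tensor algebras: generators and homomorphisms -/

namespace BimodTensorAlgebra

variable {k : Type u} [Field k] {S : Type u} [Ring S] [Algebra k S]
  {V : Type u} [AddCommGroup V] [Module S V] [Module Sᵐᵒᵖ V]

/-! The Koszul complex computes both `Ext^n_{Λ^e}(Λ, Λ^e)` and `Ext^n_Λ(DΛ, Λ)`, and it presents
them by the same generators and relations; a tensor algebra on a bimodule so presented is a path
algebra modulo the corresponding relations.

Derivatives. All tensor powers over `S` live inside the path algebra. Contraction with functionals
on paths of fixed length shows that expansions along a homogeneous basis of `K_l` have unique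
coefficients. Together with `K_{l+1} ⊆ V K_l ∩ K_l V` this gives existence and uniqueness of the
derivatives (`existsUnique_isRightDerivative`, `existsUnique_isLeftDerivative`). The inclusions
`K_{l+2} ⊆ M V^l ∩ V^l M` make the composites of two right or of two left derivatives vanish in `Λ`,
and associativity lets left and right derivatives be exchanged (`sum_dR_tmul_dL`).

Koszul complexes. A linear resolution of `S` is determined inductively: its generators in degree `l`
correspond to a basis of `K_l`, and the differential is given by the right derivatives
(`IsKoszul.exists_covers`). Hence the left Koszul complex is exact in positive degrees. For a left
module `X` consider the complex with terms `⨁ Λ e_{t q} ⊗ e_{s q} X`, whose differential combines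
right and left derivatives with a sign. The part acting on `X` raises the degree of the coefficients
applied to `X`, and the degrees of `Λ` are bounded, so exactness follows by successive approximation
(`LeftExact.exists_eq_diff`, `exists_eq_diff_zero`). With `X = Λ` this is a projective bimodule
resolution of `Λ`, with `X = DΛ` a projective resolution of the left module `DΛ`.

Ext groups. In both cases the homomorphisms from `Λ ⊗ X` into the coefficient module are identified
with `Λ^e`, in such a way that the operators in the differential become right multiplications
(`HomData`). Minimality of the resolution of `S` and global dimension `n` give `K_{n+1} = 0`
(`isEmpty_idx`), so every form on the `n`-th term is a cocycle. The coboundaries form the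
sub-bimodule generated by the dual Koszul elements (`extOf_eq_zero_iff`), and the two outer actions
on Ext become the bimodule structure of `⨁ Λ e_{s q} ⊗ e_{t q} Λ`.

Presentation. Sending `a_q` to the class of the generator `e_{s q} ⊗ e_{t q}` turns `r_p` into the
dual Koszul element of `p`, so the universal properties give mutually inverse maps between `kQ̃`
modulo the relations and `T_Λ Ext^n_Λ(DΛ, Λ)` (`exists_quotAlg_equiv`). -/

theorem base_mul_gen (s : S) (v : V) : base k S V s * gen k S V v = gen k S V (s • v) := by
  have h := ofFree_rel (TensorRel.smul_left (k := k) s v)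
  rw [map_mul] at h
  exact h.symm

theorem gen_mul_base (s : S) (v : V) : gen k S V v * base k S V s = gen k S V (op s • v) := by
  have h := ofFree_rel (TensorRel.smul_right (k := k) s v)
  rw [map_mul] at h
  exact h.symm

@[simp] theorem lift_base {R : Type u} [Ring R] [Algebra k R] (f : S →ₐ[k] R) (g : V →+ R)
    (hl : ∀ s v, g (s • v) = f s * g v) (hr : ∀ s v, g (op s • v) = g v * f s) (s : S) :
    lift f g hl hr (base k S V s) = f s := by
  change RingQuot.liftAlgHom k _ (RingQuot.mkAlgHom k _ _) = _
  simp

@[simp] theorem lift_gen {R : Type u} [Ring R] [Algebra k R] (f : S →ₐ[k] R) (g : V →+ R)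
    (hl : ∀ s v, g (s • v) = f s * g v) (hr : ∀ s v, g (op s • v) = g v * f s) (v : V) :
    lift f g hl hr (gen k S V v) = g v := by
  change RingQuot.liftAlgHom k _ (RingQuot.mkAlgHom k _ _) = _
  simp

theorem algHom_ext {R : Type u} [Ring R] [Algebra k R] {f g : BimodTensorAlgebra k S V →ₐ[k] R}
    (hb : ∀ s, f (base k S V s) = g (base k S V s))
    (hg : ∀ v, f (gen k S V v) = g (gen k S V v)) : f = g := by
  refine RingQuot.ringQuot_ext' (S := k) _ _ (FreeAlgebra.hom_ext (funext fun x => ?_))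
  rcases x with s | v
  · exact hb s
  · exact hg v

/-- The universal property maps the tensor algebra into the subalgebra generated by `S` and `V`;
followed by the inclusion this is the identity, so the subalgebra is everything. -/
theorem adjoin_eq_top :
    Algebra.adjoin k (Set.range (base k S V) ∪ Set.range (gen k S V)) = ⊤ := by
  set U := Algebra.adjoin k (Set.range (base k S V) ∪ Set.range (gen k S V)) with hU
  have hb : ∀ s, base k S V s ∈ U := fun s => Algebra.subset_adjoin (Or.inl ⟨s, rfl⟩)
  have hg : ∀ v, gen k S V v ∈ U := fun v => Algebra.subset_adjoin (Or.inr ⟨v, rfl⟩)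
  let F : BimodTensorAlgebra k S V →ₐ[k] U :=
    lift ((base k S V).codRestrict U hb)
      (AddMonoidHom.mk' (fun v => (⟨gen k S V v, hg v⟩ : U)) fun v w => by
        ext; simp)
      (fun s v => by ext; simp [base_mul_gen]) (fun s v => by ext; simp [gen_mul_base])
  have h : U.val.comp F = AlgHom.id k _ := algHom_ext (by simp [F]) (by simp [F])
  rw [eq_top_iff]
  intro x _
  have := congrArg (fun G => G x) h
  simp only [AlgHom.comp_apply, AlgHom.id_apply] at this
  rw [← this]
  exact (F x).2

/-- Induction from the left factor: a property that holds for `1` and is stable under sums and under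
right multiplication by the generators holds everywhere. -/
theorem induction_right {P : BimodTensorAlgebra k S V → Prop} (h1 : P 1)
    (hadd : ∀ x y, P x → P y → P (x + y))
    (hb : ∀ x s, P x → P (x * base k S V s)) (hg : ∀ x v, P x → P (x * gen k S V v)) (x) : P x := by
  have key : ∀ y ∈ Algebra.adjoin k (Set.range (base k S V) ∪ Set.range (gen k S V)),
      ∀ x, P x → P (x * y) := by
    intro y hy
    induction hy using Algebra.adjoin_induction with
    | mem y hy =>
      rcases hy with ⟨s, rfl⟩ | ⟨v, rfl⟩
      · exact fun x hx => hb x s hx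
      · exact fun x hx => hg x v hx
    | algebraMap c =>
      intro x hx
      rw [← (base k S V).commutes c]
      exact hb x _ hx
    | add y z _ _ hy hz =>
      intro x hx
      rw [mul_add]
      exact hadd _ _ (hy x hx) (hz x hx)
    | mul y z _ _ hy hz =>
      intro x hx
      rw [← mul_assoc]
      exact hz _ (hy x hx)
  have := key x (by rw [adjoin_eq_top]; trivial) 1 h1
  rwa [one_mul] at this

end BimodTensorAlgebra

/-! ### Quotients by relations -/

namespace QuotAlg

variable {k : Type u} [Field k] {T : Type u} [Ring T] [Algebra k T] {X : Set T}

theorem mk_surjective : Function.Surjective (mk k X) := RingQuot.mkAlgHom_surjective k _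

theorem mk_eq_zero {x : T} (hx : x ∈ X) : mk k X x = 0 := by
  have : mk k X x = mk k X 0 := RingQuot.mkAlgHom_rel k (s := fun x y : T => x ∈ X ∧ y = 0) ⟨hx, rfl⟩
  rw [this, map_zero]

/-- The universal property of `T/⟨X⟩`. -/
def lift {R : Type u} [Ring R] [Algebra k R] (f : T →ₐ[k] R) (hf : ∀ x ∈ X, f x = 0) :
    QuotAlg X →ₐ[k] R :=
  RingQuot.liftAlgHom k ⟨f, by
    rintro x y ⟨hx, rfl⟩
    rw [hf x hx, map_zero]⟩

@[simp] theorem lift_mk {R : Type u} [Ring R] [Algebra k R] (f : T →ₐ[k] R)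
    (hf : ∀ x ∈ X, f x = 0) (x : T) : lift f hf (mk k X x) = f x :=
  RingQuot.liftAlgHom_mkAlgHom_apply k _ _ _

theorem algHom_ext {R : Type u} [Ring R] [Algebra k R] {f g : QuotAlg X →ₐ[k] R}
    (h : ∀ x, f (mk k X x) = g (mk k X x)) : f = g := by
  ext x
  obtain ⟨x, rfl⟩ := mk_surjective (k := k) x
  exact h x

/-- The kernel of `T → T/⟨X⟩` is the span of the products `a x b` with `x ∈ X`. -/
theorem mk_eq_zero_iff {x : T} :
    mk k X x = 0 ↔ x ∈ (⊤ : Submodule k T) * Submodule.span k X * ⊤ := by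
  set N : Submodule k T := ⊤ * Submodule.span k X * ⊤ with hN
  have hl : ∀ a, ∀ y ∈ N, a * y ∈ N := by
    intro a y hy
    have h : (⊤ : Submodule k T) * N ≤ N := by
      rw [hN, ← mul_assoc, ← mul_assoc]
      exact mul_le_mul' (mul_le_mul' le_top le_rfl) le_rfl
    exact h (Submodule.mul_mem_mul Submodule.mem_top hy)
  have hr : ∀ a, ∀ y ∈ N, y * a ∈ N := by
    intro a y hy
    have h : N * (⊤ : Submodule k T) ≤ N := by
      rw [hN, mul_assoc]
      exact mul_le_mul' le_rfl le_top
    exact h (Submodule.mul_mem_mul hy Submodule.mem_top)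
  have hX : ∀ y ∈ X, y ∈ N := by
    intro y hy
    have := Submodule.mul_mem_mul (Submodule.mul_mem_mul (Submodule.mem_top : (1 : T) ∈ (⊤ : Submodule k T))
      (Submodule.subset_span (R := k) hy)) (Submodule.mem_top : (1 : T) ∈ (⊤ : Submodule k T))
    rwa [one_mul, mul_one] at this
  constructor
  · intro hx
    -- `T` acts on `T ⧸ N` by left multiplication. Elements of `X` act as zero because `N` is also
    -- stable on the right, so the action factors through the quotient algebra; acting on the class
    -- of `1` then shows `x ∈ N`.
    let L : T → Module.End k (T ⧸ N) := fun a => N.mapQ N (LinearMap.mulLeft k a) (hl a)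
    have hL : ∀ a y, L a (N.mkQ y) = N.mkQ (a * y) := fun a y => rfl
    let F : T →ₐ[k] Module.End k (T ⧸ N) := AlgHom.ofLinearMap
      { toFun := L
        map_add' := fun a b => N.linearMap_qext (LinearMap.ext fun y => by
          simp only [LinearMap.comp_apply, LinearMap.add_apply, hL, add_mul, map_add])
        map_smul' := fun c a => N.linearMap_qext (LinearMap.ext fun y => by
          simp only [LinearMap.comp_apply, LinearMap.smul_apply, hL, smul_mul_assoc, map_smul,
            RingHom.id_apply]) }
      (N.linearMap_qext (LinearMap.ext fun y => by
        simp only [LinearMap.comp_apply, LinearMap.coe_mk, AddHom.coe_mk, hL, one_mul]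
        rfl))
      (fun a b => N.linearMap_qext (LinearMap.ext fun y => by
        simp only [LinearMap.comp_apply, LinearMap.coe_mk, AddHom.coe_mk, hL, mul_assoc,
          Module.End.mul_apply]))
    have hF : ∀ y ∈ X, F y = 0 := by
      intro y hy
      refine N.linearMap_qext (LinearMap.ext fun z => ?_)
      exact (Submodule.Quotient.mk_eq_zero N).2 (hr z _ (hX y hy))
    have h := lift_mk F hF x
    rw [hx, map_zero] at h
    have h1 : (0 : T ⧸ N) = N.mkQ (x * 1) := congrArg (fun G : Module.End k (T ⧸ N) => G (N.mkQ 1)) h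
    rw [mul_one] at h1
    exact (Submodule.Quotient.mk_eq_zero N).1 h1.symm
  · intro hx
    have h : N ≤ LinearMap.ker (mk k X).toLinearMap := by
      rw [hN, Submodule.mul_le]
      intro a ha b _
      rw [LinearMap.mem_ker, AlgHom.toLinearMap_apply, map_mul]
      have h2 : (⊤ : Submodule k T) * Submodule.span k X ≤ LinearMap.ker (mk k X).toLinearMap := by
        rw [Submodule.mul_le]
        intro c _ d hd
        have h3 : Submodule.span k X ≤ LinearMap.ker (mk k X).toLinearMap :=
          Submodule.span_le.2 fun y hy => mk_eq_zero hy
        have := h3 hd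
        rw [LinearMap.mem_ker, AlgHom.toLinearMap_apply] at this ⊢
        rw [map_mul, this, mul_zero]
      have := h2 ha
      rw [LinearMap.mem_ker, AlgHom.toLinearMap_apply] at this
      rw [this, zero_mul]
    exact h hx

end QuotAlg

/-! ### Path algebras -/

section PathAlgebra

variable {k : Type u} [Field k] {I : Type u} {Q : QuiverOn I}

/-- The image of `S` in the path algebra. -/
abbrev baseSpan (k : Type u) [Field k] {I : Type u} (Q : QuiverOn I) :
    Submodule k (PathAlgebra k Q) :=
  Subalgebra.toSubmodule (BimodTensorAlgebra.base k (I → k) (ArrowSpace k Q)).range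

theorem base_mem_baseSpan (s : I → k) :
    BimodTensorAlgebra.base k (I → k) (ArrowSpace k Q) s ∈ baseSpan k Q := ⟨s, rfl⟩

theorem gen_mem_arrowSpan (v : ArrowSpace k Q) :
    BimodTensorAlgebra.gen k (I → k) (ArrowSpace k Q) v ∈ arrowSpan k Q :=
  Submodule.subset_span ⟨v, rfl⟩

theorem mem_arrowSpan {x : PathAlgebra k Q} :
    x ∈ arrowSpan k Q ↔ ∃ v, BimodTensorAlgebra.gen k (I → k) (ArrowSpace k Q) v = x := by
  refine ⟨fun hx => ?_, fun ⟨v, hv⟩ => hv ▸ gen_mem_arrowSpan v⟩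
  induction hx using Submodule.span_induction with
  | mem x hx => exact hx
  | zero => exact ⟨0, map_zero _⟩
  | add x y _ _ hx hy =>
    obtain ⟨v, rfl⟩ := hx
    obtain ⟨w, rfl⟩ := hy
    exact ⟨v + w, map_add _ _ _⟩
  | smul c x _ hx =>
    obtain ⟨v, rfl⟩ := hx
    refine ⟨algebraMap k (I → k) c • v, ?_⟩
    rw [← BimodTensorAlgebra.base_mul_gen, AlgHom.commutes, Algebra.smul_def]

theorem baseSpan_mul_baseSpan : baseSpan k Q * baseSpan k Q ≤ baseSpan k Q := by
  rw [Submodule.mul_le]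
  rintro _ ⟨s, rfl⟩ _ ⟨t, rfl⟩
  exact ⟨s * t, map_mul _ _ _⟩

theorem one_le_baseSpan : 1 ≤ baseSpan k Q := by
  rw [Submodule.one_le]
  exact ⟨1, map_one _⟩

theorem baseSpan_mul_arrowSpan : baseSpan k Q * arrowSpan k Q ≤ arrowSpan k Q := by
  rw [Submodule.mul_le]
  rintro _ ⟨s, rfl⟩ y hy
  obtain ⟨v, rfl⟩ := mem_arrowSpan.1 hy
  exact mem_arrowSpan.2 ⟨_, (BimodTensorAlgebra.base_mul_gen s v).symm⟩

theorem arrowSpan_mul_baseSpan : arrowSpan k Q * baseSpan k Q ≤ arrowSpan k Q := by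
  rw [Submodule.mul_le]
  rintro x hx _ ⟨s, rfl⟩
  obtain ⟨v, rfl⟩ := mem_arrowSpan.1 hx
  exact mem_arrowSpan.2 ⟨_, (BimodTensorAlgebra.gen_mul_base s v).symm⟩

theorem pathSpan_zero : pathSpan k Q 0 = baseSpan k Q := by
  rw [pathSpan, pow_zero, mul_one]

theorem pathSpan_succ (l : ℕ) : pathSpan k Q (l + 1) = arrowSpan k Q ^ (l + 1) := by
  apply le_antisymm
  · rw [pathSpan, pow_succ', ← mul_assoc]
    exact mul_le_mul' baseSpan_mul_arrowSpan le_rfl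
  · rw [pathSpan]
    conv_lhs => rw [← one_mul (arrowSpan k Q ^ (l + 1))]
    exact mul_le_mul' one_le_baseSpan le_rfl

theorem arrowSpan_pow_le_pathSpan (l : ℕ) : arrowSpan k Q ^ l ≤ pathSpan k Q l := by
  rw [pathSpan]
  conv_lhs => rw [← one_mul (arrowSpan k Q ^ l)]
  exact mul_le_mul' one_le_baseSpan le_rfl

theorem pathSpan_one : pathSpan k Q 1 = arrowSpan k Q := by
  rw [pathSpan_succ, zero_add, pow_one]

theorem pathSpan_succ' (l : ℕ) : pathSpan k Q (l + 1) = pathSpan k Q l * arrowSpan k Q := by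
  rw [pathSpan, pathSpan, pow_succ, mul_assoc]

theorem arrowSpan_mul_pathSpan (l : ℕ) :
    arrowSpan k Q * pathSpan k Q l = pathSpan k Q (l + 1) := by
  apply le_antisymm
  · rw [pathSpan, ← mul_assoc, pathSpan_succ, pow_succ']
    exact mul_le_mul' arrowSpan_mul_baseSpan le_rfl
  · rw [pathSpan_succ, pow_succ']
    exact mul_le_mul' le_rfl (arrowSpan_pow_le_pathSpan l)

theorem baseSpan_mul_pathSpan (l : ℕ) : baseSpan k Q * pathSpan k Q l ≤ pathSpan k Q l := by
  rw [pathSpan, ← mul_assoc]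
  exact mul_le_mul' baseSpan_mul_baseSpan le_rfl

theorem pathSpan_mul_baseSpan (l : ℕ) : pathSpan k Q l * baseSpan k Q ≤ pathSpan k Q l := by
  cases l with
  | zero => rw [pathSpan_zero]; exact baseSpan_mul_baseSpan
  | succ l =>
    rw [pathSpan_succ', mul_assoc]
    exact mul_le_mul' le_rfl arrowSpan_mul_baseSpan

theorem pathSpan_mul_pathSpan (l m : ℕ) :
    pathSpan k Q l * pathSpan k Q m ≤ pathSpan k Q (l + m) := by
  induction m with
  | zero => rw [pathSpan_zero]; exact pathSpan_mul_baseSpan l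
  | succ m ih =>
    rw [pathSpan_succ', ← mul_assoc, ← add_assoc, pathSpan_succ']
    exact mul_le_mul' ih le_rfl

variable (k Q) in
/-- The grading of the path algebra by length, as the algebra map `x ↦ ∑ x_l X^l`. -/
def gradePoly : PathAlgebra k Q →ₐ[k] Polynomial (PathAlgebra k Q) :=
  BimodTensorAlgebra.lift
    (Polynomial.CAlgHom.comp (BimodTensorAlgebra.base k (I → k) (ArrowSpace k Q)))
    ((Polynomial.monomial 1).toAddMonoidHom.comp
      (BimodTensorAlgebra.gen k (I → k) (ArrowSpace k Q)))
    (fun s v => by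
      simp [← BimodTensorAlgebra.base_mul_gen, Polynomial.C_mul_monomial])
    (fun s v => by
      simp [← BimodTensorAlgebra.gen_mul_base, Polynomial.monomial_mul_C])

variable (k Q) in
/-- The component of length `l`. -/
def pathComp (l : ℕ) : PathAlgebra k Q →ₗ[k] PathAlgebra k Q :=
  (Polynomial.lcoeff (PathAlgebra k Q) l).restrictScalars k ∘ₗ (gradePoly k Q).toLinearMap

theorem pathComp_apply (l : ℕ) (x : PathAlgebra k Q) :
    pathComp k Q l x = (gradePoly k Q x).coeff l := rfl

theorem gradePoly_of_mem {l : ℕ} {x : PathAlgebra k Q} (hx : x ∈ pathSpan k Q l) :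
    gradePoly k Q x = Polynomial.monomial l x := by
  induction l generalizing x with
  | zero =>
    rw [pathSpan_zero] at hx
    obtain ⟨s, rfl⟩ := hx
    exact BimodTensorAlgebra.lift_base _ _ _ _ s
  | succ l ih =>
    rw [pathSpan_succ'] at hx
    induction hx using Submodule.mul_induction_on' with
    | mem_mul_mem y hy z hz =>
      obtain ⟨v, rfl⟩ := mem_arrowSpan.1 hz
      rw [map_mul, ih hy, gradePoly, BimodTensorAlgebra.lift_gen]
      exact Polynomial.monomial_mul_monomial _ _ _ _
    | add y hy z hz h1 h2 => rw [map_add, h1, h2, map_add]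

theorem pathComp_of_mem {l : ℕ} {x : PathAlgebra k Q} (hx : x ∈ pathSpan k Q l) (m : ℕ) :
    pathComp k Q m x = if l = m then x else 0 := by
  rw [pathComp_apply, gradePoly_of_mem hx, Polynomial.coeff_monomial]

theorem pathComp_mem (l : ℕ) (x : PathAlgebra k Q) : pathComp k Q l x ∈ pathSpan k Q l := by
  revert l
  induction x using BimodTensorAlgebra.induction_right with
  | h1 =>
    intro l
    have h1 : (1 : PathAlgebra k Q) ∈ pathSpan k Q 0 := by
      rw [pathSpan_zero]; exact Submodule.one_le.1 one_le_baseSpan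
    rw [pathComp_of_mem h1]
    split_ifs with h
    · exact h ▸ h1
    · exact zero_mem _
  | hadd x y hx hy =>
    intro l
    rw [map_add]
    exact add_mem (hx l) (hy l)
  | hb x s hx =>
    intro l
    have h0 : BimodTensorAlgebra.base k (I → k) (ArrowSpace k Q) s ∈ pathSpan k Q 0 := by
      rw [pathSpan_zero]; exact base_mem_baseSpan s
    rw [pathComp_apply, map_mul, gradePoly_of_mem h0, Polynomial.monomial_zero_left,
      Polynomial.coeff_mul_C]
    exact pathSpan_mul_baseSpan l (Submodule.mul_mem_mul (hx l) (base_mem_baseSpan s))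
  | hg x v hx =>
    intro l
    have h1 : BimodTensorAlgebra.gen k (I → k) (ArrowSpace k Q) v ∈ pathSpan k Q 1 := by
      rw [pathSpan_one]; exact gen_mem_arrowSpan v
    rw [pathComp_apply, map_mul, gradePoly_of_mem h1]
    cases l with
    | zero => simp [← Polynomial.C_mul_X_eq_monomial, ← mul_assoc]
    | succ l =>
      rw [← Polynomial.C_mul_X_eq_monomial, ← mul_assoc, Polynomial.coeff_mul_X,
        Polynomial.coeff_mul_C, pathSpan_succ']
      exact Submodule.mul_mem_mul (hx l) (gen_mem_arrowSpan v)

/-- Setting the variable of `gradePoly` equal to `1` recovers `x`. Every sufficiently large bound is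
allowed, so that several elements can share one. -/
theorem eq_sum_pathComp (x : PathAlgebra k Q) :
    ∃ N, ∀ n ≥ N, x = ∑ l ∈ Finset.range n, pathComp k Q l x := by
  let e : Polynomial (PathAlgebra k Q) →ₐ[k] PathAlgebra k Q :=
    Polynomial.eval₂AlgHom (AlgHom.id k _) 1 (fun a => Commute.one_right a)
  have h : e.comp (gradePoly k Q) = AlgHom.id k _ :=
    BimodTensorAlgebra.algHom_ext
      (fun s => by
        simp only [gradePoly, AlgHom.comp_apply, BimodTensorAlgebra.lift_base]
        exact Polynomial.eval₂_C _ _)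
      (fun v => by
        simp only [gradePoly, AlgHom.comp_apply, BimodTensorAlgebra.lift_gen]
        exact (Polynomial.eval₂_monomial _ _).trans (by simp))
  refine ⟨(gradePoly k Q x).natDegree + 1, fun n hn => ?_⟩
  have hx := congrArg (fun f => f x) h
  simp only [AlgHom.comp_apply, AlgHom.id_apply] at hx
  refine hx.symm.trans ?_
  change Polynomial.eval₂ _ 1 (gradePoly k Q x) = _
  rw [Polynomial.eval₂_eq_sum_range' _ (Nat.lt_of_succ_le hn)]
  simp [pathComp_apply]

end PathAlgebra

/-! ### Splitting off arrows, and contraction of paths with functionals -/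

section Derivatives

variable {k : Type u} [Field k] {I : Type u} {Q : QuiverOn I}

local notation "base" => BimodTensorAlgebra.base k (I → k) (ArrowSpace k Q)
local notation "gen" => BimodTensorAlgebra.gen k (I → k) (ArrowSpace k Q)

theorem base_mul_vertex (s : I → k) (i : I) : base s * vertex k Q i = s i • vertex k Q i := by
  rw [vertex, ← map_mul, ← map_smul]
  congr 1
  ext j
  by_cases h : j = i
  · subst h; simp
  · simp [h]

theorem vertex_mul_base (s : I → k) (i : I) : vertex k Q i * base s = s i • vertex k Q i := by
  rw [vertex, ← map_mul, ← map_smul]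
  congr 1
  ext j
  by_cases h : j = i
  · subst h; simp
  · simp [h]

open Classical in
theorem vertex_mul_vertex (i j : I) :
    vertex k Q i * vertex k Q j = if i = j then vertex k Q i else 0 := by
  rw [vertex.eq_1 k Q i, base_mul_vertex]
  by_cases h : i = j
  · subst h; simp [vertex]
  · simp [h]

theorem vertex_mul_self (i : I) : vertex k Q i * vertex k Q i = vertex k Q i := by
  rw [vertex_mul_vertex, if_pos rfl]

theorem base_eq_sum [Fintype I] (s : I → k) : base s = ∑ i, s i • vertex k Q i := by
  classical
  simp only [vertex, ← map_smul, ← map_sum]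
  congr 1
  ext j
  simp [Finset.sum_apply, Pi.single_apply]

theorem sum_vertex [Fintype I] : ∑ i, vertex k Q i = 1 := by
  rw [← map_one base, base_eq_sum]
  simp

theorem vertex_mem_baseSpan (i : I) : vertex k Q i ∈ baseSpan k Q := ⟨_, rfl⟩

open Classical in
/-- The basis vector of `V` belonging to an arrow. -/
def arrowVec (k : Type u) [Field k] {I : Type u} {Q : QuiverOn I} (a : Q.Arrow) : ArrowSpace k Q :=
  (Pi.single a (1 : k) : Q.Arrow → k)

theorem arrow_eq (a : Q.Arrow) : arrow k Q a = gen (arrowVec k a) := rfl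

open Classical in
theorem arrowVec_apply (a b : Q.Arrow) : arrowVec k a b = if b = a then 1 else 0 :=
  Pi.single_apply a (1 : k) b

theorem smul_gen (c : k) (w : ArrowSpace k Q) : c • gen w = gen (algebraMap k (I → k) c • w) := by
  rw [← BimodTensorAlgebra.base_mul_gen, AlgHom.commutes, Algebra.smul_def]

theorem gen_eq_sum [Fintype Q.Arrow] (v : ArrowSpace k Q) : gen v = ∑ a, v a • arrow k Q a := by
  classical
  simp only [arrow_eq, smul_gen, ← map_sum]
  congr 1
  refine funext fun b => Eq.symm ?_
  refine (Finset.sum_apply (M := fun _ : Q.Arrow => k) b _ _).trans ?_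
  have h : ∀ a, (algebraMap k (I → k) (v a) • arrowVec k a : ArrowSpace k Q) b =
      if b = a then v a else 0 := fun a => by
    change v a * arrowVec k a b = _
    rw [arrowVec_apply, mul_ite, mul_one, mul_zero]
  exact (Finset.sum_congr rfl fun a _ => h a).trans
    ((Finset.sum_ite_eq Finset.univ b v).trans (if_pos (Finset.mem_univ b)))

theorem vertex_mul_arrow (a : Q.Arrow) : vertex k Q (Q.tgt a) * arrow k Q a = arrow k Q a := by
  classical
  rw [vertex, arrow_eq, BimodTensorAlgebra.base_mul_gen]
  congr 1
  refine funext fun b => ?_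
  change (Pi.single (Q.tgt a) 1 : I → k) (Q.tgt b) * arrowVec k a b = _
  rw [arrowVec_apply]
  by_cases h : b = a
  · subst h; simp
  · simp [h]

theorem arrow_mul_vertex (a : Q.Arrow) : arrow k Q a * vertex k Q (Q.src a) = arrow k Q a := by
  classical
  rw [vertex, arrow_eq, BimodTensorAlgebra.gen_mul_base]
  congr 1
  refine funext fun b => ?_
  change arrowVec k a b * (Pi.single (Q.src a) 1 : I → k) (Q.src b) = _
  rw [arrowVec_apply]
  by_cases h : b = a
  · subst h; simp
  · simp [h]

theorem arrow_mem_arrowSpan (a : Q.Arrow) : arrow k Q a ∈ arrowSpan k Q := gen_mem_arrowSpan _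

/-- Right multiplication by `s ∈ S` on `T ⊕ T ⊗_S V`. -/
def rightSplitBase (s : I → k) :
    Module.End k (PathAlgebra k Q × (Q.Arrow → PathAlgebra k Q)) where
  toFun x := (x.1 * base s, fun a => s (Q.src a) • x.2 a)
  map_add' x y := by ext <;> simp [add_mul]
  map_smul' c x := by ext <;> simp [smul_comm c]

/-- Right multiplication by `v ∈ V` on `T ⊕ T ⊗_S V`, where `T ⊗_S V` is killed. -/
def rightSplitGen (v : ArrowSpace k Q) :
    Module.End k (PathAlgebra k Q × (Q.Arrow → PathAlgebra k Q)) where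
  toFun x := (x.1 * gen v, fun a => v a • (x.1 * vertex k Q (Q.tgt a)))
  map_add' x y := by ext <;> simp [add_mul]
  map_smul' c x := by ext <;> simp [smul_comm c]

theorem rightSplitBase_apply (s : I → k) (x : PathAlgebra k Q × (Q.Arrow → PathAlgebra k Q)) :
    rightSplitBase s x = (x.1 * base s, fun a => s (Q.src a) • x.2 a) := rfl

theorem rightSplitGen_apply (v : ArrowSpace k Q)
    (x : PathAlgebra k Q × (Q.Arrow → PathAlgebra k Q)) :
    rightSplitGen v x = (x.1 * gen v, fun a => v a • (x.1 * vertex k Q (Q.tgt a))) := rfl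

variable (k Q) in
/-- The right action of the path algebra on `T ⊕ T ⊗_S V`. -/
def rightSplit :
    PathAlgebra k Q →ₐ[k] (Module.End k (PathAlgebra k Q × (Q.Arrow → PathAlgebra k Q)))ᵐᵒᵖ :=
  BimodTensorAlgebra.lift
    (AlgHom.ofLinearMap
      { toFun := fun s => op (rightSplitBase s)
        map_add' := fun s t => congrArg op (LinearMap.ext fun x => Prod.ext
          (by simp [rightSplitBase_apply, mul_add])
          (funext fun a => by simp [rightSplitBase_apply, add_smul]))
        map_smul' := fun c s => congrArg op (LinearMap.ext fun x => Prod.ext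
          (by simp [rightSplitBase_apply])
          (funext fun a => by simp [rightSplitBase_apply, mul_smul])) }
      (congrArg op (LinearMap.ext fun x => Prod.ext
          (by simp [rightSplitBase_apply])
          (funext fun a => by simp [rightSplitBase_apply])))
      (fun s t => congrArg op (LinearMap.ext fun x => Prod.ext
          (by simp [rightSplitBase_apply, mul_assoc])
          (funext fun a => by
            simp [rightSplitBase_apply, smul_smul, mul_comm]))))
    (AddMonoidHom.mk' (fun v => op (rightSplitGen v))
      (fun v w => congrArg op (LinearMap.ext fun x => Prod.ext
          (by simp [rightSplitGen_apply, mul_add])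
          (funext fun a => (add_smul (v a) (w a) _)))))
    (fun s v => congrArg op (LinearMap.ext fun x => Prod.ext
          (by simp [rightSplitGen_apply, rightSplitBase_apply, mul_assoc,
            BimodTensorAlgebra.base_mul_gen])
          (funext fun a => by
            have h : (s • v) a = s (Q.tgt a) * v a := rfl
            simp [rightSplitGen_apply, rightSplitBase_apply, mul_assoc, base_mul_vertex, h,
              smul_smul, mul_comm])))
    (fun s v => congrArg op (LinearMap.ext fun x => Prod.ext
          (by simp [rightSplitGen_apply, rightSplitBase_apply, mul_assoc,
            BimodTensorAlgebra.gen_mul_base])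
          (funext fun a => by
            have h : (op s • v) a = v a * s (Q.src a) := rfl
            simp [rightSplitGen_apply, rightSplitBase_apply, h,
              smul_smul, mul_comm])))

theorem rightSplit_base (s : I → k) (x) :
    unop (rightSplit k Q (base s)) x = (x.1 * base s, fun a => s (Q.src a) • x.2 a) := by
  exact congrArg (fun F : (Module.End k (PathAlgebra k Q ×
    (Q.Arrow → PathAlgebra k Q)))ᵐᵒᵖ => unop F x) (BimodTensorAlgebra.lift_base _ _ _ _ s)

theorem rightSplit_gen (v : ArrowSpace k Q) (x) :
    unop (rightSplit k Q (gen v)) x =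
      (x.1 * gen v, fun a => v a • (x.1 * vertex k Q (Q.tgt a))) := by
  exact congrArg (fun F : (Module.End k (PathAlgebra k Q ×
    (Q.Arrow → PathAlgebra k Q)))ᵐᵒᵖ => unop F x) (BimodTensorAlgebra.lift_gen _ _ _ _ v)

/-- The first coordinate carries the right regular representation. Multiplying by an arrow
overwrites the second coordinate with the factorization of the new path at its last arrow. As the
path algebra is given by generators and relations, this action is what makes that factorization well
defined. -/
theorem rightSplit_fst (x : PathAlgebra k Q) : (unop (rightSplit k Q x) (1, 0)).1 = x := by
  induction x using BimodTensorAlgebra.induction_right with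
  | h1 => rw [map_one]; rfl
  | hadd x y hx hy =>
    rw [map_add, MulOpposite.unop_add, LinearMap.add_apply, Prod.fst_add, hx, hy]
  | hb x s hx => rw [map_mul, unop_mul, Module.End.mul_apply, rightSplit_base, hx]
  | hg x v hx => rw [map_mul, unop_mul, Module.End.mul_apply, rightSplit_gen, hx]

/-- The map `∂_a` with `x = ∑_a ∂_a(x) a` for `x ∈ T V`. -/
def rightDeriv (a : Q.Arrow) : PathAlgebra k Q →ₗ[k] PathAlgebra k Q where
  toFun x := (unop (rightSplit k Q x) (1, 0)).2 a
  map_add' x y := by simp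
  map_smul' c x := by simp

theorem rightDeriv_mul_gen (a : Q.Arrow) (x : PathAlgebra k Q) (v : ArrowSpace k Q) :
    rightDeriv a (x * gen v) = v a • (x * vertex k Q (Q.tgt a)) := by
  change (unop (rightSplit k Q _) (1, 0)).2 a = _
  rw [map_mul, unop_mul, Module.End.mul_apply, rightSplit_gen, rightSplit_fst]

theorem sum_rightDeriv_mul [Fintype Q.Arrow] {x : PathAlgebra k Q}
    (hx : x ∈ (⊤ : Submodule k (PathAlgebra k Q)) * arrowSpan k Q) :
    ∑ a, rightDeriv a x * arrow k Q a = x := by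
  induction hx using Submodule.mul_induction_on' with
  | mem_mul_mem z _ w hw =>
    obtain ⟨v, rfl⟩ := mem_arrowSpan.1 hw
    conv_rhs => rw [gen_eq_sum, Finset.mul_sum]
    refine Finset.sum_congr rfl fun a _ => ?_
    rw [rightDeriv_mul_gen, smul_mul_assoc, mul_assoc, vertex_mul_arrow, mul_smul_comm]
  | add y _ z _ hy hz =>
    simp only [map_add, add_mul, Finset.sum_add_distrib, hy, hz]

variable (k Q) in
/-- The left regular representation, extended by the splitting off of the first factor of a path. -/
def leftSplit :
    PathAlgebra k Q →ₐ[k] Module.End k (PathAlgebra k Q × (Q.Arrow → PathAlgebra k Q)) :=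
  BimodTensorAlgebra.lift
    (AlgHom.ofLinearMap
      { toFun := fun s =>
          { toFun := fun x => (base s * x.1, fun a => s (Q.tgt a) • x.2 a)
            map_add' := fun x y => by ext <;> simp [mul_add]
            map_smul' := fun c x => by ext <;> simp [smul_comm c] }
        map_add' := fun s t => by ext x <;> simp [add_mul, add_smul]
        map_smul' := fun c s => by ext x <;> simp [mul_smul] }
      (by ext x <;> simp)
      (fun s t => by ext x <;> simp [mul_assoc, mul_smul]))
    (AddMonoidHom.mk' (fun v =>
          { toFun := fun x => (gen v * x.1, fun a => v a • (vertex k Q (Q.src a) * x.1))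
            map_add' := fun x y => by ext <;> simp [mul_add]
            map_smul' := fun c x => by ext <;> simp [smul_comm c] })
      (fun v w => by
        have h : ∀ a, (v + w) a = v a + w a := fun a => rfl
        ext x <;> simp [add_mul, add_smul, h]))
    (fun s v => by
      have h : ∀ a, (s • v) a = s (Q.tgt a) * v a := fun a => rfl
      ext x <;> simp [h, mul_smul, ← BimodTensorAlgebra.base_mul_gen, mul_assoc])
    (fun s v => by
      have h : ∀ a, (op s • v) a = v a * s (Q.src a) := fun a => rfl
      ext x <;> simp [← mul_assoc, vertex_mul_base, h, mul_smul,
        ← BimodTensorAlgebra.gen_mul_base])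

theorem leftSplit_base (s : I → k) (x) :
    leftSplit k Q (base s) x = (base s * x.1, fun a => s (Q.tgt a) • x.2 a) := by
  rw [leftSplit, BimodTensorAlgebra.lift_base]; rfl

theorem leftSplit_gen (v : ArrowSpace k Q) (x) :
    leftSplit k Q (gen v) x = (gen v * x.1, fun a => v a • (vertex k Q (Q.src a) * x.1)) := by
  rw [leftSplit, BimodTensorAlgebra.lift_gen]; rfl

theorem leftSplit_fst (x : PathAlgebra k Q) (y) : (leftSplit k Q x y).1 = x * y.1 := by
  revert y
  induction x using BimodTensorAlgebra.induction_right with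
  | h1 => intro y; rw [map_one, one_mul]; rfl
  | hadd x y hx hy =>
    intro z
    rw [map_add, LinearMap.add_apply, Prod.fst_add, hx, hy, add_mul]
  | hb x s hx => intro z; rw [map_mul, Module.End.mul_apply, hx, leftSplit_base, mul_assoc]
  | hg x v hx => intro z; rw [map_mul, Module.End.mul_apply, hx, leftSplit_gen, mul_assoc]

/-- The map `∂'_a` with `x = ∑_a a ∂'_a(x)` for `x ∈ V T`. -/
def leftDeriv (a : Q.Arrow) : PathAlgebra k Q →ₗ[k] PathAlgebra k Q where
  toFun x := (leftSplit k Q x (1, 0)).2 a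
  map_add' x y := by simp
  map_smul' c x := by simp

theorem leftDeriv_gen_mul (a : Q.Arrow) (x : PathAlgebra k Q) (v : ArrowSpace k Q) :
    leftDeriv a (gen v * x) = v a • (vertex k Q (Q.src a) * x) := by
  change (leftSplit k Q _ (1, 0)).2 a = _
  rw [map_mul, Module.End.mul_apply, leftSplit_gen, leftSplit_fst, mul_one]

theorem sum_mul_leftDeriv [Fintype Q.Arrow] {x : PathAlgebra k Q}
    (hx : x ∈ arrowSpan k Q * (⊤ : Submodule k (PathAlgebra k Q))) :
    ∑ a, arrow k Q a * leftDeriv a x = x := by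
  induction hx using Submodule.mul_induction_on' with
  | mem_mul_mem w hw z _ =>
    obtain ⟨v, rfl⟩ := mem_arrowSpan.1 hw
    conv_rhs => rw [gen_eq_sum, Finset.sum_mul]
    refine Finset.sum_congr rfl fun a _ => ?_
    rw [leftDeriv_gen_mul, mul_smul_comm, ← mul_assoc, arrow_mul_vertex, smul_mul_assoc]
  | add y _ z _ hy hz =>
    simp only [map_add, mul_add, Finset.sum_add_distrib, hy, hz]

/-- Contraction with a functional on paths of length `l` from the right: `x w ↦ φ(w) x e_i`. -/
theorem exists_rightContraction [Fintype Q.Arrow] (l : ℕ) (φ : PathAlgebra k Q →ₗ[k] k) (i : I)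
    (hφ : ∀ x, φ (vertex k Q i * x) = φ x) :
    ∃ D : PathAlgebra k Q →ₗ[k] PathAlgebra k Q,
      ∀ x, ∀ w ∈ pathSpan k Q l, D (x * w) = φ w • (x * vertex k Q i) := by
  induction l generalizing φ with
  | zero =>
    -- A path of length `0` is some `s ∈ S`, and `hφ` says that `φ` sees only its value at `i`.
    refine ⟨φ (vertex k Q i) • LinearMap.mulRight k (vertex k Q i), fun x w hw => ?_⟩
    rw [pathSpan_zero] at hw
    obtain ⟨s, rfl⟩ := hw
    change φ (vertex k Q i) • (x * base s * vertex k Q i) = φ (base s) • _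
    rw [← hφ (base s), vertex_mul_base, mul_assoc, base_mul_vertex, map_smul, mul_smul_comm,
      smul_smul, smul_eq_mul, mul_comm]
  | succ l ih =>
    -- The last arrow `a` is split off by `rightDeriv a`; what remains is contracted with the
    -- functional `w ↦ φ (w a)` on shorter paths.
    choose D hD using fun a : Q.Arrow => ih (φ ∘ₗ LinearMap.mulRight k (arrow k Q a))
      (fun x => by simp [mul_assoc, hφ])
    refine ⟨∑ a, D a ∘ₗ rightDeriv a, fun x w hw => ?_⟩
    rw [pathSpan_succ'] at hw
    induction hw using Submodule.mul_induction_on' with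
    | mem_mul_mem y hy z hz =>
      obtain ⟨v, rfl⟩ := mem_arrowSpan.1 hz
      conv_rhs => rw [gen_eq_sum, Finset.mul_sum, map_sum, Finset.sum_smul]
      rw [LinearMap.sum_apply]
      refine Finset.sum_congr rfl fun a _ => ?_
      rw [LinearMap.comp_apply, ← mul_assoc, rightDeriv_mul_gen, map_smul, mul_assoc,
        hD a x _ (pathSpan_mul_baseSpan l (Submodule.mul_mem_mul hy (vertex_mem_baseSpan _))),
        LinearMap.comp_apply, LinearMap.mulRight_apply, mul_assoc, vertex_mul_arrow,
        mul_smul_comm, map_smul, smul_smul, smul_eq_mul]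
    | add y _ z _ hy hz => rw [mul_add, map_add, hy, hz, map_add, add_smul]

/-- Contraction with a functional on paths of length `l` from the left: `w x ↦ φ(w) e_i x`. -/
theorem exists_leftContraction [Fintype Q.Arrow] (l : ℕ) (φ : PathAlgebra k Q →ₗ[k] k) (i : I)
    (hφ : ∀ x, φ (x * vertex k Q i) = φ x) :
    ∃ D : PathAlgebra k Q →ₗ[k] PathAlgebra k Q,
      ∀ x, ∀ w ∈ pathSpan k Q l, D (w * x) = φ w • (vertex k Q i * x) := by
  induction l generalizing φ with
  | zero =>
    refine ⟨φ (vertex k Q i) • LinearMap.mulLeft k (vertex k Q i), fun x w hw => ?_⟩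
    rw [pathSpan_zero] at hw
    obtain ⟨s, rfl⟩ := hw
    change φ (vertex k Q i) • (vertex k Q i * (base s * x)) = φ (base s) • _
    rw [← hφ (base s), base_mul_vertex, ← mul_assoc, vertex_mul_base, map_smul, smul_mul_assoc,
      smul_smul, smul_eq_mul, mul_comm]
  | succ l ih =>
    choose D hD using fun a : Q.Arrow => ih (φ ∘ₗ LinearMap.mulLeft k (arrow k Q a))
      (fun x => by simp [← mul_assoc, hφ])
    refine ⟨∑ a, D a ∘ₗ leftDeriv a, fun x w hw => ?_⟩
    rw [← arrowSpan_mul_pathSpan] at hw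
    induction hw using Submodule.mul_induction_on' with
    | mem_mul_mem z hz y hy =>
      obtain ⟨v, rfl⟩ := mem_arrowSpan.1 hz
      conv_rhs => rw [gen_eq_sum, Finset.sum_mul, map_sum, Finset.sum_smul]
      rw [LinearMap.sum_apply]
      refine Finset.sum_congr rfl fun a _ => ?_
      rw [LinearMap.comp_apply, mul_assoc, leftDeriv_gen_mul, map_smul, ← mul_assoc,
        hD a x _ (baseSpan_mul_pathSpan l (Submodule.mul_mem_mul (vertex_mem_baseSpan _) hy)),
        LinearMap.comp_apply, LinearMap.mulLeft_apply, ← mul_assoc, arrow_mul_vertex,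
        smul_mul_assoc, map_smul, smul_smul, smul_eq_mul]
    | add y _ z _ hy hz => rw [add_mul, map_add, hy, hz, map_add, add_smul]

end Derivatives

/-! ### The length grading of a quadratic algebra -/

section QuotientGrading

variable {k : Type u} [Field k] {I : Type u} {Q : QuiverOn I} {M : Submodule k (PathAlgebra k Q)}

theorem IsQuadratic.baseSpan_mul [Finite I] (hM : IsQuadratic M) : baseSpan k Q * M ≤ M := by
  cases nonempty_fintype I
  rw [Submodule.mul_le]
  rintro _ ⟨s, rfl⟩ y hy
  change BimodTensorAlgebra.base k (I → k) (ArrowSpace k Q) s * y ∈ M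
  rw [base_eq_sum, Finset.sum_mul]
  refine sum_mem fun i _ => ?_
  rw [smul_mul_assoc]
  exact M.smul_mem _ (hM.2 i y hy).1

theorem IsQuadratic.mul_baseSpan [Finite I] (hM : IsQuadratic M) : M * baseSpan k Q ≤ M := by
  cases nonempty_fintype I
  rw [Submodule.mul_le]
  rintro y hy _ ⟨s, rfl⟩
  change y * BimodTensorAlgebra.base k (I → k) (ArrowSpace k Q) s ∈ M
  rw [base_eq_sum, Finset.mul_sum]
  refine sum_mem fun i _ => ?_
  rw [mul_smul_comm]
  exact M.smul_mem _ (hM.2 i y hy).2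

theorem toQuiverAlgebra_surjective : Function.Surjective (toQuiverAlgebra M) :=
  QuotAlg.mk_surjective

theorem toQuiverAlgebra_eq_zero_iff {x : PathAlgebra k Q} :
    toQuiverAlgebra M x = 0 ↔ x ∈ (⊤ : Submodule k (PathAlgebra k Q)) * M * ⊤ := by
  rw [toQuiverAlgebra, QuotAlg.mk_eq_zero_iff, Submodule.span_eq]

theorem IsQuadratic.le_pathSpan (hM : IsQuadratic M) : M ≤ pathSpan k Q 2 := by
  rw [pathSpan_succ]; exact hM.1

/-- A relation has no components of length `0` and `1`, and its component of length `2` is in `M`. -/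
theorem IsQuadratic.pathComp_of_eq_zero [Finite I] (hM : IsQuadratic M) {x : PathAlgebra k Q}
    (hx : toQuiverAlgebra M x = 0) :
    pathComp k Q 0 x = 0 ∧ pathComp k Q 1 x = 0 ∧ pathComp k Q 2 x ∈ M := by
  rw [toQuiverAlgebra_eq_zero_iff] at hx
  induction hx using Submodule.mul_induction_on' with
  | add y _ z _ hy hz =>
    simp only [map_add, hy.1, hz.1, hy.2.1, hz.2.1, add_zero, true_and]
    exact add_mem hy.2.2 hz.2.2
  | mem_mul_mem y hy z _ =>
    induction hy using Submodule.mul_induction_on' with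
    | add y _ y' _ hy hz =>
      simp only [add_mul, map_add, hy.1, hz.1, hy.2.1, hz.2.1, add_zero, true_and]
      exact add_mem hy.2.2 hz.2.2
    | mem_mul_mem w _ m hm =>
      -- A relation has length `2`, so its grading polynomial contributes a factor `X ^ 2`. The
      -- coefficient in length `2` therefore involves only the parts of length `0` of the outer
      -- factors, and `M` is stable under these.
      have h : gradePoly k Q (w * m * z) =
          gradePoly k Q w * Polynomial.C m * gradePoly k Q z * Polynomial.X ^ 2 := by
        rw [map_mul, map_mul, gradePoly_of_mem (hM.le_pathSpan hm),
          ← Polynomial.C_mul_X_pow_eq_monomial]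
        simp only [mul_assoc, Polynomial.X_pow_mul]
      simp only [pathComp_apply, h]
      refine ⟨by simp, by simp [Polynomial.coeff_mul_X_pow'], ?_⟩
      rw [Polynomial.coeff_mul_X_pow']
      simp only [le_refl, if_true, Nat.sub_self, Polynomial.mul_coeff_zero, Polynomial.coeff_C_zero]
      have h0 : ∀ y, (gradePoly k Q y).coeff 0 ∈ baseSpan k Q := fun y => by
        have := pathComp_mem 0 y
        rwa [pathSpan_zero] at this
      exact hM.mul_baseSpan (Submodule.mul_mem_mul
        (hM.baseSpan_mul (Submodule.mul_mem_mul (h0 w) hm)) (h0 z))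

theorem IsQuadratic.mem_of_eq_zero [Finite I] (hM : IsQuadratic M) {x : PathAlgebra k Q}
    (hx : toQuiverAlgebra M x = 0) (h2 : x ∈ pathSpan k Q 2) : x ∈ M := by
  have := (hM.pathComp_of_eq_zero hx).2.2
  rwa [pathComp_of_mem h2, if_pos rfl] at this

theorem IsQuadratic.eq_zero_of_arrowSpan [Finite I] (hM : IsQuadratic M) {x : PathAlgebra k Q}
    (hx : toQuiverAlgebra M x = 0) (h1 : x ∈ arrowSpan k Q) : x = 0 := by
  have := (hM.pathComp_of_eq_zero hx).2.1
  rwa [pathComp_of_mem (by rwa [pathSpan_one]), if_pos rfl] at this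

theorem IsQuadratic.eq_zero_of_baseSpan [Finite I] (hM : IsQuadratic M) {x : PathAlgebra k Q}
    (hx : toQuiverAlgebra M x = 0) (h1 : x ∈ baseSpan k Q) : x = 0 := by
  have := (hM.pathComp_of_eq_zero hx).1
  rwa [pathComp_of_mem (by rwa [pathSpan_zero]), if_pos rfl] at this

/-- The component of degree `l` in `Λ`. -/
def IsQuadratic.comp (hM : IsQuadratic M) (l : ℕ) : QuiverAlgebra M →ₗ[k] QuiverAlgebra M :=
  (Polynomial.lcoeff (QuiverAlgebra M) l).restrictScalars k ∘ₗ
    (QuotAlg.lift ((Polynomial.mapAlgHom (toQuiverAlgebra M)).comp (gradePoly k Q)) (by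
      intro x hx
      rw [AlgHom.comp_apply, gradePoly_of_mem (hM.le_pathSpan hx)]
      change Polynomial.map _ _ = 0
      rw [Polynomial.map_monomial]
      have : toQuiverAlgebra M x = 0 := QuotAlg.mk_eq_zero hx
      change Polynomial.monomial 2 (toQuiverAlgebra M x) = 0
      rw [this, map_zero])).toLinearMap

theorem IsQuadratic.comp_mk (hM : IsQuadratic M) (l : ℕ) (x : PathAlgebra k Q) :
    hM.comp l (toQuiverAlgebra M x) = toQuiverAlgebra M (pathComp k Q l x) := by
  change Polynomial.coeff (QuotAlg.lift _ _ (QuotAlg.mk k _ x)) l = _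
  rw [QuotAlg.lift_mk]
  exact Polynomial.coeff_map _ _

theorem IsQuadratic.comp_mem (hM : IsQuadratic M) (l : ℕ) (a : QuiverAlgebra M) :
    hM.comp l a ∈ lengthGrading M l := by
  obtain ⟨x, rfl⟩ := toQuiverAlgebra_surjective a
  rw [hM.comp_mk]
  exact ⟨_, pathComp_mem l x, rfl⟩

theorem IsQuadratic.comp_of_mem (hM : IsQuadratic M) {l : ℕ} {a : QuiverAlgebra M}
    (ha : a ∈ lengthGrading M l) (m : ℕ) : hM.comp m a = if l = m then a else 0 := by
  obtain ⟨x, hx, rfl⟩ := ha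
  change hM.comp m (toQuiverAlgebra M x) = if l = m then toQuiverAlgebra M x else 0
  rw [hM.comp_mk, pathComp_of_mem hx]
  split_ifs
  · rfl
  · rw [map_zero]

theorem IsQuadratic.eq_sum_comp (hM : IsQuadratic M) (a : QuiverAlgebra M) :
    ∃ N, ∀ n ≥ N, a = ∑ l ∈ Finset.range n, hM.comp l a := by
  obtain ⟨x, rfl⟩ := toQuiverAlgebra_surjective a
  obtain ⟨N, hN⟩ := eq_sum_pathComp x
  refine ⟨N, fun n hn => ?_⟩
  conv_lhs => rw [hN n hn, map_sum]
  simp only [hM.comp_mk]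

/-- The degrees of a finite-dimensional `Λ` are bounded. -/
theorem IsQuadratic.exists_comp_eq_zero (hM : IsQuadratic M)
    [FiniteDimensional k (QuiverAlgebra M)] :
    ∃ N, ∀ l ≥ N, lengthGrading M l = ⊥ := by
  let b := Module.finBasis k (QuiverAlgebra M)
  choose N hN using fun i => hM.eq_sum_comp (b i)
  refine ⟨Finset.univ.sup N, fun l hl => ?_⟩
  have h : hM.comp l = 0 := by
    refine b.ext fun i => ?_
    rw [hN i _ le_rfl, map_sum]
    refine Finset.sum_eq_zero fun m hm => ?_
    rw [hM.comp_of_mem (hM.comp_mem m _), if_neg]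
    have := Finset.le_sup (f := N) (Finset.mem_univ i)
    have := Finset.mem_range.1 hm
    omega
  rw [eq_bot_iff]
  intro a ha
  have h2 := hM.comp_of_mem ha l
  rw [if_pos rfl, h] at h2
  exact h2.symm

theorem IsQuadratic.eq_sum_comp_of_bounded (hM : IsQuadratic M) {N : ℕ}
    (hN : ∀ l ≥ N, lengthGrading M l = ⊥) (a : QuiverAlgebra M) :
    a = ∑ l ∈ Finset.range N, hM.comp l a := by
  obtain ⟨n, hn⟩ := hM.eq_sum_comp a
  rw [hn (max n N) (le_max_left _ _)]
  conv_rhs => rw [← hn (max n N) (le_max_left _ _)]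
  refine (Finset.sum_subset (Finset.range_mono (le_max_right n N)) fun l _ hl => ?_).symm
  have := hM.comp_mem l a
  rwa [hN l (by simpa using hl), Submodule.mem_bot] at this

theorem toQuiverAlgebra_mul_mem_lengthGrading {l m : ℕ} {a b : QuiverAlgebra M}
    (ha : a ∈ lengthGrading M l) (hb : b ∈ lengthGrading M m) :
    a * b ∈ lengthGrading M (l + m) := by
  obtain ⟨x, hx, rfl⟩ := ha
  obtain ⟨y, hy, rfl⟩ := hb
  exact ⟨x * y, pathSpan_mul_pathSpan l m (Submodule.mul_mem_mul hx hy),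
    map_mul (toQuiverAlgebra M) x y⟩

end QuotientGrading

/-! ### Homogeneous bases and uniqueness of coefficients -/

section PathBasis

variable {k : Type u} [Field k] {I : Type u} {Q : QuiverOn I}
  {W : Submodule k (PathAlgebra k Q)} {B : Type u} {q : B → PathAlgebra k Q} {s t : B → I}

namespace IsPathBasis

theorem mem (h : IsPathBasis W q s t) (b : B) : q b ∈ W :=
  h.span_eq ▸ Submodule.subset_span ⟨b, rfl⟩

theorem vertex_mul (h : IsPathBasis W q s t) (b : B) : vertex k Q (t b) * q b = q b := by
  rw [← h.homogeneous b, ← mul_assoc, ← mul_assoc, vertex_mul_self]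

theorem mul_vertex (h : IsPathBasis W q s t) (b : B) : q b * vertex k Q (s b) = q b := by
  rw [← h.homogeneous b, mul_assoc, vertex_mul_self]

theorem ne_zero (h : IsPathBasis W q s t) (b : B) : q b ≠ 0 := h.linearIndependent.ne_zero b

open Classical in
theorem exists_dual (h : IsPathBasis W q s t) :
    ∃ φ : B → PathAlgebra k Q →ₗ[k] k, ∀ b b', φ b (q b') = if b = b' then 1 else 0 := by
  obtain ⟨g, hg⟩ := LinearMap.exists_extend h.linearIndependent.repr
  refine ⟨fun b => Finsupp.lapply b ∘ₗ g, fun b b' => ?_⟩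
  have h1 : g (q b') = h.linearIndependent.repr ⟨q b', Submodule.subset_span ⟨b', rfl⟩⟩ :=
    LinearMap.congr_fun hg ⟨q b', Submodule.subset_span ⟨b', rfl⟩⟩
  rw [LinearMap.comp_apply, h1, h.linearIndependent.repr_eq_single b' _ rfl, Finsupp.lapply_apply,
    Finsupp.single_apply]
  simp [eq_comm]

open Classical in
theorem exists_rightContraction [Fintype Q.Arrow] (h : IsPathBasis W q s t) (l : ℕ) :
    ∃ (φ : B → PathAlgebra k Q →ₗ[k] k) (D : B → PathAlgebra k Q →ₗ[k] PathAlgebra k Q),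
      (∀ b b', φ b (q b') = if b = b' then 1 else 0) ∧
      ∀ b x, ∀ w ∈ pathSpan k Q l, D b (x * w) = φ b w • (x * vertex k Q (t b)) := by
  obtain ⟨φ, hφ⟩ := h.exists_dual
  -- Precomposing the dual functional with multiplication by `e_{t b}` makes it admissible for
  -- contraction; its values on the basis do not change, because the basis is homogeneous.
  choose D hD using fun b => HigherPreproj.exists_rightContraction l
    (φ b ∘ₗ LinearMap.mulLeft k (vertex k Q (t b))) (t b)
    (fun x => by simp [← mul_assoc, vertex_mul_self])
  refine ⟨_, D, fun b b' => ?_, hD⟩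
  rw [LinearMap.comp_apply, LinearMap.mulLeft_apply, ← h.vertex_mul b', ← mul_assoc,
    vertex_mul_vertex]
  split_ifs with h1 h2 h2
  · rw [h1, h.vertex_mul, hφ, if_pos h2]
  · rw [h1, h.vertex_mul, hφ, if_neg h2]
  · exact absurd (congrArg t h2) h1
  · rw [zero_mul, map_zero]

open Classical in
theorem exists_leftContraction [Fintype Q.Arrow] (h : IsPathBasis W q s t) (l : ℕ) :
    ∃ (φ : B → PathAlgebra k Q →ₗ[k] k) (D : B → PathAlgebra k Q →ₗ[k] PathAlgebra k Q),
      (∀ b b', φ b (q b') = if b = b' then 1 else 0) ∧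
      ∀ b x, ∀ w ∈ pathSpan k Q l, D b (w * x) = φ b w • (vertex k Q (s b) * x) := by
  obtain ⟨φ, hφ⟩ := h.exists_dual
  choose D hD using fun b => HigherPreproj.exists_leftContraction l
    (φ b ∘ₗ LinearMap.mulRight k (vertex k Q (s b))) (s b)
    (fun x => by simp [mul_assoc, vertex_mul_self])
  refine ⟨_, D, fun b b' => ?_, hD⟩
  rw [LinearMap.comp_apply, LinearMap.mulRight_apply, ← h.mul_vertex b', mul_assoc,
    vertex_mul_vertex]
  split_ifs with h1 h2 h2
  · rw [h.mul_vertex, hφ, if_pos h2]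
  · rw [h.mul_vertex, hφ, if_neg h2]
  · exact absurd (congrArg s h2).symm h1
  · rw [mul_zero, map_zero]

/-- Contracting the sum with the functional dual to `q b` leaves `x b e_{t b} = x b`. This plays the
role of the injectivity of `T ⊗_S W → T` for `W ⊆ V^l`. -/
theorem eq_zero_of_sum_mul [Finite Q.Arrow] [Fintype B] (h : IsPathBasis W q s t) {l : ℕ}
    (hW : W ≤ pathSpan k Q l) {x : B → PathAlgebra k Q}
    (hx : ∀ b, x b * vertex k Q (t b) = x b) (h0 : ∑ b, x b * q b = 0) (b : B) : x b = 0 := by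
  classical
  cases nonempty_fintype Q.Arrow
  obtain ⟨φ, D, hφ, hD⟩ := h.exists_rightContraction l
  have := congrArg (D b) h0
  simpa [hD b _ _ (hW (h.mem _)), hφ, hx] using this

theorem eq_zero_of_mul_sum [Finite Q.Arrow] [Fintype B] (h : IsPathBasis W q s t) {l : ℕ}
    (hW : W ≤ pathSpan k Q l) {x : B → PathAlgebra k Q}
    (hx : ∀ b, vertex k Q (s b) * x b = x b) (h0 : ∑ b, q b * x b = 0) (b : B) : x b = 0 := by
  classical
  cases nonempty_fintype Q.Arrow
  obtain ⟨φ, D, hφ, hD⟩ := h.exists_leftContraction l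
  have := congrArg (D b) h0
  simpa [hD b _ _ (hW (h.mem _)), hφ, hx] using this

theorem eq_of_sum_mul [Finite Q.Arrow] [Fintype B] (h : IsPathBasis W q s t) {l : ℕ}
    (hW : W ≤ pathSpan k Q l) {x y : B → PathAlgebra k Q}
    (hx : ∀ b, x b * vertex k Q (t b) = x b) (hy : ∀ b, y b * vertex k Q (t b) = y b)
    (h0 : ∑ b, x b * q b = ∑ b, y b * q b) : x = y := by
  refine funext fun b => sub_eq_zero.1 (h.eq_zero_of_sum_mul hW (x := fun b => x b - y b)
    (fun b => by rw [sub_mul, hx, hy]) ?_ b)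
  simp only [sub_mul, Finset.sum_sub_distrib, h0, sub_self]

theorem eq_of_mul_sum [Finite Q.Arrow] [Fintype B] (h : IsPathBasis W q s t) {l : ℕ}
    (hW : W ≤ pathSpan k Q l) {x y : B → PathAlgebra k Q}
    (hx : ∀ b, vertex k Q (s b) * x b = x b) (hy : ∀ b, vertex k Q (s b) * y b = y b)
    (h0 : ∑ b, q b * x b = ∑ b, q b * y b) : x = y := by
  refine funext fun b => sub_eq_zero.1 (h.eq_zero_of_mul_sum hW (x := fun b => x b - y b)
    (fun b => by rw [mul_sub, hx, hy]) ?_ b)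
  simp only [mul_sub, Finset.sum_sub_distrib, h0, sub_self]

theorem exists_sum_smul [Fintype B] (h : IsPathBasis W q s t) {w : PathAlgebra k Q} (hw : w ∈ W) :
    ∃ κ : B → k, w = ∑ b, κ b • q b := by
  rw [← h.span_eq, Submodule.mem_span_range_iff_exists_fun] at hw
  obtain ⟨κ, hκ⟩ := hw
  exact ⟨κ, hκ.symm⟩

theorem exists_right_coeff [Fintype B] (h : IsPathBasis W q s t) {x : PathAlgebra k Q}
    (hx : x ∈ arrowSpan k Q * W) :
    ∃ δ : B → PathAlgebra k Q, (∀ b, δ b ∈ arrowSpan k Q ∧ δ b * vertex k Q (t b) = δ b) ∧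
      x = ∑ b, δ b * q b := by
  induction hx using Submodule.mul_induction_on' with
  | mem_mul_mem v hv w hw =>
    obtain ⟨κ, rfl⟩ := h.exists_sum_smul hw
    refine ⟨fun b => κ b • (v * vertex k Q (t b)), fun b => ⟨?_, ?_⟩, ?_⟩
    · exact Submodule.smul_mem _ _ (arrowSpan_mul_baseSpan
        (Submodule.mul_mem_mul hv (vertex_mem_baseSpan _)))
    · rw [smul_mul_assoc, mul_assoc, vertex_mul_self]
    · rw [Finset.mul_sum]
      refine Finset.sum_congr rfl fun b _ => ?_
      rw [smul_mul_assoc, mul_assoc, h.vertex_mul, mul_smul_comm]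
  | add y _ z _ hy hz =>
    obtain ⟨δ, hδ, rfl⟩ := hy
    obtain ⟨η, hη, rfl⟩ := hz
    exact ⟨fun b => δ b + η b, fun b => ⟨add_mem (hδ b).1 (hη b).1, by
      rw [add_mul, (hδ b).2, (hη b).2]⟩, by simp only [add_mul, Finset.sum_add_distrib]⟩

theorem exists_left_coeff [Fintype B] (h : IsPathBasis W q s t) {x : PathAlgebra k Q}
    (hx : x ∈ W * arrowSpan k Q) :
    ∃ δ : B → PathAlgebra k Q, (∀ b, δ b ∈ arrowSpan k Q ∧ vertex k Q (s b) * δ b = δ b) ∧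
      x = ∑ b, q b * δ b := by
  induction hx using Submodule.mul_induction_on' with
  | mem_mul_mem w hw v hv =>
    obtain ⟨κ, rfl⟩ := h.exists_sum_smul hw
    refine ⟨fun b => κ b • (vertex k Q (s b) * v), fun b => ⟨?_, ?_⟩, ?_⟩
    · exact Submodule.smul_mem _ _ (baseSpan_mul_arrowSpan
        (Submodule.mul_mem_mul (vertex_mem_baseSpan _) hv))
    · rw [mul_smul_comm, ← mul_assoc, vertex_mul_self]
    · rw [Finset.sum_mul]
      refine Finset.sum_congr rfl fun b _ => ?_
      rw [mul_smul_comm, ← mul_assoc, h.mul_vertex, smul_mul_assoc]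
  | add y _ z _ hy hz =>
    obtain ⟨δ, hδ, rfl⟩ := hy
    obtain ⟨η, hη, rfl⟩ := hz
    exact ⟨fun b => δ b + η b, fun b => ⟨add_mem (hδ b).1 (hη b).1, by
      rw [mul_add, (hδ b).2, (hη b).2]⟩, by simp only [mul_add, Finset.sum_add_distrib]⟩

end IsPathBasis

/-- A finite-dimensional sub-bimodule has a finite homogeneous basis. -/
theorem exists_isPathBasis [Finite I] {W : Submodule k (PathAlgebra k Q)} (hfin : W.FG)
    (hl : baseSpan k Q * W ≤ W) (hr : W * baseSpan k Q ≤ W) :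
    ∃ (B : Type u) (_ : Fintype B) (q : B → PathAlgebra k Q) (s t : B → I),
      IsPathBasis W q s t := by
  classical
  cases nonempty_fintype I
  have : Module.Finite k W := Module.Finite.iff_fg.2 hfin
  -- The Peirce projections `x ↦ e_j x e_i`: they are orthogonal idempotents with sum the identity
  -- and they preserve `W`, so bases of their images of `W` together form a homogeneous basis.
  let P : I × I → PathAlgebra k Q →ₗ[k] PathAlgebra k Q := fun ij =>
    LinearMap.mulLeft k (vertex k Q ij.2) ∘ₗ LinearMap.mulRight k (vertex k Q ij.1)
  have hP : ∀ ij x, P ij x = vertex k Q ij.2 * x * vertex k Q ij.1 := fun ij x => by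
    simp [P, mul_assoc]
  have hPW : ∀ ij, W.map (P ij) ≤ W := by
    rintro ij _ ⟨x, hx, rfl⟩
    rw [hP]
    exact hr (Submodule.mul_mem_mul (hl (Submodule.mul_mem_mul (vertex_mem_baseSpan _) hx))
      (vertex_mem_baseSpan _))
  have hPP : ∀ ij ij' x, P ij (P ij' x) = if ij = ij' then P ij x else 0 := by
    rintro ⟨i, j⟩ ⟨i', j'⟩ x
    simp only [hP, Prod.mk.injEq]
    rw [show vertex k Q j * (vertex k Q j' * x * vertex k Q i') * vertex k Q i =
      (vertex k Q j * vertex k Q j') * x * (vertex k Q i' * vertex k Q i) by simp only [mul_assoc],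
      vertex_mul_vertex, vertex_mul_vertex]
    by_cases h1 : i = i' <;> by_cases h2 : j = j' <;> simp [h1, h2, eq_comm]
  have hsum : ∀ x, x = ∑ ij, P ij x := by
    intro x
    rw [Fintype.sum_prod_type]
    simp only [hP, ← Finset.sum_mul, sum_vertex, one_mul]
    rw [← Finset.mul_sum, sum_vertex, mul_one]
  let β := fun ij => Module.finBasis k (W.map (P ij))
  have hβ : ∀ ij ij' n, P ij (β ij' n) = if ij = ij' then ((β ij' n : _) : PathAlgebra k Q) else 0 := by
    intro ij ij' n
    obtain ⟨x, _, hx⟩ := (β ij' n).2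
    rw [← hx, hPP]
    split_ifs with h
    · rw [h]
    · rfl
  refine ⟨Σ ij : I × I, Fin (Module.finrank k (W.map (P ij))), inferInstance,
    fun b => β b.1 b.2, fun b => b.1.1, fun b => b.1.2, ?_, ?_, ?_⟩
  · rw [Fintype.linearIndependent_iff]
    rintro g hg ⟨ij, n⟩
    have h1 := congrArg (P ij) hg
    rw [map_zero, map_sum, Fintype.sum_sigma] at h1
    simp only [map_smul, hβ] at h1
    rw [Finset.sum_eq_single ij (fun ij' _ h => by simp [Ne.symm h]) (by simp)] at h1
    simp only [if_true] at h1
    refine Fintype.linearIndependent_iff.1 (β ij).linearIndependent (fun n => g ⟨ij, n⟩) ?_ n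
    apply Subtype.ext
    simpa using h1
  · apply le_antisymm
    · rw [Submodule.span_le]
      rintro _ ⟨b, rfl⟩
      exact hPW _ (β b.1 b.2).2
    · intro x hx
      rw [hsum x]
      refine sum_mem fun ij _ => ?_
      have h1 := (β ij).sum_repr ⟨P ij x, ⟨x, hx, rfl⟩⟩
      have h2 := congrArg Subtype.val h1
      simp only [Submodule.coe_sum, Submodule.coe_smul] at h2
      rw [← h2]
      exact sum_mem fun n _ => Submodule.smul_mem _ _ (Submodule.subset_span ⟨⟨ij, n⟩, rfl⟩)
  · rintro ⟨ij, n⟩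
    have := hβ ij ij n
    rwa [if_pos rfl, hP] at this

end PathBasis

/-! ### The spaces `K_l` -/

section KoszulSpace

variable {k : Type u} [Field k] {I : Type u} {Q : QuiverOn I} {M : Submodule k (PathAlgebra k Q)}

theorem koszulSpace_le_pathSpan (l : ℕ) : koszulSpace M l ≤ pathSpan k Q l := inf_le_left

theorem mem_koszulSpace {l : ℕ} {x : PathAlgebra k Q} :
    x ∈ koszulSpace M l ↔ x ∈ pathSpan k Q l ∧
      ∀ μ, μ + 2 ≤ l → x ∈ arrowSpan k Q ^ μ * M * arrowSpan k Q ^ (l - μ - 2) := by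
  simp [koszulSpace, Submodule.mem_iInf]

theorem koszulSpace_zero : koszulSpace M 0 = baseSpan k Q := by
  ext x
  rw [mem_koszulSpace, pathSpan_zero]
  exact ⟨fun h => h.1, fun h => ⟨h, fun μ hμ => by omega⟩⟩

theorem koszulSpace_one : koszulSpace M 1 = arrowSpan k Q := by
  ext x
  rw [mem_koszulSpace, pathSpan_one]
  exact ⟨fun h => h.1, fun h => ⟨h, fun μ hμ => by omega⟩⟩

theorem leftDeriv_mem {W : Submodule k (PathAlgebra k Q)} (hW : baseSpan k Q * W ≤ W)
    {x : PathAlgebra k Q} (hx : x ∈ arrowSpan k Q * W) (a : Q.Arrow) : leftDeriv a x ∈ W := by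
  induction hx using Submodule.mul_induction_on' with
  | mem_mul_mem v hv w hw =>
    obtain ⟨v, rfl⟩ := mem_arrowSpan.1 hv
    rw [leftDeriv_gen_mul]
    exact W.smul_mem _ (hW (Submodule.mul_mem_mul (vertex_mem_baseSpan _) hw))
  | add y _ z _ hy hz => rw [map_add]; exact add_mem hy hz

theorem rightDeriv_mem {W : Submodule k (PathAlgebra k Q)} (hW : W * baseSpan k Q ≤ W)
    {x : PathAlgebra k Q} (hx : x ∈ W * arrowSpan k Q) (a : Q.Arrow) : rightDeriv a x ∈ W := by
  induction hx using Submodule.mul_induction_on' with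
  | mem_mul_mem w hw v hv =>
    obtain ⟨v, rfl⟩ := mem_arrowSpan.1 hv
    rw [rightDeriv_mul_gen]
    exact W.smul_mem _ (hW (Submodule.mul_mem_mul hw (vertex_mem_baseSpan _)))
  | add y _ z _ hy hz => rw [map_add]; exact add_mem hy hz

theorem koszulSpace_le_mul_pathSpan (l : ℕ) :
    koszulSpace M (l + 2) ≤ M * pathSpan k Q l := by
  intro x hx
  have := (mem_koszulSpace.1 hx).2 0 (by omega)
  rw [pow_zero, one_mul] at this
  exact mul_le_mul' le_rfl (arrowSpan_pow_le_pathSpan l) this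

theorem koszulSpace_le_pathSpan_mul (l : ℕ) :
    koszulSpace M (l + 2) ≤ pathSpan k Q l * M := by
  intro x hx
  have := (mem_koszulSpace.1 hx).2 l le_rfl
  rw [show l + 2 - l - 2 = 0 by omega, pow_zero, mul_one] at this
  exact mul_le_mul' (arrowSpan_pow_le_pathSpan l) le_rfl this

variable [Finite I]

theorem IsQuadratic.baseSpan_mul_pow (hM : IsQuadratic M) (μ ν : ℕ) :
    baseSpan k Q * (arrowSpan k Q ^ μ * M * arrowSpan k Q ^ ν) ≤
      arrowSpan k Q ^ μ * M * arrowSpan k Q ^ ν := by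
  rw [← mul_assoc, ← mul_assoc]
  refine mul_le_mul' ?_ le_rfl
  cases μ with
  | zero => rw [pow_zero, mul_one, one_mul]; exact hM.baseSpan_mul
  | succ μ =>
    rw [pow_succ', ← mul_assoc]
    exact mul_le_mul' (mul_le_mul' baseSpan_mul_arrowSpan le_rfl) le_rfl

theorem IsQuadratic.pow_mul_baseSpan (hM : IsQuadratic M) (μ ν : ℕ) :
    arrowSpan k Q ^ μ * M * arrowSpan k Q ^ ν * baseSpan k Q ≤
      arrowSpan k Q ^ μ * M * arrowSpan k Q ^ ν := by
  rw [mul_assoc, mul_assoc, mul_assoc (arrowSpan k Q ^ μ)]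
  refine mul_le_mul' le_rfl ?_
  cases ν with
  | zero => rw [pow_zero, mul_one, one_mul]; exact hM.mul_baseSpan
  | succ ν =>
    rw [pow_succ, mul_assoc]
    exact mul_le_mul' le_rfl (mul_le_mul' le_rfl arrowSpan_mul_baseSpan)

theorem IsQuadratic.baseSpan_mul_koszulSpace (hM : IsQuadratic M) (l : ℕ) :
    baseSpan k Q * koszulSpace M l ≤ koszulSpace M l := by
  rw [Submodule.mul_le]
  intro s hs x hx
  rw [mem_koszulSpace] at hx ⊢
  exact ⟨baseSpan_mul_pathSpan l (Submodule.mul_mem_mul hs hx.1), fun μ hμ =>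
    hM.baseSpan_mul_pow _ _ (Submodule.mul_mem_mul hs (hx.2 μ hμ))⟩

theorem IsQuadratic.koszulSpace_mul_baseSpan (hM : IsQuadratic M) (l : ℕ) :
    koszulSpace M l * baseSpan k Q ≤ koszulSpace M l := by
  rw [Submodule.mul_le]
  intro x hx s hs
  rw [mem_koszulSpace] at hx ⊢
  exact ⟨pathSpan_mul_baseSpan l (Submodule.mul_mem_mul hx.1 hs), fun μ hμ =>
    hM.pow_mul_baseSpan _ _ (Submodule.mul_mem_mul (hx.2 μ hμ) hs)⟩

/-- Write `x = ∑ a ∂'_a(x)`. Removing the first arrow turns the condition of index `μ + 1` on `x`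
into that of index `μ` on `∂'_a(x)`, each of the spaces involved being stable under `S` from the
left. -/
theorem IsQuadratic.koszulSpace_succ_le [Finite Q.Arrow] (hM : IsQuadratic M) (l : ℕ) :
    koszulSpace M (l + 1) ≤ arrowSpan k Q * koszulSpace M l := by
  cases nonempty_fintype Q.Arrow
  intro x hx
  rw [mem_koszulSpace] at hx
  have h1 : x ∈ arrowSpan k Q * pathSpan k Q l := by rw [arrowSpan_mul_pathSpan]; exact hx.1
  have h2 : arrowSpan k Q * pathSpan k Q l ≤ arrowSpan k Q * ⊤ := mul_le_mul' le_rfl le_top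
  rw [← sum_mul_leftDeriv (h2 h1)]
  refine sum_mem fun a _ => Submodule.mul_mem_mul (arrow_mem_arrowSpan a) ?_
  rw [mem_koszulSpace]
  refine ⟨leftDeriv_mem (baseSpan_mul_pathSpan l) h1 a, fun μ hμ => ?_⟩
  refine leftDeriv_mem (hM.baseSpan_mul_pow _ _) ?_ a
  have := hx.2 (μ + 1) (by omega)
  rwa [pow_succ', mul_assoc, mul_assoc, ← mul_assoc _ M,
    show l + 1 - (μ + 1) - 2 = l - μ - 2 by omega] at this

theorem IsQuadratic.koszulSpace_succ_le' [Finite Q.Arrow] (hM : IsQuadratic M) (l : ℕ) :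
    koszulSpace M (l + 1) ≤ koszulSpace M l * arrowSpan k Q := by
  cases nonempty_fintype Q.Arrow
  intro x hx
  rw [mem_koszulSpace] at hx
  have h1 : x ∈ pathSpan k Q l * arrowSpan k Q := by rw [← pathSpan_succ']; exact hx.1
  have h2 : pathSpan k Q l * arrowSpan k Q ≤ ⊤ * arrowSpan k Q := mul_le_mul' le_top le_rfl
  rw [← sum_rightDeriv_mul (h2 h1)]
  refine sum_mem fun a _ => Submodule.mul_mem_mul ?_ (arrow_mem_arrowSpan a)
  rw [mem_koszulSpace]
  refine ⟨rightDeriv_mem (pathSpan_mul_baseSpan l) h1 a, fun μ hμ => ?_⟩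
  refine rightDeriv_mem (hM.pow_mul_baseSpan _ _) ?_ a
  have := hx.2 μ (by omega)
  rwa [show l + 1 - μ - 2 = l - μ - 2 + 1 by omega, pow_succ, ← mul_assoc] at this

/-- Membership in `V K_{l+1}` accounts for the conditions of index `μ ≥ 1`, and membership in `M
V^l` is the condition of index `0`. -/
theorem IsQuadratic.mem_koszulSpace_of_mem (hM : IsQuadratic M) {l : ℕ} {x : PathAlgebra k Q}
    (h1 : x ∈ arrowSpan k Q * koszulSpace M (l + 1)) (h2 : x ∈ M * pathSpan k Q l) :
    x ∈ koszulSpace M (l + 2) := by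
  rw [mem_koszulSpace]
  constructor
  · rw [← arrowSpan_mul_pathSpan]
    exact mul_le_mul' le_rfl (koszulSpace_le_pathSpan _) h1
  · rintro (_ | μ) hμ
    · rw [pow_zero, one_mul, show l + 2 - 0 - 2 = l by omega]
      cases l with
      | zero =>
        rw [pathSpan_zero] at h2
        rw [pow_zero, mul_one]
        exact hM.mul_baseSpan h2
      | succ l => rwa [pathSpan_succ] at h2
    · have h3 : koszulSpace M (l + 1) ≤
          arrowSpan k Q ^ μ * M * arrowSpan k Q ^ (l + 2 - (μ + 1) - 2) := by
        intro y hy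
        have := (mem_koszulSpace.1 hy).2 μ (by omega)
        rwa [show l + 1 - μ - 2 = l + 2 - (μ + 1) - 2 by omega] at this
      have := mul_le_mul' (le_refl (arrowSpan k Q)) h3 h1
      rwa [← mul_assoc, ← mul_assoc, ← pow_succ'] at this

theorem pathSpan_fg [Finite Q.Arrow] (l : ℕ) : (pathSpan k Q l).FG := by
  cases nonempty_fintype I
  cases nonempty_fintype Q.Arrow
  have hb : (baseSpan k Q).FG := by
    have : baseSpan k Q = Submodule.span k (Set.range (vertex k Q)) := by
      apply le_antisymm
      · rintro _ ⟨s, rfl⟩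
        change BimodTensorAlgebra.base k (I → k) (ArrowSpace k Q) s ∈ _
        rw [base_eq_sum]
        exact sum_mem fun i _ => Submodule.smul_mem _ _ (Submodule.subset_span ⟨i, rfl⟩)
      · rw [Submodule.span_le]
        rintro _ ⟨i, rfl⟩
        exact vertex_mem_baseSpan i
    rw [this]
    exact Submodule.fg_span (Set.finite_range _)
  have ha : (arrowSpan k Q).FG := by
    have : arrowSpan k Q = Submodule.span k (Set.range (arrow k Q)) := by
      apply le_antisymm
      · intro x hx
        obtain ⟨v, rfl⟩ := mem_arrowSpan.1 hx
        rw [gen_eq_sum]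
        exact sum_mem fun i _ => Submodule.smul_mem _ _ (Submodule.subset_span ⟨i, rfl⟩)
      · rw [Submodule.span_le]
        rintro _ ⟨i, rfl⟩
        exact arrow_mem_arrowSpan i
    rw [this]
    exact Submodule.fg_span (Set.finite_range _)
  exact hb.mul (ha.pow l)

theorem IsQuadratic.exists_isPathBasis_koszulSpace [Finite Q.Arrow] (hM : IsQuadratic M) (l : ℕ) :
    ∃ (B : Type u) (_ : Fintype B) (q : B → PathAlgebra k Q) (s t : B → I),
      IsPathBasis (koszulSpace M l) q s t := by
  refine exists_isPathBasis ?_ (hM.baseSpan_mul_koszulSpace l) (hM.koszulSpace_mul_baseSpan l)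
  have : Module.Finite k (pathSpan k Q l) := Module.Finite.iff_fg.2 (pathSpan_fg l)
  have h2 : Module.Finite k (koszulSpace M l) :=
    Module.Finite.of_injective (Submodule.inclusion (koszulSpace_le_pathSpan l))
      (Submodule.inclusion_injective _)
  exact Module.Finite.iff_fg.1 h2

end KoszulSpace

/-! ### Derivatives of the elements of the `K_l` and their identities -/

section Derivatives

variable {k : Type u} [Field k] {I : Type u} {Q : QuiverOn I} {M : Submodule k (PathAlgebra k Q)}

/-- Existence is the inclusion `K_{l+1} ⊆ V K_l`; uniqueness is the uniqueness of coefficients along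
a basis of `K_l`. -/
theorem existsUnique_isRightDerivative [Finite I] [Finite Q.Arrow] (hM : IsQuadratic M) {l : ℕ}
    {B C : Type u} [Fintype C] {q : B → PathAlgebra k Q} {sq tq : B → I}
    (hq : IsPathBasis (koszulSpace M (l + 1)) q sq tq)
    {p : C → PathAlgebra k Q} {sp tp : C → I} (hp : IsPathBasis (koszulSpace M l) p sp tp) :
    ∃! δ : C → B → PathAlgebra k Q, IsRightDerivative q p tp δ := by
  choose δ hδ using fun b => hp.exists_right_coeff (hM.koszulSpace_succ_le l (hq.mem b))
  refine ⟨fun c b => δ b c, hδ, fun η hη => ?_⟩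
  refine funext fun c => funext fun b => ?_
  exact congrFun (hp.eq_of_sum_mul (koszulSpace_le_pathSpan l) (fun c => ((hη b).1 c).2)
    (fun c => ((hδ b).1 c).2) ((hη b).2.symm.trans (hδ b).2)) c

theorem existsUnique_isLeftDerivative [Finite I] [Finite Q.Arrow] (hM : IsQuadratic M) {l : ℕ}
    {B C : Type u} [Fintype C] {q : B → PathAlgebra k Q} {sq tq : B → I}
    (hq : IsPathBasis (koszulSpace M (l + 1)) q sq tq)
    {p : C → PathAlgebra k Q} {sp tp : C → I} (hp : IsPathBasis (koszulSpace M l) p sp tp) :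
    ∃! δ : C → B → PathAlgebra k Q, IsLeftDerivative q p sp δ := by
  choose δ hδ using fun b => hp.exists_left_coeff (hM.koszulSpace_succ_le' l (hq.mem b))
  refine ⟨fun c b => δ b c, hδ, fun η hη => ?_⟩
  refine funext fun c => funext fun b => ?_
  exact congrFun (hp.eq_of_mul_sum (koszulSpace_le_pathSpan l) (fun c => ((hη b).1 c).2)
    (fun c => ((hδ b).1 c).2) ((hη b).2.symm.trans (hδ b).2)) c

/-- A finite homogeneous basis of a space of paths. -/
structure PathBasisData (W : Submodule k (PathAlgebra k Q)) where
  /-- the index set -/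
  idx : Type u
  /-- it is finite -/
  fintype : Fintype idx
  /-- the elements -/
  elt : idx → PathAlgebra k Q
  /-- their sources -/
  src : idx → I
  /-- their targets -/
  tgt : idx → I
  isBasis : IsPathBasis W elt src tgt

attribute [instance] PathBasisData.fintype

variable (M) in
/-- Homogeneous bases of all the `K_l`, with the derivatives of the elements of `K_{l+1}`. -/
structure KoszulSystem where
  /-- the bases -/
  basis : ∀ l, PathBasisData (koszulSpace M l)
  /-- the right derivatives -/
  dR : ∀ l, (basis l).idx → (basis (l + 1)).idx → PathAlgebra k Q
  /-- the left derivatives -/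
  dL : ∀ l, (basis l).idx → (basis (l + 1)).idx → PathAlgebra k Q
  isRight : ∀ l, IsRightDerivative (basis (l + 1)).elt (basis l).elt (basis l).tgt (dR l)
  isLeft : ∀ l, IsLeftDerivative (basis (l + 1)).elt (basis l).elt (basis l).src (dL l)

theorem IsQuadratic.exists_koszulSystem [Finite I] [Finite Q.Arrow] (hM : IsQuadratic M)
    (D : ∀ l, PathBasisData (koszulSpace M l)) : ∃ K : KoszulSystem M, K.basis = D := by
  choose δR hδR _ using fun l => existsUnique_isRightDerivative hM (D (l + 1)).isBasis (D l).isBasis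
  choose δL hδL _ using fun l => existsUnique_isLeftDerivative hM (D (l + 1)).isBasis (D l).isBasis
  exact ⟨⟨D, δR, δL, hδR, hδL⟩, rfl⟩

namespace KoszulSystem

variable (K : KoszulSystem M)

/-- The index set of the basis of `K_l`. -/
abbrev idx (l : ℕ) : Type u := (K.basis l).idx

/-- The elements of the basis of `K_l`. -/
abbrev elt (l : ℕ) : K.idx l → PathAlgebra k Q := (K.basis l).elt

/-- The sources of the elements of the basis of `K_l`. -/
abbrev src (l : ℕ) : K.idx l → I := (K.basis l).src

/-- The targets of the elements of the basis of `K_l`. -/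
abbrev tgt (l : ℕ) : K.idx l → I := (K.basis l).tgt

theorem isBasis (l : ℕ) : IsPathBasis (koszulSpace M l) (K.elt l) (K.src l) (K.tgt l) :=
  (K.basis l).isBasis

theorem elt_mem_pathSpan (l : ℕ) (b) : K.elt l b ∈ pathSpan k Q l :=
  koszulSpace_le_pathSpan l ((K.isBasis l).mem b)

theorem dR_mem (l : ℕ) (c b) : K.dR l c b ∈ arrowSpan k Q := ((K.isRight l b).1 c).1

theorem dL_mem (l : ℕ) (c b) : K.dL l c b ∈ arrowSpan k Q := ((K.isLeft l b).1 c).1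

theorem dR_mul_vertex (l : ℕ) (c b) : K.dR l c b * vertex k Q (K.tgt l c) = K.dR l c b :=
  ((K.isRight l b).1 c).2

theorem vertex_mul_dL (l : ℕ) (c b) : vertex k Q (K.src l c) * K.dL l c b = K.dL l c b :=
  ((K.isLeft l b).1 c).2

theorem elt_eq_dR (l : ℕ) (b) : K.elt (l + 1) b = ∑ c, K.dR l c b * K.elt l c := (K.isRight l b).2

theorem elt_eq_dL (l : ℕ) (b) : K.elt (l + 1) b = ∑ c, K.elt l c * K.dL l c b := (K.isLeft l b).2

/-- Cutting a representative by the vertex at which the derivative ends removes the other arrows.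
The support condition is what `sum_dR_tmul_dL` needs to absorb the vertex produced by `rightDeriv`.
-/
theorem exists_gen_dL (l : ℕ) (c b) : ∃ w : ArrowSpace k Q,
    BimodTensorAlgebra.gen k (I → k) (ArrowSpace k Q) w = K.dL l c b ∧
      ∀ a, w a ≠ 0 → Q.tgt a = K.src l c := by
  classical
  obtain ⟨w, hw⟩ := mem_arrowSpan.1 (K.dL_mem l c b)
  refine ⟨(Pi.single (K.src l c) 1 : I → k) • w, ?_, fun a ha => ?_⟩
  · rw [← BimodTensorAlgebra.base_mul_gen, hw]
    exact K.vertex_mul_dL l c b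
  · by_contra h
    refine ha ?_
    change (Pi.single (K.src l c) 1 : I → k) (Q.tgt a) * w a = 0
    rw [Pi.single_eq_of_ne h, zero_mul]

variable [Finite Q.Arrow]

/-- Multiplying `q_b` by `e_{t b}` does not change it, so by uniqueness it does not change its
coefficients. -/
theorem vertex_mul_dR (l : ℕ) (c b) :
    vertex k Q (K.tgt (l + 1) b) * K.dR l c b = K.dR l c b := by
  refine congrFun ((K.isBasis l).eq_of_sum_mul (koszulSpace_le_pathSpan l)
    (x := fun c => vertex k Q (K.tgt (l + 1) b) * K.dR l c b) (y := fun c => K.dR l c b)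
    (fun c => by rw [mul_assoc, dR_mul_vertex]) (fun c => K.dR_mul_vertex l c b) ?_) c
  simp only [mul_assoc, ← Finset.mul_sum]
  rw [← K.elt_eq_dR, (K.isBasis (l + 1)).vertex_mul]

theorem dL_mul_vertex (l : ℕ) (c b) :
    K.dL l c b * vertex k Q (K.src (l + 1) b) = K.dL l c b := by
  refine congrFun ((K.isBasis l).eq_of_mul_sum (koszulSpace_le_pathSpan l)
    (x := fun c => K.dL l c b * vertex k Q (K.src (l + 1) b)) (y := fun c => K.dL l c b)
    (fun c => by rw [← mul_assoc, vertex_mul_dL]) (fun c => K.vertex_mul_dL l c b) ?_) c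
  simp only [← mul_assoc, ← Finset.sum_mul]
  rw [← K.elt_eq_dL, (K.isBasis (l + 1)).mul_vertex]

/-- In `q_b = q_b e_{s b}` the terms whose `p_c` has another source drop out; by uniqueness their
coefficients were zero already. -/
theorem src_eq_of_dR_ne_zero {l : ℕ} {c b} (h : K.dR l c b ≠ 0) :
    K.src l c = K.src (l + 1) b := by
  classical
  by_contra hne
  refine h (Eq.trans (congrFun ((K.isBasis l).eq_of_sum_mul (koszulSpace_le_pathSpan l)
    (x := fun c => K.dR l c b)
    (y := fun c => if K.src l c = K.src (l + 1) b then K.dR l c b else 0)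
    (fun c => K.dR_mul_vertex l c b) (fun c => ?_) ?_) c) (if_neg hne))
  · split_ifs
    · exact K.dR_mul_vertex l c b
    · exact zero_mul _
  · rw [← K.elt_eq_dR]
    conv_lhs => rw [← (K.isBasis (l + 1)).mul_vertex b]
    rw [K.elt_eq_dR, Finset.sum_mul]
    refine Finset.sum_congr rfl fun c _ => ?_
    rw [← (K.isBasis l).mul_vertex c, mul_assoc, mul_assoc, vertex_mul_vertex]
    split_ifs <;> simp

theorem tgt_eq_of_dL_ne_zero {l : ℕ} {c b} (h : K.dL l c b ≠ 0) :
    K.tgt l c = K.tgt (l + 1) b := by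
  classical
  by_contra hne
  refine h (Eq.trans (congrFun ((K.isBasis l).eq_of_mul_sum (koszulSpace_le_pathSpan l)
    (x := fun c => K.dL l c b)
    (y := fun c => if K.tgt l c = K.tgt (l + 1) b then K.dL l c b else 0)
    (fun c => K.vertex_mul_dL l c b) (fun c => ?_) ?_) c) (if_neg hne))
  · split_ifs
    · exact K.vertex_mul_dL l c b
    · exact mul_zero _
  · rw [← K.elt_eq_dL]
    conv_lhs => rw [← (K.isBasis (l + 1)).vertex_mul b]
    rw [K.elt_eq_dL, Finset.mul_sum]
    refine Finset.sum_congr rfl fun c _ => ?_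
    rw [← (K.isBasis l).vertex_mul c, ← mul_assoc, ← mul_assoc, vertex_mul_vertex]
    by_cases h : K.tgt l c = K.tgt (l + 1) b
    · rw [if_pos h.symm, if_pos h, h]
    · rw [if_neg (Ne.symm h), if_neg h]; simp

/-- Expanding `q_b ∈ K_{l+2}` twice and contracting with the functional dual to `p_d` gives the sum.
Since `K_{l+2} ⊆ M V^l`, contraction of the last `l` arrows lands in `M`. -/
theorem sum_dR_mul_dR_mem [Finite I] (hM : IsQuadratic M) (l : ℕ) (d b) :
    ∑ c, K.dR (l + 1) c b * K.dR l d c ∈ M := by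
  classical
  cases nonempty_fintype Q.Arrow
  obtain ⟨φ, D, hφ, hD⟩ := (K.isBasis l).exists_rightContraction l
  have h1 : D d (K.elt (l + 2) b) = ∑ c, K.dR (l + 1) c b * K.dR l d c := by
    rw [K.elt_eq_dR, map_sum]
    refine Finset.sum_congr rfl fun c _ => ?_
    rw [K.elt_eq_dR, Finset.mul_sum, map_sum]
    simp only [← mul_assoc, hD d _ _ (K.elt_mem_pathSpan l _), hφ]
    simp only [ite_smul, one_smul, zero_smul, Finset.sum_ite_eq, Finset.mem_univ, if_true]
    rw [mul_assoc, dR_mul_vertex]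
  rw [← h1]
  have h2 := koszulSpace_le_mul_pathSpan l ((K.isBasis (l + 2)).mem b)
  generalize K.elt (l + 2) b = x at h2
  induction h2 using Submodule.mul_induction_on' with
  | mem_mul_mem m hm w hw =>
    rw [hD d _ _ hw]
    exact M.smul_mem _ (hM.2 _ m hm).2
  | add x _ y _ hx hy => rw [map_add]; exact add_mem hx hy

theorem sum_dL_mul_dL_mem [Finite I] (hM : IsQuadratic M) (l : ℕ) (d b) :
    ∑ c, K.dL l d c * K.dL (l + 1) c b ∈ M := by
  classical
  cases nonempty_fintype Q.Arrow
  obtain ⟨φ, D, hφ, hD⟩ := (K.isBasis l).exists_leftContraction l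
  have h1 : D d (K.elt (l + 2) b) = ∑ c, K.dL l d c * K.dL (l + 1) c b := by
    rw [K.elt_eq_dL, map_sum]
    refine Finset.sum_congr rfl fun c _ => ?_
    rw [K.elt_eq_dL, Finset.sum_mul, map_sum]
    simp only [mul_assoc, hD d _ _ (K.elt_mem_pathSpan l _), hφ]
    simp only [ite_smul, one_smul, zero_smul, Finset.sum_ite_eq, Finset.mem_univ, if_true]
    rw [← mul_assoc, vertex_mul_dL]
  rw [← h1]
  have h2 := koszulSpace_le_pathSpan_mul l ((K.isBasis (l + 2)).mem b)
  generalize K.elt (l + 2) b = x at h2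
  induction h2 using Submodule.mul_induction_on' with
  | mem_mul_mem w hw m hm =>
    rw [hD d _ _ hw]
    exact M.smul_mem _ (hM.2 _ m hm).1
  | add x _ y _ hx hy => rw [map_add]; exact add_mem hx hy

/-- An element of `K_{l+2}` can be expanded by removing one arrow on each side, in either order.
Splitting off the last arrow and contracting the middle with the functional dual to `p_d` compares
the two expansions. The identity is stated in a tensor product over `k` so that any bilinear
expression in the derivatives can be evaluated on it. -/
theorem sum_dR_tmul_dL (l : ℕ) (d b) :
    ∑ c, K.dR (l + 1) c b ⊗ₜ[k] K.dL l d c = ∑ c, K.dR l d c ⊗ₜ[k] K.dL (l + 1) c b := by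
  classical
  cases nonempty_fintype Q.Arrow
  obtain ⟨φ, D, hφ, hD⟩ := (K.isBasis l).exists_rightContraction l
  choose w hw hw' using fun d c => K.exists_gen_dL l d c
  choose w₁ hw₁ hw₁' using fun c => K.exists_gen_dL (l + 1) c b
  have h1 : ∀ (m : ℕ) (e : K.idx m) (u : ArrowSpace k Q), (∀ a, u a ≠ 0 → Q.tgt a = K.src m e) →
      ∀ a x, rightDeriv a (x * K.elt m e *
        BimodTensorAlgebra.gen k (I → k) (ArrowSpace k Q) u) = u a • (x * K.elt m e) := by
    intro m e u hu a x
    rw [rightDeriv_mul_gen]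
    by_cases h : u a = 0
    · rw [h, zero_smul, zero_smul]
    · rw [hu a h, mul_assoc, (K.isBasis m).mul_vertex]
  have h2 : ∀ a, ∑ c, ∑ e, w e c a • (K.dR (l + 1) c b * K.elt l e) =
      ∑ c, ∑ e, w₁ c a • (K.dR l e c * K.elt l e) := by
    intro a
    have h3 : rightDeriv a (K.elt (l + 2) b) = ∑ c, ∑ e, w e c a •
        (K.dR (l + 1) c b * K.elt l e) := by
      rw [K.elt_eq_dR, map_sum]
      refine Finset.sum_congr rfl fun c _ => ?_
      rw [K.elt_eq_dL, Finset.mul_sum, map_sum]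
      refine Finset.sum_congr rfl fun e _ => ?_
      rw [← mul_assoc, ← hw, h1 l e _ (hw' e c)]
    have h4 : rightDeriv a (K.elt (l + 2) b) = ∑ c, ∑ e, w₁ c a • (K.dR l e c * K.elt l e) := by
      rw [K.elt_eq_dL, map_sum]
      refine Finset.sum_congr rfl fun c _ => ?_
      have := h1 (l + 1) c (w₁ c) (hw₁' c) a 1
      rw [one_mul, hw₁] at this
      rw [this, K.elt_eq_dR, Finset.smul_sum]
    rw [← h3, h4]
  have h5 : ∀ a, ∑ c, w d c a • (K.dR (l + 1) c b * vertex k Q (K.tgt l d)) =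
      ∑ c, w₁ c a • K.dR l d c := by
    intro a
    have := congrArg (D d) (h2 a)
    simpa [hD d _ _ (K.elt_mem_pathSpan l _), hφ, dR_mul_vertex] using this
  -- Contraction leaves a factor `e_{t d}` behind. It is harmless: if the left derivative is
  -- nonzero, `p_d` and the element indexed by `c` have the same target, and that vertex is
  -- absorbed.
  have h6 : ∀ c, K.dR (l + 1) c b ⊗ₜ[k] K.dL l d c =
      (K.dR (l + 1) c b * vertex k Q (K.tgt l d)) ⊗ₜ[k] K.dL l d c := by
    intro c
    by_cases h : K.dL l d c = 0
    · rw [h, TensorProduct.tmul_zero, TensorProduct.tmul_zero]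
    · rw [K.tgt_eq_of_dL_ne_zero h, dR_mul_vertex]
  have h7 : ∀ d c, K.dL l d c = ∑ a, w d c a • arrow k Q a := fun d c => by rw [← gen_eq_sum, hw]
  have h8 : ∀ c, K.dL (l + 1) c b = ∑ a, w₁ c a • arrow k Q a := fun c => by
    rw [← gen_eq_sum, hw₁]
  simp only [h6]
  simp only [h7, h8, TensorProduct.tmul_sum, TensorProduct.tmul_smul]
  rw [Finset.sum_comm, Finset.sum_comm (s := (Finset.univ : Finset (K.idx (l + 1))))]
  refine Finset.sum_congr rfl fun a _ => ?_
  simp only [TensorProduct.smul_tmul', ← TensorProduct.sum_tmul, h5]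

end KoszulSystem

end Derivatives

/-! ### Graded projective modules generated in one degree -/

section GradedModules

/-- The projections `p i` onto the components of a graded abelian group. -/
structure IsGradedProj {P : Type*} [AddCommGroup P] (𝒢 : ℤ → AddSubgroup P)
    (p : ℤ → P →+ P) : Prop where
  mem : ∀ i x, p i x ∈ 𝒢 i
  of_mem : ∀ i j, ∀ x ∈ 𝒢 i, p j x = if i = j then x else 0
  mem_of_forall : ∀ (S : AddSubgroup P) x, (∀ i, p i x ∈ S) → x ∈ S

theorem exists_isGradedProj {P : Type*} [AddCommGroup P] {𝒢 : ℤ → AddSubgroup P}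
    (h : DirectSum.IsInternal 𝒢) : ∃ p, IsGradedProj 𝒢 p := by
  classical
  let e := AddEquiv.ofBijective (DirectSum.coeAddMonoidHom 𝒢) h
  have he : ∀ i (x : 𝒢 i), e (DirectSum.of (fun i => 𝒢 i) i x) = x := fun i x =>
    DirectSum.coeAddMonoidHom_of _ _ _
  refine ⟨fun i => ((𝒢 i).subtype.comp (DFinsupp.evalAddMonoidHom i)).comp e.symm.toAddMonoidHom,
    fun i x => ?_, fun i j x hx => ?_, fun S x hx => ?_⟩
  · exact ((e.symm x) i).2
  · change ((e.symm x j : 𝒢 j) : P) = _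
    rw [show e.symm x = DirectSum.of (fun i => 𝒢 i) i ⟨x, hx⟩ by
      rw [AddEquiv.symm_apply_eq, he], DirectSum.coe_of_apply]
    split_ifs <;> rfl
  · rw [← e.apply_symm_apply x]
    change ∀ i, ((e.symm x i : 𝒢 i) : P) ∈ S at hx
    rw [← DirectSum.sum_support_of (e.symm x), map_sum]
    refine sum_mem fun i _ => ?_
    rw [he]
    exact hx i

variable {k : Type u} [Field k] {I : Type u} {Q : QuiverOn I} {M : Submodule k (PathAlgebra k Q)}

namespace IsGradedProj

variable {P P' : Type*} [AddCommGroup P] [AddCommGroup P'] {𝒢 : ℤ → AddSubgroup P}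
  {𝒢' : ℤ → AddSubgroup P'} {p : ℤ → P →+ P} {p' : ℤ → P' →+ P'}

theorem map_comm (hp : IsGradedProj 𝒢 p) (hp' : IsGradedProj 𝒢' p') (d : P →+ P')
    (hd : ∀ i, ∀ x ∈ 𝒢 i, d x ∈ 𝒢' i) (i : ℤ) (x : P) : p' i (d x) = d (p i x) := by
  refine hp.mem_of_forall ((p' i).comp d - d.comp (p i)).ker x (fun j => ?_) |> sub_eq_zero.1
  change p' i (d (p j x)) - d (p i (p j x)) = 0
  rw [hp'.of_mem j i _ (hd j _ (hp.mem j x)), hp.of_mem j i _ (hp.mem j x)]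
  split_ifs <;> simp

variable [Module (QuiverAlgebra M) P]

theorem proj_smul (hp : IsGradedProj 𝒢 p) (hM : IsQuadratic M)
    (h𝒢 : ∀ m i, ∀ a ∈ lengthGrading M m, ∀ x ∈ 𝒢 i, a • x ∈ 𝒢 (m + i)) {i : ℤ} {x : P}
    (hx : x ∈ 𝒢 i) (a : QuiverAlgebra M) (j : ℤ) (m : ℕ) (hj : j = m + i) :
    p j (a • x) = hM.comp m a • x := by
  obtain ⟨N, hN⟩ := hM.eq_sum_comp a
  conv_lhs => rw [hN (max N (m + 1)) (le_max_left _ _), Finset.sum_smul, map_sum]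
  rw [Finset.sum_eq_single m]
  · rw [hp.of_mem _ _ _ (h𝒢 m i _ (hM.comp_mem m a) x hx), if_pos hj.symm]
  · intro m' _ hm'
    rw [hp.of_mem _ _ _ (h𝒢 m' i _ (hM.comp_mem m' a) x hx), if_neg]
    omega
  · intro h
    exact absurd (Finset.mem_range.2 (lt_of_lt_of_le (Nat.lt_succ_self m) (le_max_right _ _))) h

/-- `Λ` has no negative degrees, so multiplying generators of degree `l` never produces a component
of degree `j < l`. -/
theorem eq_zero_of_lt (hp : IsGradedProj 𝒢 p) (hM : IsQuadratic M)
    (h𝒢 : ∀ m i, ∀ a ∈ lengthGrading M m, ∀ x ∈ 𝒢 i, a • x ∈ 𝒢 (m + i)) {l j : ℤ}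
    (hspan : Submodule.span (QuiverAlgebra M) (𝒢 l : Set P) = ⊤) (hj : j < l) {x : P}
    (hx : x ∈ 𝒢 j) : x = 0 := by
  have h : ∀ y, p j y = 0 := by
    intro y
    have hy : y ∈ Submodule.span (QuiverAlgebra M) (𝒢 l : Set P) := hspan ▸ Submodule.mem_top
    induction hy using Submodule.closure_induction with
    | zero => exact map_zero _
    | add y z _ _ hy hz => rw [map_add, hy, hz, add_zero]
    | smul_mem a y hy =>
      obtain ⟨N, hN⟩ := hM.eq_sum_comp a
      rw [hN N le_rfl, Finset.sum_smul, map_sum]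
      refine Finset.sum_eq_zero fun m _ => ?_
      rw [hp.of_mem _ _ _ (h𝒢 m l _ (hM.comp_mem m a) y hy), if_neg]
      omega
  have := h x
  rwa [hp.of_mem j j x hx, if_pos rfl] at this

end IsGradedProj

namespace IsQuadratic

theorem comp_mul (hM : IsQuadratic M) (l : ℕ) (a b : QuiverAlgebra M) :
    hM.comp l (a * b) = ∑ ij ∈ Finset.HasAntidiagonal.antidiagonal l, hM.comp ij.1 a * hM.comp ij.2 b := by
  change Polynomial.coeff (QuotAlg.lift _ _ (a * b)) l = _
  rw [map_mul, Polynomial.coeff_mul]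
  rfl

/-- The elements without components of degree `< m`. -/
def fil (hM : IsQuadratic M) (m : ℕ) : AddSubgroup (QuiverAlgebra M) :=
  ⨅ l : Fin m, (hM.comp l).toAddMonoidHom.ker

theorem mem_fil (hM : IsQuadratic M) {m : ℕ} {a : QuiverAlgebra M} :
    a ∈ hM.fil m ↔ ∀ l < m, hM.comp l a = 0 := by
  simp only [fil, AddSubgroup.mem_iInf]
  exact ⟨fun h l hl => h ⟨l, hl⟩, fun h l => h l l.2⟩

theorem mul_mem_fil (hM : IsQuadratic M) {m : ℕ} {a b : QuiverAlgebra M} (ha : a ∈ hM.fil 1)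
    (hb : b ∈ hM.fil m) : b * a ∈ hM.fil (m + 1) := by
  rw [mem_fil] at *
  intro l hl
  rw [comp_mul]
  refine Finset.sum_eq_zero fun ij hij => ?_
  rw [Finset.HasAntidiagonal.mem_antidiagonal] at hij
  by_cases h : ij.1 < m
  · rw [hb _ h, zero_mul]
  · rw [show ij.2 = 0 by omega, ha 0 one_pos, mul_zero]

theorem eq_zero_of_mem_fil (hM : IsQuadratic M) {N : ℕ} (hN : ∀ l ≥ N, lengthGrading M l = ⊥)
    {a : QuiverAlgebra M} (ha : a ∈ hM.fil N) : a = 0 := by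
  rw [hM.eq_sum_comp_of_bounded hN a]
  exact Finset.sum_eq_zero fun l hl => hM.mem_fil.1 ha l (Finset.mem_range.1 hl)

theorem idem_mem (i : I) : idem M i ∈ lengthGrading M 0 :=
  ⟨vertex k Q i, by rw [pathSpan_zero]; exact vertex_mem_baseSpan i, rfl⟩

theorem idem_mul_self (i : I) : idem M i * idem M i = idem M i := by
  rw [idem, ← map_mul, vertex_mul_self]

theorem exists_comp_zero_mul_idem (hM : IsQuadratic M) (a : QuiverAlgebra M) (i : I) :
    ∃ c : k, hM.comp 0 a * idem M i = c • idem M i := by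
  obtain ⟨x, hx, hxa⟩ := hM.comp_mem 0 a
  rw [pathSpan_zero] at hx
  obtain ⟨s, rfl⟩ := hx
  refine ⟨s i, ?_⟩
  rw [← hxa]
  change toQuiverAlgebra M _ * toQuiverAlgebra M _ = _
  rw [← map_mul]
  exact (congrArg _ (base_mul_vertex s i)).trans (map_smul _ _ _)

theorem comp_zero_mul_idem (hM : IsQuadratic M) (l : ℕ) (a : QuiverAlgebra M) (i : I) :
    hM.comp l (a * idem M i) = hM.comp l a * idem M i := by
  rw [comp_mul, Finset.sum_eq_single (l, 0)]
  · rw [hM.comp_of_mem (idem_mem i), if_pos rfl]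
  · rintro ⟨m, n⟩ hij hne
    rw [Finset.HasAntidiagonal.mem_antidiagonal] at hij
    rw [hM.comp_of_mem (idem_mem i), if_neg, mul_zero]
    rintro rfl
    exact hne (by simp at hij; simp [hij])
  · simp

/-- A form of Nakayama's lemma: a projective module has no relations between generators that are
independent modulo `Λ_+`. -/
theorem eq_zero_of_sum_smul (hM : IsQuadratic M) [FiniteDimensional k (QuiverAlgebra M)]
    {P : Type*} [AddCommGroup P] [Module (QuiverAlgebra M) P] [Module.Projective (QuiverAlgebra M) P]
    {B : Type*} [Fintype B] (t : B → I) (w : B → P) (hw : ∀ b, idem M (t b) • w b = w b)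
    (hspan : ∀ y, ∃ z : B → QuiverAlgebra M, y = ∑ b, z b • w b)
    (h0 : ∀ z : B → QuiverAlgebra M, ∑ b, z b • w b = 0 → ∀ b, z b * idem M (t b) ∈ hM.fil 1)
    (z : B → QuiverAlgebra M) (hz : ∑ b, z b • w b = 0) (b : B) : z b * idem M (t b) = 0 := by
  classical
  obtain ⟨N, hN⟩ := hM.exists_comp_eq_zero
  let θ : (B → QuiverAlgebra M) →ₗ[QuiverAlgebra M] P := Fintype.linearCombination _ w
  have hθ : ∀ z, θ z = ∑ b, z b • w b := fun z => Fintype.linearCombination_apply _ _ _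
  obtain ⟨s, hs⟩ := Module.projective_lifting_property θ LinearMap.id (fun y => by
    obtain ⟨z, hz⟩ := hspan y
    exact ⟨z, (hθ z).trans hz.symm⟩)
  have hs' : ∀ y, θ (s y) = y := fun y => LinearMap.congr_fun hs y
  have key : ∀ z : B → QuiverAlgebra M, (∀ b, z b * idem M (t b) = z b) → θ z = 0 →
      ∀ m b, z b ∈ hM.fil m := by
    intro z hz1 hz2 m
    induction m with
    | zero => intro b; exact hM.mem_fil.2 fun l hl => absurd hl (Nat.not_lt_zero l)
    | succ m ih =>
      intro c
      -- Since `s` splits `θ`, the `g b` generate the relations, and a relation `z` equals `∑ z_b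
      -- g_b`. By `h0` each `g b`, cut by the idempotents, has entries without constant term, so
      -- every such rewriting raises the order of `z` by one.
      let g : B → B → QuiverAlgebra M := fun b => Pi.single b 1 - s (θ (Pi.single b 1))
      have hg : ∀ b, θ (g b) = 0 := fun b => by simp only [g, map_sub, hs', sub_self]
      have hzg : z = ∑ b, z b • g b := by
        have h1 : z = ∑ b, z b • (Pi.single b 1 : B → QuiverAlgebra M) := by
          ext c; simp [Finset.sum_apply, Pi.single_apply]
        have h2 : ∑ b, z b • s (θ (Pi.single b 1)) = 0 := by
          simp only [← map_smul, ← map_sum, ← h1, hz2, map_zero]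
        simp only [g, smul_sub, Finset.sum_sub_distrib, h2, sub_zero, ← h1]
      have h3 : z c = ∑ b, z b * (g b c * idem M (t c)) := by
        rw [← hz1 c]
        conv_lhs => rw [hzg]
        simp [Finset.sum_apply, Finset.sum_mul, mul_assoc]
      rw [h3]
      exact sum_mem fun b _ => hM.mul_mem_fil (h0 _ ((hθ _).symm.trans (hg b)) c) (ih b)
  refine hM.eq_zero_of_mem_fil hN (key (fun b => z b * idem M (t b)) (fun b => ?_) ?_ N b)
  · rw [mul_assoc, idem_mul_self]
  · rw [hθ]; simpa only [mul_smul, hw] using hz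

/-- A graded projective module generated in degree `l` is determined by its generators. -/
theorem projective_cover (hM : IsQuadratic M) [FiniteDimensional k (QuiverAlgebra M)]
    {P : Type*} [AddCommGroup P] [Module (QuiverAlgebra M) P] [Module.Projective (QuiverAlgebra M) P]
    {𝒢 : ℤ → AddSubgroup P} {p : ℤ → P →+ P} (hp : IsGradedProj 𝒢 p)
    (h𝒢 : ∀ m i, ∀ a ∈ lengthGrading M m, ∀ x ∈ 𝒢 i, a • x ∈ 𝒢 (m + i)) {l : ℤ}
    (hgen : Submodule.span (QuiverAlgebra M) (𝒢 l : Set P) = ⊤)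
    {Y : Type*} [AddCommGroup Y] [Module (QuiverAlgebra M) Y] (g : P →ₗ[QuiverAlgebra M] Y)
    (hg : ∀ x ∈ 𝒢 l, g x = 0 → x = 0)
    {B : Type*} [Fintype B] (t : B → I) (w : B → P) (hwl : ∀ b, w b ∈ 𝒢 l)
    (hw : ∀ b, idem M (t b) • w b = w b)
    (ha : ∀ κ : B → k, ∑ b, algebraMap k (QuiverAlgebra M) (κ b) • g (w b) = 0 → ∀ b, κ b = 0)
    (hb : ∀ y ∈ 𝒢 l, ∃ κ : B → k, g y = ∑ b, algebraMap k (QuiverAlgebra M) (κ b) • g (w b)) :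
    (∀ y, ∃ z : B → QuiverAlgebra M, y = ∑ b, z b • w b) ∧
    ∀ z : B → QuiverAlgebra M, ∑ b, z b • w b = 0 → ∀ b, z b * idem M (t b) = 0 := by
  have h0 : ∀ a, a ∈ lengthGrading M 0 → ∀ x ∈ 𝒢 l, a • x ∈ 𝒢 l := fun a ha x hx => by
    have := h𝒢 0 l a ha x hx
    rwa [Nat.cast_zero, zero_add] at this
  have halg : ∀ c : k, algebraMap k (QuiverAlgebra M) c ∈ lengthGrading M 0 := fun c =>
    ⟨algebraMap k _ c, by
      rw [pathSpan_zero, ← (BimodTensorAlgebra.base k (I → k) (ArrowSpace k Q)).commutes]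
      exact base_mem_baseSpan _, (toQuiverAlgebra M).commutes c⟩
  -- An element of the generating degree agrees with a combination of the `w b` after applying `g`,
  -- hence already before, `g` being injective in that degree.
  have hspan : ∀ y, ∃ z : B → QuiverAlgebra M, y = ∑ b, z b • w b := by
    intro y
    have hy : y ∈ Submodule.span (QuiverAlgebra M) (𝒢 l : Set P) := hgen ▸ Submodule.mem_top
    induction hy using Submodule.span_induction with
    | mem y hy =>
      obtain ⟨κ, hκ⟩ := hb y hy
      refine ⟨fun b => algebraMap k _ (κ b), sub_eq_zero.1 (hg _ ?_ ?_)⟩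
      · exact sub_mem hy (sum_mem fun b _ => h0 _ (halg _) _ (hwl b))
      · rw [map_sub, hκ, map_sum]
        simp only [map_smul, sub_self]
    | zero => exact ⟨0, by simp⟩
    | add x y _ _ hx hy =>
      obtain ⟨z, rfl⟩ := hx
      obtain ⟨z', rfl⟩ := hy
      exact ⟨z + z', by simp [add_smul, Finset.sum_add_distrib]⟩
    | smul a x _ hx =>
      obtain ⟨z, rfl⟩ := hx
      exact ⟨a • z, by simp [mul_smul, Finset.smul_sum]⟩
  refine ⟨hspan, hM.eq_zero_of_sum_smul t w hw hspan fun z hz => ?_⟩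
  choose κ hκ using fun b => hM.exists_comp_zero_mul_idem (z b) (t b)
  -- The part of degree `l` of a relation involves only the constant terms of the coefficients,
  -- which act on the `w b` as the scalars `κ b`.
  have h1 : ∑ b, algebraMap k (QuiverAlgebra M) (κ b) • w b = 0 := by
    have := congrArg (p l) hz
    rw [map_zero, map_sum] at this
    rw [← this]
    refine Finset.sum_congr rfl fun b _ => ?_
    rw [hp.proj_smul hM h𝒢 (hwl b) (z b) l 0 (by simp)]
    conv_lhs => rw [← hw b]
    conv_rhs => rw [← hw b]
    rw [← mul_smul, ← mul_smul, hκ, Algebra.smul_def]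
  have h2 : ∀ b, κ b = 0 := ha κ (by
    have := congrArg g h1
    simpa only [map_sum, map_smul, map_zero] using this)
  intro b
  rw [mem_fil]
  intro m hm
  rw [show m = 0 by omega, hM.comp_zero_mul_idem, hκ, h2, zero_smul]

end IsQuadratic

end GradedModules

/-! ### Linear resolutions and the left Koszul complex -/

section LeftKoszulComplex

variable {k : Type u} [Field k] {I : Type u} {Q : QuiverOn I} {M : Submodule k (PathAlgebra k Q)}

/-- Contraction with the functional dual to `q b` recovers `x b` from the sum and maps `N V^l` into
`N`. -/
theorem IsPathBasis.mem_of_sum_mul_mem [Finite Q.Arrow] {W : Submodule k (PathAlgebra k Q)}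
    {B : Type u} [Fintype B] {q : B → PathAlgebra k Q} {s t : B → I} (h : IsPathBasis W q s t)
    {l : ℕ} (hW : W ≤ pathSpan k Q l) {N : Submodule k (PathAlgebra k Q)}
    (hN : N * baseSpan k Q ≤ N) {x : B → PathAlgebra k Q}
    (hx : ∀ b, x b * vertex k Q (t b) = x b) (h0 : ∑ b, x b * q b ∈ N * pathSpan k Q l) (b : B) :
    x b ∈ N := by
  classical
  cases nonempty_fintype Q.Arrow
  obtain ⟨φ, D, hφ, hD⟩ := h.exists_rightContraction l
  have h1 : D b (∑ b, x b * q b) = x b := by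
    simp [hD b _ _ (hW (h.mem _)), hφ, hx]
  rw [← h1]
  generalize ∑ b, x b * q b = y at h0
  induction h0 using Submodule.mul_induction_on' with
  | mem_mul_mem m hm w hw =>
    rw [hD b _ _ hw]
    exact N.smul_mem _ (hN (Submodule.mul_mem_mul hm (vertex_mem_baseSpan _)))
  | add x _ y _ hx hy => rw [map_add]; exact add_mem hx hy

theorem mk_mem_lengthGrading_one {x : PathAlgebra k Q} (hx : x ∈ arrowSpan k Q) :
    toQuiverAlgebra M x ∈ lengthGrading M 1 := ⟨x, by rwa [pathSpan_one], rfl⟩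

/-- The kernel of `g` is the image of a module generated in degree `i`, which is zero in degrees
below `i`. -/
theorem IsGradedProj.eq_zero_of_exact {P₀ P₁ : Type*} [AddCommGroup P₀] [AddCommGroup P₁]
    {Y : Type*} [AddCommGroup Y] [Module (QuiverAlgebra M) P₀] [Module (QuiverAlgebra M) P₁]
    [Module (QuiverAlgebra M) Y] {𝒢₀ : ℤ → AddSubgroup P₀} {𝒢₁ : ℤ → AddSubgroup P₁}
    {p₀ : ℤ → P₀ →+ P₀} {p₁ : ℤ → P₁ →+ P₁}
    (hp₀ : IsGradedProj 𝒢₀ p₀) (hp₁ : IsGradedProj 𝒢₁ p₁) (hM : IsQuadratic M)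
    (h𝒢₁ : ∀ m i, ∀ a ∈ lengthGrading M m, ∀ x ∈ 𝒢₁ i, a • x ∈ 𝒢₁ (m + i))
    (d : P₁ →ₗ[QuiverAlgebra M] P₀) (g : P₀ →ₗ[QuiverAlgebra M] Y)
    (hd : ∀ i, ∀ x ∈ 𝒢₁ i, d x ∈ 𝒢₀ i) (hdg : Function.Exact d g) {i j : ℤ} (hij : j < i)
    (hgen : Submodule.span (QuiverAlgebra M) (𝒢₁ i : Set P₁) = ⊤) {x : P₀} (hx : x ∈ 𝒢₀ j)
    (h0 : g x = 0) : x = 0 := by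
  obtain ⟨y, rfl⟩ := (hdg x).1 h0
  have h1 := hp₁.map_comm hp₀ d.toAddMonoidHom hd j y
  rw [hp₁.eq_zero_of_lt hM h𝒢₁ hgen hij (hp₁.mem j y), map_zero] at h1
  have h2 := hp₀.of_mem j j _ hx
  rw [if_pos rfl] at h2
  exact h2.symm.trans h1

/-- The elements `w b` present `P` as the term `⨁_b Λ e_{t b}` of the left Koszul complex. -/
structure IsKoszulCover (K : KoszulSystem M) (l : ℕ) {P P' : Type u} [AddCommGroup P]
    [AddCommGroup P'] [Module (QuiverAlgebra M) P] [Module (QuiverAlgebra M) P']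
    (d : P' →ₗ[QuiverAlgebra M] P) (𝒢 : ℤ → AddSubgroup P) (w : K.idx l → P) : Prop where
  mem : ∀ b, w b ∈ 𝒢 l
  idem_smul : ∀ b, idem M (K.tgt l b) • w b = w b
  span : ∀ y, ∃ z : K.idx l → QuiverAlgebra M, y = ∑ b, z b • w b
  indep : ∀ z : K.idx l → QuiverAlgebra M, ∑ b, z b • w b = 0 →
    ∀ b, z b * idem M (K.tgt l b) = 0
  mem_range : ∀ v : K.idx l → PathAlgebra k Q,
    (∀ b, v b ∈ arrowSpan k Q ∧ v b * vertex k Q (K.tgt l b) = v b) →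
      ((∃ y, d y = ∑ b, toQuiverAlgebra M (v b) • w b) ↔
        ∑ b, v b * K.elt l b ∈ koszulSpace M (l + 1))

variable (K : KoszulSystem M) [Finite I]
  {P₀ P₁ P₂ : Type u} [AddCommGroup P₀] [AddCommGroup P₁] [AddCommGroup P₂]
  [Module (QuiverAlgebra M) P₀] [Module (QuiverAlgebra M) P₁] [Module (QuiverAlgebra M) P₂]
  {𝒢₀ : ℤ → AddSubgroup P₀} {𝒢₁ : ℤ → AddSubgroup P₁} {𝒢₂ : ℤ → AddSubgroup P₂}

/-- By hypothesis the image of `d₀` in degree `l + 1` is `K_{l+1}`, written in the coordinates `w`.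
Lifting a basis of `K_{l+1}` gives the new generators; they are minimal by `projective_cover`, since
the kernel of `d₀` is generated in degree `l + 2`. A combination with coefficients in `V` lies in
that kernel exactly when all its coordinates lie in `M`, which means that the corresponding element
of `V K_{l+1}` also lies in `M V^l`, that is, in `K_{l+2}`. -/
theorem IsKoszulCover.succ [Finite Q.Arrow] (hM : IsQuadratic M) [FiniteDimensional k (QuiverAlgebra M)]
    [Module.Projective (QuiverAlgebra M) P₁]
    (hI₀ : DirectSum.IsInternal 𝒢₀) (hI₁ : DirectSum.IsInternal 𝒢₁)
    (hI₂ : DirectSum.IsInternal 𝒢₂)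
    (h𝒢₀ : ∀ m i, ∀ a ∈ lengthGrading M m, ∀ x ∈ 𝒢₀ i, a • x ∈ 𝒢₀ (m + i))
    (h𝒢₁ : ∀ m i, ∀ a ∈ lengthGrading M m, ∀ x ∈ 𝒢₁ i, a • x ∈ 𝒢₁ (m + i))
    (h𝒢₂ : ∀ m i, ∀ a ∈ lengthGrading M m, ∀ x ∈ 𝒢₂ i, a • x ∈ 𝒢₂ (m + i))
    (d₀ : P₁ →ₗ[QuiverAlgebra M] P₀) (d₁ : P₂ →ₗ[QuiverAlgebra M] P₁)
    (hd₀ : ∀ i, ∀ x ∈ 𝒢₁ i, d₀ x ∈ 𝒢₀ i) (hd₁ : ∀ i, ∀ x ∈ 𝒢₂ i, d₁ x ∈ 𝒢₁ i)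
    (hex : Function.Exact d₁ d₀) (l : ℕ)
    (hgen₁ : Submodule.span (QuiverAlgebra M) (𝒢₁ (l + 1 : ℕ) : Set P₁) = ⊤)
    (hgen₂ : Submodule.span (QuiverAlgebra M) (𝒢₂ (l + 2 : ℕ) : Set P₂) = ⊤)
    {w : K.idx l → P₀} (hw : IsKoszulCover K l d₀ 𝒢₀ w) :
    ∃ w' : K.idx (l + 1) → P₁, IsKoszulCover K (l + 1) d₁ 𝒢₁ w' ∧
      ∀ b, d₀ (w' b) = ∑ c, toQuiverAlgebra M (K.dR l c b) • w c := by
  obtain ⟨p₀, hp₀⟩ := exists_isGradedProj hI₀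
  obtain ⟨p₁, hp₁⟩ := exists_isGradedProj hI₁
  obtain ⟨p₂, hp₂⟩ := exists_isGradedProj hI₂
  have hmem0 : ∀ v, v ∈ arrowSpan k Q → ∀ c, toQuiverAlgebra M v • w c ∈ 𝒢₀ (l + 1 : ℕ) := by
    intro v hv c
    have := h𝒢₀ 1 l _ (mk_mem_lengthGrading_one hv) _ (hw.mem c)
    rwa [show ((1 : ℕ) : ℤ) + (l : ℤ) = ((l + 1 : ℕ) : ℤ) by push_cast; ring] at this
  have hexists : ∀ b, ∃ y ∈ 𝒢₁ (l + 1 : ℕ), d₀ y = ∑ c, toQuiverAlgebra M (K.dR l c b) • w c := by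
    intro b
    obtain ⟨y, hy⟩ := (hw.mem_range (fun c => K.dR l c b)
      fun c => ⟨K.dR_mem l c b, K.dR_mul_vertex l c b⟩).2 (by
        rw [← K.elt_eq_dR]; exact (K.isBasis (l + 1)).mem b)
    -- The target is homogeneous of degree `l + 1` and `d₀` is graded, so the component of the
    -- preimage in this degree is a preimage too.
    refine ⟨p₁ (l + 1 : ℕ) y, hp₁.mem _ _, ?_⟩
    have := hp₁.map_comm hp₀ d₀.toAddMonoidHom hd₀ (l + 1 : ℕ) y
    refine this.symm.trans ?_
    change p₀ _ (d₀ y) = _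
    rw [hy, hp₀.of_mem _ _ _ (sum_mem fun c _ => hmem0 _ (K.dR_mem l c b) c), if_pos rfl]
  choose y hy hdy using hexists
  have hdw : ∀ b, d₀ (idem M (K.tgt (l + 1) b) • y b) =
      ∑ c, toQuiverAlgebra M (K.dR l c b) • w c := by
    intro b
    rw [map_smul, hdy, Finset.smul_sum]
    refine Finset.sum_congr rfl fun c _ => ?_
    rw [← mul_smul, idem, ← map_mul, K.vertex_mul_dR]
  have hwl : ∀ b, idem M (K.tgt (l + 1) b) • y b ∈ 𝒢₁ (l + 1 : ℕ) := fun b => by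
    have := h𝒢₁ 0 _ _ (IsQuadratic.idem_mem (K.tgt (l + 1) b)) _ (hy b)
    rwa [Nat.cast_zero, zero_add] at this
  have hsum : ∀ x : K.idx (l + 1) → PathAlgebra k Q,
      ∑ b, toQuiverAlgebra M (x b) • d₀ (idem M (K.tgt (l + 1) b) • y b) =
        ∑ c, toQuiverAlgebra M (∑ b, x b * K.dR l c b) • w c := by
    intro x
    simp only [hdw, Finset.smul_sum, map_sum, Finset.sum_smul, map_mul, mul_smul]
    rw [Finset.sum_comm]
  have hindep : ∀ x : K.idx l → PathAlgebra k Q, (∀ c, x c * vertex k Q (K.tgt l c) = x c) →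
      (∑ c, toQuiverAlgebra M (x c) • w c = 0 ↔ ∀ c, toQuiverAlgebra M (x c) = 0) := by
    intro x hx
    refine ⟨fun h c => ?_, fun h => by simp [h]⟩
    have := hw.indep _ h c
    rwa [idem, ← map_mul, hx] at this
  have hκ : ∀ κ : K.idx (l + 1) → k,
      ∑ b, algebraMap k (QuiverAlgebra M) (κ b) • d₀ (idem M (K.tgt (l + 1) b) • y b) =
        ∑ c, toQuiverAlgebra M (∑ b, κ b • K.dR l c b) • w c := by
    intro κ
    have := hsum fun b => algebraMap k _ (κ b)
    simpa only [AlgHom.commutes, ← Algebra.smul_def] using this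
  have hcut : ∀ (κ : K.idx (l + 1) → k) c,
      (∑ b, κ b • K.dR l c b) * vertex k Q (K.tgt l c) = ∑ b, κ b • K.dR l c b := fun κ c => by
    simp only [Finset.sum_mul, smul_mul_assoc, K.dR_mul_vertex]
  have helt : ∀ x : K.idx (l + 1) → PathAlgebra k Q,
      ∑ b, x b * K.elt (l + 1) b = ∑ c, (∑ b, x b * K.dR l c b) * K.elt l c := by
    intro x
    simp only [K.elt_eq_dR, Finset.mul_sum, Finset.sum_mul, mul_assoc]
    rw [Finset.sum_comm]
  have hκelt : ∀ κ : K.idx (l + 1) → k,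
      ∑ b, κ b • K.elt (l + 1) b = ∑ c, (∑ b, κ b • K.dR l c b) * K.elt l c := by
    intro κ
    have := helt fun b => algebraMap k _ (κ b)
    simpa only [← Algebra.smul_def] using this
  obtain ⟨hspan, hind⟩ := hM.projective_cover hp₁ h𝒢₁ hgen₁ d₀
    (fun x hx h0 => hp₁.eq_zero_of_exact hp₂ hM h𝒢₂ d₁ d₀ hd₁ hex (by push_cast; omega) hgen₂ hx h0)
    (K.tgt (l + 1)) (fun b => idem M (K.tgt (l + 1) b) • y b) hwl
    (fun b => by rw [← mul_smul, IsQuadratic.idem_mul_self]) (by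
      intro κ h0
      rw [hκ, hindep _ (hcut κ)] at h0
      have h1 : ∀ c, ∑ b, κ b • K.dR l c b = 0 := fun c => hM.eq_zero_of_arrowSpan (h0 c)
        (sum_mem fun b _ => Submodule.smul_mem _ _ (K.dR_mem l c b))
      refine Fintype.linearIndependent_iff.1 (K.isBasis (l + 1)).linearIndependent κ ?_
      rw [hκelt]
      simp only [h1, zero_mul, Finset.sum_const_zero])
    (by
      intro x hx
      obtain ⟨z, hz⟩ := hw.span (d₀ x)
      choose v hv hvz using fun b => hM.comp_mem 1 (z b)
      have h1 : d₀ x = ∑ b, toQuiverAlgebra M (v b * vertex k Q (K.tgt l b)) • w b := by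
        have h2 := hp₀.of_mem _ (l + 1 : ℕ) _ (hd₀ _ _ hx)
        rw [if_pos rfl] at h2
        rw [← h2, hz, map_sum]
        refine Finset.sum_congr rfl fun b _ => ?_
        rw [hp₀.proj_smul hM h𝒢₀ (hw.mem b) (z b) _ 1 (by push_cast; ring), ← hvz, map_mul,
          mul_smul]
        change _ = toQuiverAlgebra M (v b) • (idem M _ • w b)
        rw [hw.idem_smul]
        rfl
      have h3 : ∀ b, v b * vertex k Q (K.tgt l b) ∈ arrowSpan k Q := fun b =>
        arrowSpan_mul_baseSpan (Submodule.mul_mem_mul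
          (by have := hv b; rwa [SetLike.mem_coe, pathSpan_one] at this) (vertex_mem_baseSpan _))
      have h4 := (hw.mem_range (fun b => v b * vertex k Q (K.tgt l b)) fun b =>
        ⟨h3 b, by rw [mul_assoc, vertex_mul_self]⟩).1 ⟨x, h1⟩
      obtain ⟨κ, h5⟩ := (K.isBasis (l + 1)).exists_sum_smul h4
      rw [hκelt] at h5
      have h6 := (K.isBasis l).eq_of_sum_mul (koszulSpace_le_pathSpan l)
        (fun b => by rw [mul_assoc, vertex_mul_self]) (hcut κ) h5
      refine ⟨κ, ?_⟩
      rw [hκ, h1]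
      refine Finset.sum_congr rfl fun b _ => ?_
      rw [← congrFun h6 b])
  refine ⟨_, ⟨hwl, fun b => by rw [← mul_smul, IsQuadratic.idem_mul_self], hspan, hind, ?_⟩, hdw⟩
  intro v hv
  have h1 := hex (∑ b, toQuiverAlgebra M (v b) • (idem M (K.tgt (l + 1) b) • y b))
  -- By exactness, lying in the image of `d₁` means being killed by `d₀`, which is a condition on
  -- the coordinates in `P₀`.
  refine Iff.trans ⟨fun ⟨x, hx⟩ => ⟨x, hx⟩, fun ⟨x, hx⟩ => ⟨x, hx⟩⟩ (h1.symm.trans ?_)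
  have hcutv : ∀ c, (∑ b, v b * K.dR l c b) * vertex k Q (K.tgt l c) = ∑ b, v b * K.dR l c b :=
    fun c => by simp only [Finset.sum_mul, mul_assoc, K.dR_mul_vertex]
  rw [map_sum]
  simp only [map_smul d₀ (toQuiverAlgebra M _)]
  rw [hsum, hindep _ hcutv]
  have hmemV : ∀ c, ∑ b, v b * K.dR l c b ∈ pathSpan k Q 2 := by
    intro c
    rw [pathSpan_succ, pow_succ, pow_one]
    exact sum_mem fun b _ => Submodule.mul_mem_mul (hv b).1 (K.dR_mem l c b)
  constructor
  · intro h0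
    refine hM.mem_koszulSpace_of_mem
      (sum_mem fun b _ => Submodule.mul_mem_mul (hv b).1 ((K.isBasis (l + 1)).mem b)) ?_
    rw [helt]
    exact sum_mem fun c _ => Submodule.mul_mem_mul (hM.mem_of_eq_zero (h0 c) (hmemV c))
      (K.elt_mem_pathSpan l c)
  · intro h0 c
    have h2 := koszulSpace_le_mul_pathSpan l h0
    rw [helt] at h2
    exact QuotAlg.mk_eq_zero ((K.isBasis l).mem_of_sum_mul_mem (koszulSpace_le_pathSpan l)
      hM.mul_baseSpan hcutv h2 c)

/-- The basis of `K_0 = S` maps to a basis of `Λ/Λ_+`, and lifts of degree `0` generate `P₀`. Both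
sides of the last condition hold automatically: `K_1 = V`, and elements of degree `1` die in
`Λ/Λ_+`. -/
theorem IsKoszulCover.zero (hM : IsQuadratic M) [FiniteDimensional k (QuiverAlgebra M)]
    [Module.Projective (QuiverAlgebra M) P₀]
    (hI₀ : DirectSum.IsInternal 𝒢₀) (hI₁ : DirectSum.IsInternal 𝒢₁)
    (h𝒢₀ : ∀ m i, ∀ a ∈ lengthGrading M m, ∀ x ∈ 𝒢₀ i, a • x ∈ 𝒢₀ (m + i))
    (h𝒢₁ : ∀ m i, ∀ a ∈ lengthGrading M m, ∀ x ∈ 𝒢₁ i, a • x ∈ 𝒢₁ (m + i))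
    (d₀ : P₁ →ₗ[QuiverAlgebra M] P₀)
    (ε : P₀ →ₗ[QuiverAlgebra M] QuiverAlgebra M ⧸ augIdeal (lengthGrading M))
    (hd₀ : ∀ i, ∀ x ∈ 𝒢₁ i, d₀ x ∈ 𝒢₀ i) (hε : ∀ i, i ≠ 0 → ∀ x ∈ 𝒢₀ i, ε x = 0)
    (hsurj : Function.Surjective ε) (hex : Function.Exact d₀ ε)
    (hgen₀ : Submodule.span (QuiverAlgebra M) (𝒢₀ 0 : Set P₀) = ⊤)
    (hgen₁ : Submodule.span (QuiverAlgebra M) (𝒢₁ 1 : Set P₁) = ⊤) :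
    ∃ w : K.idx 0 → P₀, IsKoszulCover K 0 d₀ 𝒢₀ w := by
  obtain ⟨p₀, hp₀⟩ := exists_isGradedProj hI₀
  obtain ⟨p₁, hp₁⟩ := exists_isGradedProj hI₁
  let mkQ := (augIdeal (lengthGrading M)).mkQ
  have haug : ∀ a ∈ augIdeal (lengthGrading M), hM.comp 0 a = 0 := by
    intro a ha
    induction ha using Submodule.closure_induction with
    | zero => exact map_zero _
    | add x y _ _ hx hy => rw [map_add, hx, hy, add_zero]
    | smul_mem a x hx =>
      obtain ⟨m, hm⟩ := Set.mem_iUnion.1 hx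
      rw [smul_eq_mul, hM.comp_mul]
      simp [hM.comp_of_mem hm]
  have hbase : ∀ c, K.elt 0 c ∈ baseSpan k Q := fun c => by
    rw [← pathSpan_zero]; exact K.elt_mem_pathSpan 0 c
  have hεp : ∀ x, ε (p₀ 0 x) = ε x := by
    intro x
    refine hp₀.mem_of_forall (ε.toAddMonoidHom.comp (p₀ 0) - ε.toAddMonoidHom).ker x
      (fun j => ?_) |> sub_eq_zero.1
    change ε (p₀ 0 (p₀ j x)) - ε (p₀ j x) = 0
    rw [hp₀.of_mem j 0 _ (hp₀.mem j x)]
    split_ifs with h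
    · exact sub_self _
    · rw [map_zero, hε j h _ (hp₀.mem j x), sub_zero]
  choose y hy using fun c => hsurj (mkQ (toQuiverAlgebra M (K.elt 0 c)))
  have hεw : ∀ c, ε (idem M (K.tgt 0 c) • p₀ 0 (y c)) = mkQ (toQuiverAlgebra M (K.elt 0 c)) := by
    intro c
    rw [map_smul, hεp, hy, ← map_smul, smul_eq_mul, idem, ← map_mul, (K.isBasis 0).vertex_mul]
  have hwl : ∀ c, idem M (K.tgt 0 c) • p₀ 0 (y c) ∈ 𝒢₀ 0 := fun c => by
    have := h𝒢₀ 0 _ _ (IsQuadratic.idem_mem (K.tgt 0 c)) _ (hp₀.mem 0 (y c))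
    rwa [Nat.cast_zero, zero_add] at this
  have hκ : ∀ κ : K.idx 0 → k,
      ∑ c, algebraMap k (QuiverAlgebra M) (κ c) • ε (idem M (K.tgt 0 c) • p₀ 0 (y c)) =
        mkQ (toQuiverAlgebra M (∑ c, κ c • K.elt 0 c)) := by
    intro κ
    simp only [hεw, map_sum, Algebra.smul_def, ← map_smul mkQ, smul_eq_mul, map_mul,
      AlgHom.commutes]
  obtain ⟨hspan, hind⟩ := hM.projective_cover hp₀ h𝒢₀ hgen₀ ε
    (fun x hx h0 => hp₀.eq_zero_of_exact hp₁ hM h𝒢₁ d₀ ε hd₀ hex one_pos hgen₁ hx h0)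
    (K.tgt 0) (fun c => idem M (K.tgt 0 c) • p₀ 0 (y c)) hwl
    (fun b => by rw [← mul_smul, IsQuadratic.idem_mul_self]) (by
      intro κ h0
      rw [hκ, Submodule.mkQ_apply, Submodule.Quotient.mk_eq_zero] at h0
      have h1 : ∑ c, κ c • K.elt 0 c ∈ baseSpan k Q :=
        sum_mem fun c _ => Submodule.smul_mem _ _ (hbase c)
      have h2 := haug _ h0
      have h3 : toQuiverAlgebra M (∑ c, κ c • K.elt 0 c) ∈ lengthGrading M 0 :=
        ⟨_, by rwa [SetLike.mem_coe, pathSpan_zero], rfl⟩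
      rw [hM.comp_of_mem h3, if_pos rfl] at h2
      exact Fintype.linearIndependent_iff.1 (K.isBasis 0).linearIndependent κ
        (hM.eq_zero_of_baseSpan h2 h1))
    (by
      intro x _
      obtain ⟨a, ha⟩ := Submodule.mkQ_surjective _ (ε x)
      obtain ⟨s, hs, hsa⟩ := hM.comp_mem 0 a
      obtain ⟨κ, hκs⟩ := (K.isBasis 0).exists_sum_smul (w := s) (by
        rw [koszulSpace_zero, ← pathSpan_zero]; exact hs)
      refine ⟨κ, ?_⟩
      rw [hκ, ← hκs, ← ha, ← sub_eq_zero, ← map_sub]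
      change mkQ (a - (toQuiverAlgebra M).toLinearMap s) = 0
      rw [hsa, Submodule.mkQ_apply, Submodule.Quotient.mk_eq_zero]
      obtain ⟨N, hN⟩ := hM.eq_sum_comp a
      -- The bound `N + 1` makes the range nonempty, so the constant term can be split off; the
      -- remaining components have positive degree and lie in `Λ_+`.
      rw [sub_eq_iff_eq_add.2 ((hN (N + 1) (Nat.le_succ _)).trans (Finset.sum_range_succ' _ _))]
      exact sum_mem fun m _ => Submodule.subset_span (Set.mem_iUnion.2 ⟨m, hM.comp_mem _ _⟩))
  refine ⟨_, hwl, fun b => by rw [← mul_smul, IsQuadratic.idem_mul_self], hspan, hind, ?_⟩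
  intro v hv
  constructor
  · intro _
    rw [koszulSpace_one]
    exact sum_mem fun c _ => arrowSpan_mul_baseSpan (Submodule.mul_mem_mul (hv c).1 (hbase c))
  · intro _
    refine (hex _).1 ?_
    rw [map_sum]
    refine Finset.sum_eq_zero fun c _ => ?_
    rw [map_smul, hεw, ← map_smul, smul_eq_mul, ← map_mul, Submodule.mkQ_apply,
      Submodule.Quotient.mk_eq_zero]
    exact Submodule.subset_span (Set.mem_iUnion.2 ⟨0, mk_mem_lengthGrading_one
      (arrowSpan_mul_baseSpan (Submodule.mul_mem_mul (hv c).1 (hbase c)))⟩)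

/-- A linear resolution of `S` is isomorphic to the left Koszul complex. -/
theorem IsKoszul.exists_covers [Finite Q.Arrow] (hM : IsQuadratic M) [FiniteDimensional k (QuiverAlgebra M)]
    {P : ℕ → ModuleCat.{u} (QuiverAlgebra M)} {𝒢 : ∀ l, ℤ → AddSubgroup (P l)}
    {d : ∀ l, P (l + 1) →ₗ[QuiverAlgebra M] P l}
    {ε : P 0 →ₗ[QuiverAlgebra M] QuiverAlgebra M ⧸ augIdeal (lengthGrading M)}
    (hI : ∀ l, DirectSum.IsInternal (𝒢 l))
    (h𝒢 : ∀ l m i, ∀ a ∈ lengthGrading M m, ∀ x ∈ 𝒢 l i, a • x ∈ 𝒢 l (m + i))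
    (hd : ∀ l i, ∀ x ∈ 𝒢 (l + 1) i, d l x ∈ 𝒢 l i)
    (hε : ∀ i, i ≠ 0 → ∀ x ∈ 𝒢 0 i, ε x = 0)
    (hproj : ∀ l, Module.Projective (QuiverAlgebra M) (P l))
    (hsurj : Function.Surjective ε) (hex₀ : Function.Exact (d 0) ε)
    (hex : ∀ l, Function.Exact (d (l + 1)) (d l))
    (hgen : ∀ l : ℕ, Submodule.span (QuiverAlgebra M) (𝒢 l l : Set (P l)) = ⊤) :
    ∃ w : ∀ l, K.idx l → P l, (∀ l, IsKoszulCover K l (d l) (𝒢 l) (w l)) ∧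
      ∀ l b, d l (w (l + 1) b) = ∑ c, toQuiverAlgebra M (K.dR l c b) • w l c := by
  obtain ⟨w₀, hw₀⟩ := IsKoszulCover.zero K hM (hI 0) (hI 1) (h𝒢 0) (h𝒢 1) (d 0) ε (hd 0) hε hsurj
    hex₀ (hgen 0) (hgen 1)
  choose f hf hf' using fun l (w : {w : K.idx l → P l // IsKoszulCover K l (d l) (𝒢 l) w}) =>
    IsKoszulCover.succ K hM (hI l) (hI (l + 1)) (hI (l + 2)) (h𝒢 l) (h𝒢 (l + 1)) (h𝒢 (l + 2))
      (d l) (d (l + 1)) (hd l) (hd (l + 1)) (hex l) l (hgen (l + 1)) (hgen (l + 2)) w.2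
  let W : ∀ l, {w : K.idx l → P l // IsKoszulCover K l (d l) (𝒢 l) w} :=
    Nat.rec ⟨w₀, hw₀⟩ fun l w => ⟨f l w, hf l w⟩
  exact ⟨fun l => (W l).1, fun l => (W l).2, fun l b => hf' l (W l) b⟩

end LeftKoszulComplex

/-! ### Ext groups from explicit projective resolutions -/

section Resolutions

/-- A projective resolution of a module, in terms of linear maps. -/
structure LinearResolution (R : Type u) [Ring R] (X : Type u) [AddCommGroup X] [Module R X] where
  /-- the terms -/
  P : ℕ → ModuleCat.{u} R
  /-- the differentials -/
  d : ∀ l, P (l + 1) →ₗ[R] P l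
  /-- the augmentation -/
  ε : P 0 →ₗ[R] X
  projective : ∀ l, Module.Projective R (P l)
  surjective : Function.Surjective ε
  exact_zero : Function.Exact (d 0) ε
  exact_succ : ∀ l, Function.Exact (d (l + 1)) (d l)

namespace LinearResolution

variable {R : Type u} [Ring R] {X : Type u} [AddCommGroup X] [Module R X]
  (L : LinearResolution R X)

theorem d_comp_d (l : ℕ) : ModuleCat.ofHom (L.d (l + 1)) ≫ ModuleCat.ofHom (L.d l) = 0 := by
  ext x
  exact (L.exact_succ l).apply_apply_eq_zero x

/-- The underlying chain complex. -/
def complex : ChainComplex (ModuleCat.{u} R) ℕ :=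
  ChainComplex.of L.P (fun l => ModuleCat.ofHom (L.d l)) L.d_comp_d

theorem complex_d (l : ℕ) : L.complex.d (l + 1) l = ModuleCat.ofHom (L.d l) :=
  ChainComplex.of_d (fun l => L.P l) (fun l => ModuleCat.ofHom (L.d l)) l

theorem complex_d_comp_ε : L.complex.d 1 0 ≫ ModuleCat.ofHom L.ε = 0 := by
  rw [complex_d]
  ext x
  exact L.exact_zero.apply_apply_eq_zero x

theorem complex_exactAt_succ (n : ℕ) : L.complex.ExactAt (n + 1) := by
  rw [HomologicalComplex.exactAt_iff' _ (n + 1 + 1) (n + 1) n (by simp) (by simp)]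
  rw [ShortComplex.moduleCat_exact_iff]
  intro x hx
  change (L.complex.d (n + 1) n).hom x = 0 at hx
  rw [complex_d] at hx
  obtain ⟨y, hy⟩ := (L.exact_succ n x).1 hx
  refine ⟨y, ?_⟩
  change (L.complex.d (n + 2) (n + 1)).hom y = x
  rw [complex_d]
  exact hy

/-- The corresponding projective resolution in the category of modules. -/
def toProjectiveResolution : ProjectiveResolution (ModuleCat.of R X) where
  complex := L.complex
  projective l := by
    have := L.projective l
    exact ModuleCat.projective_of_categoryTheory_projective (L.P l)
  π := (ChainComplex.toSingle₀Equiv _ _).symm ⟨ModuleCat.ofHom L.ε, L.complex_d_comp_ε⟩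
  quasiIso := ⟨fun n => by
    cases n
    · rw [ChainComplex.quasiIsoAt₀_iff, ShortComplex.quasiIso_iff_of_zeros']
      · have h : (ShortComplex.mk _ _ L.complex_d_comp_ε).Exact ∧ Epi (ModuleCat.ofHom L.ε) := by
          refine ⟨?_, (ModuleCat.epi_iff_surjective _).2 L.surjective⟩
          rw [ShortComplex.moduleCat_exact_iff]
          intro x hx
          obtain ⟨y, hy⟩ := (L.exact_zero x).1 hx
          refine ⟨y, ?_⟩
          change (L.complex.d 1 0).hom y = x
          rw [complex_d]
          exact hy
        refine (ShortComplex.exact_and_epi_g_iff_of_iso ?_).2 h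
        exact ShortComplex.isoMk (Iso.refl _) (Iso.refl _) (Iso.refl _)
          ((Category.id_comp _).trans (Category.comp_id _).symm)
          ((Category.id_comp _).trans
            (((ChainComplex.toSingle₀Equiv_symm_apply_f_zero (C := L.complex) _
              L.complex_d_comp_ε).symm).trans (Category.comp_id _).symm))
      all_goals rfl
    · rw [quasiIsoAt_iff_exactAt']
      · apply complex_exactAt_succ
      · apply ChainComplex.exactAt_succ_single_obj⟩

variable {N : Type u} [AddCommGroup N] [Module R N] {n : ℕ}

theorem d_comp_eq_zero {f : L.P n →ₗ[R] N} (hf : f ∘ₗ L.d n = 0) :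
    L.toProjectiveResolution.complex.d (n + 1) n ≫
      (show L.toProjectiveResolution.complex.X n ⟶ ModuleCat.of R N from ModuleCat.ofHom f) = 0 := by
  change L.complex.d (n + 1) n ≫ ModuleCat.ofHom f = 0
  rw [complex_d]
  ext x
  exact LinearMap.congr_fun hf x

/-- The class in `Ext^n` of a cocycle. -/
def extClass (f : L.P n →ₗ[R] N) (hf : f ∘ₗ L.d n = 0) : ExtGroup (R := R) X N n :=
  L.toProjectiveResolution.extMk (ModuleCat.ofHom f) (n + 1) rfl (L.d_comp_eq_zero hf)

theorem extClass_add (f g : L.P n →ₗ[R] N) (hf : f ∘ₗ L.d n = 0) (hg : g ∘ₗ L.d n = 0) :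
    L.extClass (f + g) (by rw [LinearMap.add_comp, hf, hg, add_zero]) =
      L.extClass f hf + L.extClass g hg :=
  (ProjectiveResolution.add_extMk _ _ _ _ _ _ _).symm

theorem extClass_surjective (x : ExtGroup (R := R) X N n) : ∃ f hf, L.extClass f hf = x := by
  obtain ⟨f, hf, rfl⟩ := L.toProjectiveResolution.extMk_surjective x (n + 1) rfl
  refine ⟨f.hom, ?_, rfl⟩
  change L.complex.d (n + 1) n ≫ f = 0 at hf
  rw [complex_d] at hf
  exact congrArg ModuleCat.Hom.hom hf

theorem extClass_eq_zero_iff {m : ℕ} (f : L.P (m + 1) →ₗ[R] N) (hf : f ∘ₗ L.d (m + 1) = 0) :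
    L.extClass f hf = 0 ↔ ∃ g : L.P m →ₗ[R] N, g ∘ₗ L.d m = f := by
  refine (ProjectiveResolution.extMk_eq_zero_iff _ _ _ _ _ m rfl).trans ⟨?_, ?_⟩
  · rintro ⟨g, hg⟩
    refine ⟨g.hom, ?_⟩
    change L.complex.d (m + 1) m ≫ g = _ at hg
    rw [complex_d] at hg
    exact congrArg ModuleCat.Hom.hom hg
  · rintro ⟨g, rfl⟩
    refine ⟨ModuleCat.ofHom g, ?_⟩
    change L.complex.d (m + 1) m ≫ ModuleCat.ofHom g = _
    rw [complex_d]
    rfl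

theorem extClass_comp {N' : Type u} [AddCommGroup N'] [Module R N'] (f : L.P n →ₗ[R] N)
    (hf : f ∘ₗ L.d n = 0) (g : N →ₗ[R] N') :
    (L.extClass f hf).comp (Abelian.Ext.mk₀ (ModuleCat.ofHom g)) (add_zero n) =
      L.extClass (g ∘ₗ f) (by rw [LinearMap.comp_assoc, hf, LinearMap.comp_zero]) :=
  ProjectiveResolution.extMk_comp_mk₀ _ _ _ _ _ _

/-- A chain map lifting an endomorphism, as a morphism of projective resolutions. -/
def homOfEnd (g : X →ₗ[R] X) (φ : ∀ l, L.P l →ₗ[R] L.P l) (hφ : ∀ l, φ l ∘ₗ L.d l = L.d l ∘ₗ φ (l + 1))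
    (hε : L.ε ∘ₗ φ 0 = g ∘ₗ L.ε) :
    ProjectiveResolution.Hom L.toProjectiveResolution L.toProjectiveResolution
      (ModuleCat.ofHom g) where
  hom := show L.complex ⟶ L.complex from
    ChainComplex.ofHom (fun l => show L.P l ⟶ L.P l from ModuleCat.ofHom (φ l)) fun l => by
      rw [complex_d]
      exact congrArg ModuleCat.ofHom (hφ l).symm
  hom_f_zero_comp_π_f_zero := by
    have h : L.toProjectiveResolution.π.f 0 = ModuleCat.ofHom L.ε :=
      ChainComplex.toSingle₀Equiv_symm_apply_f_zero _ _
    rw [h]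
    exact congrArg ModuleCat.ofHom hε

theorem comp_extClass (g : X →ₗ[R] X) (φ : ∀ l, L.P l →ₗ[R] L.P l)
    (hφ : ∀ l, φ l ∘ₗ L.d l = L.d l ∘ₗ φ (l + 1)) (hε : L.ε ∘ₗ φ 0 = g ∘ₗ L.ε)
    (f : L.P n →ₗ[R] N) (hf : f ∘ₗ L.d n = 0) :
    (Abelian.Ext.mk₀ (ModuleCat.ofHom g)).comp (L.extClass f hf) (zero_add n) =
      L.extClass (f ∘ₗ φ n) (by
        rw [LinearMap.comp_assoc, hφ, ← LinearMap.comp_assoc, hf, LinearMap.zero_comp]) :=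
  ProjectiveResolution.mk₀_comp_extMk _ _ _ _ (L.homOfEnd g φ hφ hε)

end LinearResolution

end Resolutions

/-! ### Exactness of the left Koszul complex and the vanishing of `K_{n+1}` -/

section KoszulConsequences

variable {k : Type u} [Field k] {I : Type u} {Q : QuiverOn I} {M : Submodule k (PathAlgebra k Q)}

namespace KoszulSystem

variable (K : KoszulSystem M)

/-- The right derivatives, as elements of `Λ`. -/
def mR (l : ℕ) (c : K.idx l) (b : K.idx (l + 1)) : QuiverAlgebra M :=
  toQuiverAlgebra M (K.dR l c b)

/-- The left derivatives, as elements of `Λ`. -/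
def mL (l : ℕ) (c : K.idx l) (b : K.idx (l + 1)) : QuiverAlgebra M :=
  toQuiverAlgebra M (K.dL l c b)

theorem mR_mul_idem (l : ℕ) (c b) : K.mR l c b * idem M (K.tgt l c) = K.mR l c b := by
  rw [mR, idem, ← map_mul, dR_mul_vertex]

theorem idem_mul_mL (l : ℕ) (c b) : idem M (K.src l c) * K.mL l c b = K.mL l c b := by
  rw [mL, idem, ← map_mul, vertex_mul_dL]

theorem mR_mem (l : ℕ) (c b) : K.mR l c b ∈ lengthGrading M 1 :=
  mk_mem_lengthGrading_one (K.dR_mem l c b)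

theorem mL_mem (l : ℕ) (c b) : K.mL l c b ∈ lengthGrading M 1 :=
  mk_mem_lengthGrading_one (K.dL_mem l c b)

theorem sum_mR_tmul_mL [Finite Q.Arrow] (l : ℕ) (d b) :
    ∑ c, K.mR (l + 1) c b ⊗ₜ[k] K.mL l d c = ∑ c, K.mR l d c ⊗ₜ[k] K.mL (l + 1) c b := by
  have h := congrArg (TensorProduct.map (toQuiverAlgebra M).toLinearMap
    (toQuiverAlgebra M).toLinearMap) (K.sum_dR_tmul_dL l d b)
  rw [map_sum, map_sum] at h
  exact h

theorem idem_mul_mR [Finite Q.Arrow] (l : ℕ) (c b) :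
    idem M (K.tgt (l + 1) b) * K.mR l c b = K.mR l c b := by
  rw [mR, idem, ← map_mul, vertex_mul_dR]

theorem mL_mul_idem [Finite Q.Arrow] (l : ℕ) (c b) :
    K.mL l c b * idem M (K.src (l + 1) b) = K.mL l c b := by
  rw [mL, idem, ← map_mul, dL_mul_vertex]

theorem mR_eq_zero [Finite Q.Arrow] {l : ℕ} {c b} (h : K.src l c ≠ K.src (l + 1) b) :
    K.mR l c b = 0 := by
  rw [mR, not_not.1 (mt K.src_eq_of_dR_ne_zero h), map_zero]

theorem mL_eq_zero [Finite Q.Arrow] {l : ℕ} {c b} (h : K.tgt l c ≠ K.tgt (l + 1) b) :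
    K.mL l c b = 0 := by
  rw [mL, not_not.1 (mt K.tgt_eq_of_dL_ne_zero h), map_zero]

theorem sum_mR_mul_mR [Finite I] [Finite Q.Arrow] (hM : IsQuadratic M) (l : ℕ) (d b) :
    ∑ c, K.mR (l + 1) c b * K.mR l d c = 0 := by
  have h := QuotAlg.mk_eq_zero (k := k) (K.sum_dR_mul_dR_mem hM l d b)
  rw [map_sum] at h
  simp only [map_mul] at h
  exact h

theorem sum_mL_mul_mL [Finite I] [Finite Q.Arrow] (hM : IsQuadratic M) (l : ℕ) (d b) :
    ∑ c, K.mL l d c * K.mL (l + 1) c b = 0 := by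
  have h := QuotAlg.mk_eq_zero (k := k) (K.sum_dL_mul_dL_mem hM l d b)
  rw [map_sum] at h
  simp only [map_mul] at h
  exact h

/-- Exactness in positive degrees of the left Koszul complex. -/
def LeftExact : Prop :=
  ∀ l (z : K.idx (l + 1) → QuiverAlgebra M), (∀ b, z b * idem M (K.tgt (l + 1) b) = z b) →
    (∀ c, ∑ b, z b * K.mR l c b = 0) →
    ∃ y : K.idx (l + 2) → QuiverAlgebra M, ∀ b, z b = ∑ b', y b' * K.mR (l + 1) b b'

variable [Finite I] [Finite Q.Arrow]

/-- The covers `w` carry the left Koszul complex to the given exact resolution. Coefficients with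
respect to `w` are determined once they are cut by the idempotents at the targets, so exactness can
be read back. -/
theorem leftExact_of_isKoszul (hM : IsQuadratic M) [FiniteDimensional k (QuiverAlgebra M)]
    (h : IsKoszul (lengthGrading M)) : K.LeftExact := by
  obtain ⟨P, 𝒢, d, ε, hI, h𝒢, hd, hε, hproj, hsurj, hex₀, hex, hgen⟩ := h
  obtain ⟨w, hw, hdw⟩ := IsKoszul.exists_covers K hM hI h𝒢 hd hε hproj hsurj hex₀ hex hgen
  intro l z hz h0
  have h1 : d l (∑ b, z b • w (l + 1) b) = 0 := by
    simp only [map_sum, map_smul, hdw, Finset.smul_sum, smul_smul]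
    rw [Finset.sum_comm]
    refine Finset.sum_eq_zero fun c _ => ?_
    rw [← Finset.sum_smul]
    exact (congrArg (· • w l c) (h0 c)).trans (zero_smul _ _)
  obtain ⟨x, hx⟩ := (hex l _).1 h1
  obtain ⟨y, rfl⟩ := (hw (l + 2)).span x
  refine ⟨y, fun b => ?_⟩
  have h2 : ∑ b, (z b - ∑ b', y b' * K.mR (l + 1) b b') • w (l + 1) b = 0 := by
    simp only [sub_smul, Finset.sum_sub_distrib]
    rw [← hx, sub_eq_zero]
    simp only [map_sum, map_smul, hdw, Finset.smul_sum, smul_smul, Finset.sum_smul]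
    exact Finset.sum_comm
  have h3 := (hw (l + 1)).indep _ h2 b
  rw [sub_mul, hz, Finset.sum_mul, sub_eq_zero] at h3
  rw [h3]
  exact Finset.sum_congr rfl fun b' _ => by rw [mul_assoc, mR_mul_idem]

/-- Vanishing of `Ext^{n+1}` out of `S` makes the map of the `(n+1)`-st term onto the image of `d n`
extend over the `n`-th term. All entries of the differentials have degree `1`, so comparing constant
terms shows that the idempotent at the target of an element of the basis of `K_{n+1}` is zero. -/
theorem isEmpty_idx (hM : IsQuadratic M) [FiniteDimensional k (QuiverAlgebra M)]
    (h : IsKoszul (lengthGrading M)) {n : ℕ} (hn : globalDimension (QuiverAlgebra M) = n) :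
    IsEmpty (K.idx (n + 1)) := by
  classical
  obtain ⟨P, 𝒢, d, ε, hI, h𝒢, hd, hε, hproj, hsurj, hex₀, hex, hgen⟩ := h
  obtain ⟨w, hw, hdw⟩ := IsKoszul.exists_covers K hM hI h𝒢 hd hε hproj hsurj hex₀ hex hgen
  let L : LinearResolution (QuiverAlgebra M)
    (QuiverAlgebra M ⧸ augIdeal (lengthGrading M)) := ⟨P, d, ε, hproj, hsurj, hex₀, hex⟩
  have hpd : HasProjectiveDimensionLT (ModuleCat.of (QuiverAlgebra M)
      (QuiverAlgebra M ⧸ augIdeal (lengthGrading M))) (n + 1) := by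
    refine (projectiveDimension_le_iff _ n).1 (le_trans ?_ hn.le)
    exact le_iSup (fun N : ModuleCat.{u} (QuiverAlgebra M) => projectiveDimension N) _
  -- The cocycle is `d n` itself, with values in its own image.
  have h0 : L.extClass (n := n + 1) (d n).rangeRestrict (by
      ext x
      exact (hex n).apply_apply_eq_zero x) = 0 :=
    Abelian.Ext.eq_zero_of_hasProjectiveDimensionLT _ (n + 1) le_rfl
  obtain ⟨g, hg⟩ := (L.extClass_eq_zero_iff _ _).1 h0
  have hg' : ∀ x, g (d n x) = (d n).rangeRestrict x := fun x => LinearMap.congr_fun hg x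
  refine ⟨fun b => ?_⟩
  have h1 : ∀ c, ∃ y : K.idx (n + 1) → QuiverAlgebra M,
      (g (w n c) : P n) = d n (∑ b', y b' • w (n + 1) b') := by
    intro c
    obtain ⟨x, hx⟩ := (g (w n c)).2
    obtain ⟨y, rfl⟩ := (hw (n + 1)).span x
    exact ⟨y, hx.symm⟩
  choose y hy using h1
  have h2 : d n (w (n + 1) b - ∑ b', (∑ c, K.mR n c b * y c b') • w (n + 1) b') = 0 := by
    have h3 := congrArg Subtype.val (hg' (w (n + 1) b))
    rw [hdw, map_sum] at h3
    rw [map_sub, sub_eq_zero]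
    refine h3.symm.trans ?_
    rw [AddSubmonoidClass.coe_finsetSum]
    simp only [map_smul, Submodule.coe_smul, hy, map_sum, Finset.sum_smul]
    simp only [Finset.smul_sum, smul_smul]
    exact Finset.sum_comm
  obtain ⟨x, hx⟩ := (hex n _).1 h2
  obtain ⟨y', rfl⟩ := (hw (n + 2)).span x
  -- A relation among the minimal generators: its coefficient at `b` is `1` minus terms each
  -- containing an entry `mR` of degree `1`.
  have h4 : ∑ b', ((if b' = b then 1 else 0) - ∑ c, K.mR n c b * y c b' -
      ∑ b'', y' b'' * K.mR (n + 1) b' b'') • w (n + 1) b' = 0 := by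
    simp only [sub_smul, Finset.sum_sub_distrib, ite_smul, one_smul, zero_smul,
      Finset.sum_ite_eq', Finset.mem_univ, if_true]
    rw [← hx, sub_eq_zero]
    simp only [map_sum, map_smul, hdw, Finset.smul_sum, smul_smul, Finset.sum_smul]
    exact Finset.sum_comm
  have h5 := congrArg (hM.comp 0) ((hw (n + 1)).indep _ h4 b)
  have h6 : ∀ a a' : QuiverAlgebra M, hM.comp 0 (a * a') = hM.comp 0 a * hM.comp 0 a' := by
    intro a a'
    rw [hM.comp_mul]
    exact Finset.sum_singleton _ _
  have h7 : ∀ l c b', hM.comp 0 (K.mR l c b') = 0 := fun l c b' => by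
    rw [hM.comp_of_mem (K.mR_mem l c b'), if_neg one_ne_zero]
  rw [if_pos rfl, sub_mul, sub_mul, one_mul, map_sub, map_sub, Finset.sum_mul, Finset.sum_mul,
    map_sum, map_sum, map_zero] at h5
  simp only [h6, h7, zero_mul, mul_zero, Finset.sum_const_zero, sub_zero] at h5
  rw [hM.comp_of_mem (IsQuadratic.idem_mem _), if_pos rfl] at h5
  refine (K.isBasis (n + 1)).ne_zero b ?_
  rw [← (K.isBasis (n + 1)).homogeneous b, hM.eq_zero_of_baseSpan h5 (vertex_mem_baseSpan _),
    zero_mul, zero_mul]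

end KoszulSystem

end KoszulConsequences

/-! ### Linear algebra over the ground field -/

section LinearAlgebra

variable {k : Type*} [Field k]

/-- A linear section over the image is extended to all of `W`. Such inverses yield `k`-linear
homotopies, which survive tensoring with `X`. -/
theorem exists_generalizedInverse {V W : Type*} [AddCommGroup V] [AddCommGroup W] [Module k V]
    [Module k W] (f : V →ₗ[k] W) : ∃ g : W →ₗ[k] V, ∀ x, f (g (f x)) = f x := by
  obtain ⟨s, hs⟩ := f.rangeRestrict.exists_rightInverse_of_surjective f.range_rangeRestrict
  obtain ⟨g, hg⟩ := s.exists_extend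
  refine ⟨g, fun x => ?_⟩
  have h1 : g (f x) = s (f.rangeRestrict x) := LinearMap.congr_fun hg (f.rangeRestrict x)
  rw [h1]
  exact congrArg Subtype.val (LinearMap.congr_fun hs (f.rangeRestrict x))

variable {A X W : Type*} [AddCommGroup A] [Module k A] [AddCommGroup X] [Module k X]
  [AddCommGroup W] [Module k W] {B B' : Type*} [Fintype B]

theorem pi_tensor_ext {f g : (B → A ⊗[k] X) →ₗ[k] W}
    (h : ∀ (v : B → A) x, f (fun b => v b ⊗ₜ x) = g fun b => v b ⊗ₜ x) : f = g := by
  classical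
  refine LinearMap.pi_ext' fun b => TensorProduct.ext' fun a x => ?_
  have := h (Pi.single b a) x
  have h1 : (fun b' => (Pi.single b a : B → A) b' ⊗ₜ[k] x) = Pi.single b (a ⊗ₜ[k] x) := by
    funext b'
    by_cases hb : b' = b
    · subst hb
      simp
    · simp [hb]
  rwa [h1] at this

variable (X) in
open Classical in
/-- The map `f ⊗ X` on families of tensors. -/
def piTensor (f : (B → A) →ₗ[k] (B' → A)) : (B → A ⊗[k] X) →ₗ[k] (B' → A ⊗[k] X) :=
  LinearMap.pi fun b' => ∑ b,
    (LinearMap.rTensor X (LinearMap.proj b' ∘ₗ f ∘ₗ LinearMap.single k (fun _ => A) b)) ∘ₗ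
      LinearMap.proj b

theorem piTensor_tmul (f : (B → A) →ₗ[k] (B' → A)) (v : B → A) (x : X) :
    piTensor X f (fun b => v b ⊗ₜ x) = fun b' => f v b' ⊗ₜ x := by
  classical
  funext b'
  have h : f v = ∑ b, f (Pi.single b (v b)) := by
    rw [← map_sum, Finset.univ_sum_single]
  rw [h, Finset.sum_apply, TensorProduct.sum_tmul]
  simp only [piTensor, LinearMap.pi_apply, LinearMap.coe_sum, Finset.sum_apply]
  rfl

end LinearAlgebra

/-! ### The operators on `Λ ⊗ X` that make up the Koszul differential -/

section Twist

variable (k A X : Type u) [Field k] [Ring A] [Algebra k A] [AddCommGroup X] [Module k X]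
  [Module A X] [IsScalarTower k A X]

/-- The map `b ⊗ x ↦ b r ⊗ a x`. -/
def twist : A →ₗ[k] A →ₗ[k] Module.End k (A ⊗[k] X) :=
  (TensorProduct.mapBilinear (RingHom.id k) A X A X).compl₁₂ (LinearMap.mul k A).flip
    (Algebra.lsmul k k X).toLinearMap

/-- The map `b ⊗ x ↦ b x`. -/
def tensorAct : A ⊗[k] X →ₗ[k] X := TensorProduct.lift (Algebra.lsmul k k X).toLinearMap

variable {k A X}

@[simp]
theorem twist_tmul (r a b : A) (x : X) :
    twist k A X r a (b ⊗ₜ x) = (b * r) ⊗ₜ (a • x) := rfl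

@[simp]
theorem tensorAct_tmul (b : A) (x : X) : tensorAct k A X (b ⊗ₜ x) = b • x := rfl

theorem twist_twist (r a r' a' : A) (w : A ⊗[k] X) :
    twist k A X r a (twist k A X r' a' w) = twist k A X (r' * r) (a * a') w := by
  induction w with
  | zero => simp only [map_zero]
  | add x y hx hy => simp only [map_add, hx, hy]
  | tmul b x => simp only [twist_tmul, mul_assoc, mul_smul]

end Twist

/-! ### The Koszul complex with coefficients in a module -/

namespace KoszulSystem

variable {k : Type u} [Field k] {I : Type u} {Q : QuiverOn I} {M : Submodule k (PathAlgebra k Q)}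
  (K : KoszulSystem M) (X : Type u) [AddCommGroup X] [Module k X] [Module (QuiverAlgebra M) X]
  [IsScalarTower k (QuiverAlgebra M) X]

section Operators

/-- The projection of `⨁_b Λ ⊗ X` onto `⨁_b Λ e_{t b} ⊗ e_{s b} X`. -/
def cut (l : ℕ) : Module.End k (K.idx l → QuiverAlgebra M ⊗[k] X) :=
  LinearMap.pi fun b => twist k _ X (idem M (K.tgt l b)) (idem M (K.src l b)) ∘ₗ LinearMap.proj b

/-- The components of the Koszul differential. -/
def coef (l : ℕ) (c : K.idx l) (b : K.idx (l + 1)) : Module.End k (QuiverAlgebra M ⊗[k] X) :=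
  twist k _ X (K.mR l c b) 1 + (-1 : k) ^ (l + 1) • twist k _ X 1 (K.mL l c b)

/-- The Koszul differential, with coefficients in `X`. -/
def diff (l : ℕ) : (K.idx (l + 1) → QuiverAlgebra M ⊗[k] X) →ₗ[k]
    (K.idx l → QuiverAlgebra M ⊗[k] X) :=
  LinearMap.pi fun c => ∑ b, K.coef X l c b ∘ₗ LinearMap.proj b

/-- The left part of the differential. -/
def diffRight (l : ℕ) : (K.idx (l + 1) → QuiverAlgebra M) →ₗ[k] (K.idx l → QuiverAlgebra M) :=
  LinearMap.pi fun c => ∑ b, LinearMap.mulRight k (K.mR l c b) ∘ₗ LinearMap.proj b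

/-- The right part of the differential. -/
def diffLeft (l : ℕ) : (K.idx (l + 1) → QuiverAlgebra M ⊗[k] X) →ₗ[k]
    (K.idx l → QuiverAlgebra M ⊗[k] X) :=
  LinearMap.pi fun c => ∑ b, twist k _ X 1 (K.mL l c b) ∘ₗ LinearMap.proj b

/-- The projection of `⨁_b Λ` onto `⨁_b Λ e_{t b}`. -/
def cutRight (l : ℕ) : Module.End k (K.idx l → QuiverAlgebra M) :=
  LinearMap.pi fun b => LinearMap.mulRight k (idem M (K.tgt l b)) ∘ₗ LinearMap.proj b

/-- The augmentation `⨁_c Λ e_{t c} ⊗ e_{s c} X → X`. -/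
def aug : (K.idx 0 → QuiverAlgebra M ⊗[k] X) →ₗ[k] X :=
  ∑ c, tensorAct k _ X ∘ₗ twist k _ X (toQuiverAlgebra M (K.elt 0 c)) 1 ∘ₗ LinearMap.proj c

variable {X}

theorem cut_apply (l : ℕ) (z b) :
    K.cut X l z b = twist k _ X (idem M (K.tgt l b)) (idem M (K.src l b)) (z b) := rfl

theorem diff_apply (l : ℕ) (z c) : K.diff X l z c = ∑ b, K.coef X l c b (z b) := by
  simp only [diff, LinearMap.pi_apply, LinearMap.coe_sum, Finset.sum_apply]
  rfl

theorem diffRight_apply (l : ℕ) (z c) : K.diffRight l z c = ∑ b, z b * K.mR l c b := by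
  simp only [diffRight, LinearMap.pi_apply, LinearMap.coe_sum, Finset.sum_apply]
  rfl

theorem diffLeft_apply (l : ℕ) (z c) :
    K.diffLeft X l z c = ∑ b, twist k _ X 1 (K.mL l c b) (z b) := by
  simp only [diffLeft, LinearMap.pi_apply, LinearMap.coe_sum, Finset.sum_apply]
  rfl

theorem cutRight_apply (l : ℕ) (z b) : K.cutRight l z b = z b * idem M (K.tgt l b) := rfl

theorem aug_apply (z) : K.aug X z =
    ∑ c, tensorAct k _ X (twist k _ X (toQuiverAlgebra M (K.elt 0 c)) 1 (z c)) := by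
  simp only [aug, LinearMap.coe_sum, Finset.sum_apply]
  rfl

theorem coef_apply (l : ℕ) (c b) (w) : K.coef X l c b w =
    twist k _ X (K.mR l c b) 1 w + (-1 : k) ^ (l + 1) • twist k _ X 1 (K.mL l c b) w := rfl

theorem cut_cut (l : ℕ) (z) : K.cut X l (K.cut X l z) = K.cut X l z := by
  funext b
  rw [cut_apply, cut_apply, twist_twist, IsQuadratic.idem_mul_self, IsQuadratic.idem_mul_self]

theorem diff_eq (l : ℕ) (z) : K.diff X l z =
    piTensor X (K.diffRight l) z + (-1 : k) ^ (l + 1) • K.diffLeft X l z := by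
  suffices h : K.diff X l = piTensor X (K.diffRight l) + (-1 : k) ^ (l + 1) • K.diffLeft X l from
    LinearMap.congr_fun h z
  refine pi_tensor_ext fun v x => ?_
  rw [LinearMap.add_apply, piTensor_tmul, LinearMap.smul_apply]
  funext c
  rw [diff_apply, Pi.add_apply, diffRight_apply, Pi.smul_apply, diffLeft_apply,
    TensorProduct.sum_tmul, Finset.smul_sum, ← Finset.sum_add_distrib]
  refine Finset.sum_congr rfl fun b _ => ?_
  rw [coef_apply, twist_tmul, one_smul]

theorem aug_cut (z) : K.aug X (K.cut X 0 z) = K.aug X z := by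
  rw [aug_apply, aug_apply]
  refine Finset.sum_congr rfl fun c _ => ?_
  rw [cut_apply, twist_twist]
  generalize z c = w
  induction w with
  | zero => simp only [map_zero]
  | add x y hx hy => simp only [map_add, hx, hy]
  | tmul a x =>
    simp only [twist_tmul, tensorAct_tmul, ← mul_smul, mul_one, one_mul]
    rw [mul_assoc, idem, idem, ← map_mul, ← map_mul, (K.isBasis 0).homogeneous]

/-- The two parts of the differential contribute `∑ δ^R p` and `∑ p δ^L`. Both equal `q_b`, and they
enter with opposite signs. -/
theorem aug_diff (z) : K.aug X (K.diff X 0 z) = 0 := by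
  suffices h : K.aug X ∘ₗ K.diff X 0 = 0 from LinearMap.congr_fun h z
  refine pi_tensor_ext fun v x => ?_
  rw [LinearMap.comp_apply, LinearMap.zero_apply, aug_apply]
  simp only [diff_apply, map_sum, coef_apply, map_add, map_smul, twist_tmul, tensorAct_tmul,
    ← mul_smul, mul_one, one_mul, one_smul, zero_add, pow_one, neg_smul, ← sub_eq_add_neg]
  rw [Finset.sum_comm]
  refine Finset.sum_eq_zero fun b _ => ?_
  rw [Finset.sum_sub_distrib, ← Finset.sum_smul, ← Finset.sum_smul, sub_eq_zero]
  congr 1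
  simp only [mul_assoc, ← Finset.mul_sum]
  congr 1
  simp only [mR, mL, ← map_mul, ← map_sum]
  rw [← K.elt_eq_dR, ← K.elt_eq_dL]

variable [Finite Q.Arrow]

/-- A right derivative matches idempotents on the left factor and is zero unless the sources agree;
a left derivative does the same with the roles of the two sides exchanged. -/
theorem coef_cut (l : ℕ) (c b w) :
    K.coef X l c b (twist k _ X (idem M (K.tgt (l + 1) b)) (idem M (K.src (l + 1) b)) w) =
      twist k _ X (idem M (K.tgt l c)) (idem M (K.src l c)) (K.coef X l c b w) := by
  simp only [coef_apply, map_add, map_smul, twist_twist, mul_one, one_mul]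
  congr 1
  · rw [K.idem_mul_mR, K.mR_mul_idem]
    by_cases h : K.src l c = K.src (l + 1) b
    · rw [h]
    · rw [K.mR_eq_zero h, map_zero]
      rfl
  · rw [K.mL_mul_idem, K.idem_mul_mL]
    by_cases h : K.tgt l c = K.tgt (l + 1) b
    · rw [h]
    · rw [K.mL_eq_zero h, map_zero, map_zero]

theorem diff_cut (l : ℕ) (z) : K.diff X l (K.cut X (l + 1) z) = K.cut X l (K.diff X l z) := by
  funext c
  rw [diff_apply, cut_apply, diff_apply, map_sum]
  exact Finset.sum_congr rfl fun b _ => K.coef_cut l c b _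

variable [Finite I]

/-- Products of two derivatives of the same side vanish in `Λ`. The mixed terms agree by
`sum_mR_tmul_mL`, and cancel because the sign changes from `l + 1` to `l + 2`. -/
theorem diff_diff (hM : IsQuadratic M) (l : ℕ) (z) : K.diff X l (K.diff X (l + 1) z) = 0 := by
  funext d
  rw [diff_apply, Pi.zero_apply]
  simp only [diff_apply, map_sum]
  rw [Finset.sum_comm]
  refine Finset.sum_eq_zero fun b _ => ?_
  simp only [coef_apply, map_add, map_smul, twist_twist, mul_one, one_mul, Finset.sum_add_distrib,
    ← Finset.smul_sum]
  have h1 : ∑ c, twist k _ X (K.mR (l + 1) c b * K.mR l d c) 1 (z b) = 0 := by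
    rw [← LinearMap.sum_apply, ← LinearMap.sum_apply, ← map_sum, K.sum_mR_mul_mR hM, map_zero]
    rfl
  have h2 : ∑ c, twist k _ X 1 (K.mL l d c * K.mL (l + 1) c b) (z b) = 0 := by
    rw [← LinearMap.sum_apply, ← map_sum, K.sum_mL_mul_mL hM, map_zero]
    rfl
  have h3 : ∑ c, twist k _ X (K.mR (l + 1) c b) (K.mL l d c) (z b) =
      ∑ c, twist k _ X (K.mR l d c) (K.mL (l + 1) c b) (z b) := by
    have h := congrArg (TensorProduct.lift (twist k _ X)) (K.sum_mR_tmul_mL l d b)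
    simp only [map_sum, TensorProduct.lift.tmul] at h
    have h' := LinearMap.congr_fun h (z b)
    simpa only [LinearMap.sum_apply] using h'
  rw [h1, h2, h3, pow_succ (-1 : k) (l + 1)]
  module

end Operators

end KoszulSystem

/-! ### Exactness of the Koszul complex in positive degrees -/

namespace KoszulSystem

variable {k : Type u} [Field k] {I : Type u} {Q : QuiverOn I} {M : Submodule k (PathAlgebra k Q)}
  (K : KoszulSystem M) {X : Type u} [AddCommGroup X] [Module k X] [Module (QuiverAlgebra M) X]

section Filtration

variable (M X) in
/-- The subspace of `Λ ⊗ X` spanned by the `a ⊗ b x` with `b` of degree `m`. -/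
def tensorFil (m : ℕ) : Submodule k (QuiverAlgebra M ⊗[k] X) :=
  Submodule.span k {w | ∃ a, ∃ b ∈ lengthGrading M m, ∃ x : X, w = a ⊗ₜ (b • x)}

theorem twist_mem_tensorFil [IsScalarTower k (QuiverAlgebra M) X] {j m : ℕ} (r : QuiverAlgebra M) {a : QuiverAlgebra M}
    (ha : a ∈ lengthGrading M j) {w : QuiverAlgebra M ⊗[k] X} (hw : w ∈ tensorFil M X m) :
    twist k _ X r a w ∈ tensorFil M X (j + m) := by
  induction hw using Submodule.span_induction with
  | zero => rw [map_zero]; exact Submodule.zero_mem _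
  | add x y _ _ hx hy => rw [map_add]; exact Submodule.add_mem _ hx hy
  | smul c x _ hx => rw [map_smul]; exact Submodule.smul_mem _ _ hx
  | mem w hw =>
    obtain ⟨b, c, hc, x, rfl⟩ := hw
    refine Submodule.subset_span ⟨b * r, a * c, toQuiverAlgebra_mul_mem_lengthGrading ha hc, x, ?_⟩
    rw [twist_tmul, mul_smul]

theorem rTensor_mem_tensorFil (f : QuiverAlgebra M →ₗ[k] QuiverAlgebra M) {m : ℕ}
    {w : QuiverAlgebra M ⊗[k] X} (hw : w ∈ tensorFil M X m) :
    LinearMap.rTensor X f w ∈ tensorFil M X m := by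
  induction hw using Submodule.span_induction with
  | zero => rw [map_zero]; exact Submodule.zero_mem _
  | add x y _ _ hx hy => rw [map_add]; exact Submodule.add_mem _ hx hy
  | smul c x _ hx => rw [map_smul]; exact Submodule.smul_mem _ _ hx
  | mem w hw =>
    obtain ⟨b, c, hc, x, rfl⟩ := hw
    exact Submodule.subset_span ⟨f b, c, hc, x, rfl⟩

theorem piTensor_mem_tensorFil {B B' : Type u} [Fintype B]
    (f : (B → QuiverAlgebra M) →ₗ[k] (B' → QuiverAlgebra M)) {m : ℕ}
    {z : B → QuiverAlgebra M ⊗[k] X} (hz : ∀ b, z b ∈ tensorFil M X m) (b' : B') :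
    piTensor X f z b' ∈ tensorFil M X m := by
  simp only [piTensor, LinearMap.pi_apply, LinearMap.coe_sum, Finset.sum_apply]
  exact Submodule.sum_mem _ fun b _ => rTensor_mem_tensorFil _ (hz b)

theorem mem_tensorFil_zero (w : QuiverAlgebra M ⊗[k] X) : w ∈ tensorFil M X 0 := by
  induction w with
  | zero => exact Submodule.zero_mem _
  | add x y hx hy => exact Submodule.add_mem _ hx hy
  | tmul a x =>
    refine Submodule.subset_span ⟨a, 1, ⟨1, ?_, map_one (toQuiverAlgebra M)⟩, x, by rw [one_smul]⟩
    rw [pathSpan_zero]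
    exact Submodule.one_le.1 one_le_baseSpan

theorem eq_zero_of_mem_tensorFil {m : ℕ} (hm : lengthGrading M m = ⊥) {w : QuiverAlgebra M ⊗[k] X}
    (hw : w ∈ tensorFil M X m) : w = 0 := by
  induction hw using Submodule.span_induction with
  | zero => rfl
  | add x y _ _ hx hy => rw [hx, hy, add_zero]
  | smul c x _ hx => rw [hx, smul_zero]
  | mem w hw =>
    obtain ⟨a, b, hb, x, rfl⟩ := hw
    rw [hm, Submodule.mem_bot] at hb
    rw [hb, zero_smul, TensorProduct.tmul_zero]

variable [IsScalarTower k (QuiverAlgebra M) X]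

theorem diffLeft_mem_tensorFil {l m : ℕ} {z : K.idx (l + 1) → QuiverAlgebra M ⊗[k] X}
    (hz : ∀ b, z b ∈ tensorFil M X m) (c) : K.diffLeft X l z c ∈ tensorFil M X (m + 1) := by
  rw [diffLeft_apply, add_comm m]
  exact Submodule.sum_mem _ fun b _ => twist_mem_tensorFil _ (K.mL_mem l c b) (hz b)

theorem cut_mem_tensorFil {l m : ℕ} {z : K.idx l → QuiverAlgebra M ⊗[k] X}
    (hz : ∀ b, z b ∈ tensorFil M X m) (b) : K.cut X l z b ∈ tensorFil M X m := by
  rw [cut_apply, ← zero_add m]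
  exact twist_mem_tensorFil _ (IsQuadratic.idem_mem _) (hz b)

end Filtration

section Exactness

variable [IsScalarTower k (QuiverAlgebra M) X]

theorem piTensor_cutRight (l : ℕ) (z : K.idx l → QuiverAlgebra M ⊗[k] X) (b) :
    piTensor X (K.cutRight l) z b = twist k _ X (idem M (K.tgt l b)) 1 (z b) := by
  suffices H : LinearMap.proj b ∘ₗ piTensor X (K.cutRight l) =
      twist k _ X (idem M (K.tgt l b)) 1 ∘ₗ LinearMap.proj b from LinearMap.congr_fun H z
  refine pi_tensor_ext fun v x => ?_
  rw [LinearMap.comp_apply, piTensor_tmul, LinearMap.comp_apply]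
  simp only [LinearMap.proj_apply, twist_tmul, one_smul]
  rfl

variable [Finite Q.Arrow]

variable {K} in
/-- A partial contracting homotopy of the left Koszul complex. -/
theorem LeftExact.exists_homotopy (hK : K.LeftExact) (l : ℕ) :
    ∃ (h : (K.idx l → QuiverAlgebra M) →ₗ[k] (K.idx (l + 1) → QuiverAlgebra M))
      (h' : (K.idx (l + 1) → QuiverAlgebra M) →ₗ[k] (K.idx (l + 2) → QuiverAlgebra M)),
      ∀ z, K.cutRight (l + 1) z = h (K.diffRight l z) + K.diffRight (l + 1) (h' z) := by
  obtain ⟨s, hs⟩ := exists_generalizedInverse (K.diffRight l)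
  obtain ⟨s', hs'⟩ := exists_generalizedInverse (K.diffRight (l + 1))
  -- Subtracting `s (d z)` turns `z` into a cycle `v`, whose cut is a boundary by left exactness;
  -- `s'` then selects a primitive of it linearly in `z`.
  refine ⟨K.cutRight (l + 1) ∘ₗ s,
    s' ∘ₗ K.cutRight (l + 1) ∘ₗ (LinearMap.id - s ∘ₗ K.diffRight l), fun z => ?_⟩
  set v := z - s (K.diffRight l z)
  have hv : K.diffRight l v = 0 := by rw [map_sub, hs, sub_self]
  have h1 : K.diffRight l (K.cutRight (l + 1) v) = 0 := by
    rw [← hv]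
    funext c
    rw [diffRight_apply, diffRight_apply]
    refine Finset.sum_congr rfl fun b _ => ?_
    rw [cutRight_apply, mul_assoc, idem_mul_mR]
  obtain ⟨y, hy⟩ := hK l (K.cutRight (l + 1) v)
    (fun b => by rw [cutRight_apply, mul_assoc, IsQuadratic.idem_mul_self])
    (fun c => by rw [← diffRight_apply, h1]; rfl)
  have h2 : K.cutRight (l + 1) v = K.diffRight (l + 1) y := by
    funext b
    rw [hy, diffRight_apply]
  have h3 : K.diffRight (l + 1) (s' (K.cutRight (l + 1) v)) = K.cutRight (l + 1) v := by
    rw [h2, hs']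
  change _ = K.cutRight (l + 1) (s (K.diffRight l z)) +
    K.diffRight (l + 1) (s' (K.cutRight (l + 1) v))
  rw [h3, ← map_add, add_sub_cancel]

variable {K} in
-- For a cycle the right-derivative part of the differential equals, up to sign, the left-derivative
-- part, which has order `m + 1`. The homotopy of the left Koszul complex, tensored with `X`,
-- therefore writes `z` as a boundary up to terms of order `m + 1`.
theorem LeftExact.exists_sub_mem (hK : K.LeftExact) (l : ℕ) {m : ℕ}
    (z : K.idx (l + 1) → QuiverAlgebra M ⊗[k] X) (hz : K.cut X (l + 1) z = z)
    (hd : K.diff X l z = 0) (hm : ∀ b, z b ∈ tensorFil M X m) :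
    ∃ u, ∀ b, (z - K.diff X (l + 1) (K.cut X (l + 2) u)) b ∈ tensorFil M X (m + 1) := by
  obtain ⟨h, h', hh⟩ := hK.exists_homotopy l
  have h1 : piTensor X (K.cutRight (l + 1)) z = piTensor X h (piTensor X (K.diffRight l) z) +
      piTensor X (K.diffRight (l + 1)) (piTensor X h' z) := by
    suffices H : piTensor X (K.cutRight (l + 1)) =
        piTensor X h ∘ₗ piTensor X (K.diffRight l) +
          piTensor X (K.diffRight (l + 1)) ∘ₗ piTensor X h' from LinearMap.congr_fun H z
    refine pi_tensor_ext fun v x => ?_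
    rw [LinearMap.add_apply, LinearMap.comp_apply, LinearMap.comp_apply]
    simp only [piTensor_tmul, hh]
    funext b
    exact TensorProduct.add_tmul _ _ _
  have h2 : piTensor X (K.cutRight (l + 1)) z = z := by
    funext b
    rw [piTensor_cutRight, ← hz, cut_apply, twist_twist, IsQuadratic.idem_mul_self, one_mul]
  have h3 := K.diff_eq l z
  rw [hd] at h3
  refine ⟨piTensor X h' z, fun b => ?_⟩
  rw [diff_cut]
  nth_rewrite 1 [← hz]
  rw [← map_sub]
  revert b
  refine K.cut_mem_tensorFil ?_
  have h4 : z - K.diff X (l + 1) (piTensor X h' z) =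
      piTensor X h (-((-1 : k) ^ (l + 1) • K.diffLeft X l z)) -
        (-1 : k) ^ (l + 2) • K.diffLeft X (l + 1) (piTensor X h' z) := by
    rw [K.diff_eq, ← eq_neg_of_add_eq_zero_left h3.symm]
    nth_rewrite 1 [← h2]
    rw [h1]
    abel
  -- The homotopy maps do not touch the factor `X`, so they preserve the order; the two remaining
  -- terms each contain one `diffLeft`.
  intro b
  rw [h4]
  refine Submodule.sub_mem _ (piTensor_mem_tensorFil _ (fun c => ?_) b)
    (Submodule.smul_mem _ _ (K.diffLeft_mem_tensorFil (piTensor_mem_tensorFil _ hm) b))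
  exact Submodule.neg_mem _ (Submodule.smul_mem _ _ (K.diffLeft_mem_tensorFil hm c))

variable [Finite I]

variable {K} in
-- Corrections by boundaries raise the order of a cycle step by step. The degrees of `Λ` are bounded
-- by `N`, so at order `N` nothing is left.
theorem LeftExact.exists_eq_diff (hK : K.LeftExact) (hM : IsQuadratic M)
    [FiniteDimensional k (QuiverAlgebra M)] (l : ℕ)
    (z : K.idx (l + 1) → QuiverAlgebra M ⊗[k] X) (hz : K.cut X (l + 1) z = z)
    (hd : K.diff X l z = 0) : ∃ u, K.diff X (l + 1) (K.cut X (l + 2) u) = z := by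
  obtain ⟨N, hN⟩ := hM.exists_comp_eq_zero
  have key : ∀ m, ∀ z : K.idx (l + 1) → QuiverAlgebra M ⊗[k] X, K.cut X (l + 1) z = z →
      K.diff X l z = 0 → (∀ b, z b ∈ tensorFil M X (N - m)) →
      ∃ u, K.diff X (l + 1) (K.cut X (l + 2) u) = z := by
    intro m
    induction m with
    | zero =>
      intro z _ _ hm
      refine ⟨0, ?_⟩
      rw [map_zero, map_zero]
      funext b
      exact (eq_zero_of_mem_tensorFil (hN N le_rfl) (hm b)).symm
    | succ m ih =>
      intro z hz hd hm
      obtain ⟨u, hu⟩ := hK.exists_sub_mem l z hz hd hm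
      have hle : ∀ b, (z - K.diff X (l + 1) (K.cut X (l + 2) u)) b ∈ tensorFil M X (N - m) := by
        intro b
        -- The equality fails only when the subtraction truncates, that is when `N - m = 0`, and
        -- order `0` is no condition.
        by_cases h : N - (m + 1) + 1 = N - m
        · rw [← h]
          exact hu b
        · have h0 : N - m = 0 := by omega
          rw [h0]
          exact mem_tensorFil_zero _
      obtain ⟨u', hu'⟩ := ih _ (by rw [map_sub, hz, diff_cut, cut_cut])
        (by rw [map_sub, hd, K.diff_diff hM, sub_zero]) hle
      refine ⟨u' + u, ?_⟩
      rw [map_add, map_add, hu', sub_add_cancel]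
  exact key N z hz hd fun b => by
    rw [Nat.sub_self]
    exact mem_tensorFil_zero _

end Exactness

end KoszulSystem

/-! ### Exactness of the Koszul complex at the augmentation -/

namespace KoszulSystem

variable {k : Type u} [Field k] {I : Type u} {Q : QuiverOn I} {M : Submodule k (PathAlgebra k Q)}
  (K : KoszulSystem M) {X : Type u} [AddCommGroup X] [Module k X] [Module (QuiverAlgebra M) X]
  [IsScalarTower k (QuiverAlgebra M) X]

/-- `K_0 = S` is spanned by orthogonal idempotents, so `e_j s e_i` is zero for `i ≠ j` and a
multiple of `e_i` for `i = j`. -/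
theorem elt_zero (c : K.idx 0) : K.src 0 c = K.tgt 0 c ∧
    ∃ κ : k, κ ≠ 0 ∧ K.elt 0 c = κ • vertex k Q (K.tgt 0 c) := by
  classical
  have h := (K.isBasis 0).mem c
  rw [koszulSpace_zero] at h
  obtain ⟨s, hs⟩ := h
  have h1 := (K.isBasis 0).homogeneous c
  have h0 := (K.isBasis 0).ne_zero c
  change BimodTensorAlgebra.base k (I → k) (ArrowSpace k Q) s = K.elt 0 c at hs
  change vertex k Q (K.tgt 0 c) * K.elt 0 c * vertex k Q (K.src 0 c) = K.elt 0 c at h1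
  change K.elt 0 c ≠ 0 at h0
  rw [← hs, vertex_mul_base, smul_mul_assoc, vertex_mul_vertex, hs] at h1
  have hst : K.tgt 0 c = K.src 0 c := by
    by_contra hne
    rw [if_neg hne, smul_zero] at h1
    exact h0 h1.symm
  rw [if_pos hst] at h1
  refine ⟨hst.symm, s (K.tgt 0 c), fun hs0 => h0 ?_, h1.symm⟩
  rw [← h1, hs0, zero_smul]

theorem tgt_zero_injective : Function.Injective (K.tgt 0) := by
  classical
  intro c c' h
  obtain ⟨-, κ, hκ, hc⟩ := K.elt_zero c
  obtain ⟨-, κ', hκ', hc'⟩ := K.elt_zero c'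
  by_contra hne
  have h1 := Fintype.linearIndependent_iff.1 (K.isBasis 0).linearIndependent
    (fun d => (if d = c then κ' else 0) - (if d = c' then κ else 0)) (by
      simp only [sub_smul, ite_smul, zero_smul, Finset.sum_sub_distrib, Finset.sum_ite_eq',
        Finset.mem_univ, if_true]
      change κ' • K.elt 0 c - κ • K.elt 0 c' = 0
      rw [hc, hc', h, smul_smul, smul_smul, mul_comm, sub_self]) c
  rw [if_pos rfl, if_neg hne, sub_zero] at h1
  exact hκ' h1

theorem aug_surjective (x : X) : ∃ z, K.aug X (K.cut X 0 z) = x := by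
  obtain ⟨κ, hκ⟩ := (K.isBasis 0).exists_sum_smul (w := 1) (by
    rw [koszulSpace_zero]
    exact Submodule.one_le.1 one_le_baseSpan)
  refine ⟨fun c => κ c • (1 ⊗ₜ x), ?_⟩
  rw [aug_cut, aug_apply]
  simp only [map_smul, twist_tmul, tensorAct_tmul, one_mul, one_smul]
  have h1 : ∑ c, κ c • (toQuiverAlgebra M (K.elt 0 c)) • x = toQuiverAlgebra M 1 • x := by
    rw [hκ, map_sum, Finset.sum_smul]
    exact Finset.sum_congr rfl fun c _ => by rw [map_smul, smul_assoc]
  rw [h1, map_one, one_smul]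

variable [Finite Q.Arrow]

variable (X) in
/-- The boundaries together with the elements of left degree zero. -/
def boundariesSup : Submodule k (K.idx 0 → QuiverAlgebra M ⊗[k] X) :=
  LinearMap.range (K.diff X 0 ∘ₗ K.cut X 1) ⊔
    LinearMap.range (K.cut X 0 ∘ₗ LinearMap.pi fun c =>
      TensorProduct.mk k (QuiverAlgebra M) X 1 ∘ₗ LinearMap.proj c)

/-- Modulo boundaries `a v ⊗ y` equals `a ⊗ v y`, so the arrows of `x` can be moved one by one into
the factor `X`, until the left factor is `1`. -/
theorem cut_single_mem [DecidableEq (K.idx 0)] (x : PathAlgebra k Q) (c : K.idx 0) (y : X) :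
    K.cut X 0 (Pi.single c (toQuiverAlgebra M x ⊗ₜ y)) ∈ K.boundariesSup X := by
  induction x using BimodTensorAlgebra.induction_right generalizing c y with
  | h1 =>
    refine Submodule.mem_sup_right ⟨Pi.single c y, ?_⟩
    have h : (fun c' => 1 ⊗ₜ (Pi.single c y : K.idx 0 → X) c') =
        (Pi.single c (toQuiverAlgebra M 1 ⊗ₜ y) : K.idx 0 → QuiverAlgebra M ⊗[k] X) := by
      funext c'
      by_cases h : c' = c
      · subst h
        rw [Pi.single_eq_same, Pi.single_eq_same, map_one]
      · rw [Pi.single_eq_of_ne h, Pi.single_eq_of_ne h, TensorProduct.tmul_zero]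
    exact congrArg (K.cut X 0) h
  | hadd a b ha hb =>
    rw [map_add, TensorProduct.add_tmul, Pi.single_add, map_add]
    exact Submodule.add_mem _ (ha c y) (hb c y)
  | hb a s ha =>
    have h : K.cut X 0 (Pi.single c (toQuiverAlgebra M
          (a * BimodTensorAlgebra.base k (I → k) (ArrowSpace k Q) s) ⊗ₜ y)) =
        s (K.tgt 0 c) • K.cut X 0 (Pi.single c (toQuiverAlgebra M a ⊗ₜ y)) := by
      funext c'
      rw [Pi.smul_apply, cut_apply, cut_apply]
      by_cases hc : c' = c
      · subst hc
        rw [Pi.single_eq_same, Pi.single_eq_same, twist_tmul, twist_tmul, idem, ← map_mul,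
          mul_assoc, base_mul_vertex, mul_smul_comm, map_smul, map_mul]
        rfl
      · rw [Pi.single_eq_of_ne hc, Pi.single_eq_of_ne hc, map_zero, smul_zero]
    rw [h]
    exact Submodule.smul_mem _ _ (ha c y)
  | hg a v ha =>
    -- The boundary for the arrow element `v` is found by expanding `v p_c` in the chosen basis of
    -- `K_1 = V`; comparing coefficients of the `p_{c'}` then expresses `v e_{t c}` through the
    -- right derivatives.
    obtain ⟨κ, hκ⟩ := (K.isBasis 1).exists_sum_smul
      (w := BimodTensorAlgebra.gen k (I → k) (ArrowSpace k Q) v * vertex k Q (K.tgt 0 c) * K.elt 0 c)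
      (by
        rw [koszulSpace_one]
        refine arrowSpan_mul_baseSpan (Submodule.mul_mem_mul (arrowSpan_mul_baseSpan
          (Submodule.mul_mem_mul (gen_mem_arrowSpan v) (vertex_mem_baseSpan _))) ?_)
        rw [← koszulSpace_zero (M := M)]
        exact (K.isBasis 0).mem c)
    have h1 : (fun c' => ∑ b, κ b • K.dR 0 c' b) = Pi.single c
        (BimodTensorAlgebra.gen k (I → k) (ArrowSpace k Q) v * vertex k Q (K.tgt 0 c)) := by
      refine (K.isBasis 0).eq_of_sum_mul (koszulSpace_le_pathSpan 0) (fun c' => ?_) (fun c' => ?_) ?_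
      · rw [Finset.sum_mul]
        exact Finset.sum_congr rfl fun b _ => by rw [smul_mul_assoc]; erw [K.dR_mul_vertex]
      · by_cases hc : c' = c
        · subst hc
          rw [Pi.single_eq_same, mul_assoc]
          erw [vertex_mul_self]
        · rw [Pi.single_eq_of_ne hc, zero_mul]
      · have h2 : ∑ c', (Pi.single c (BimodTensorAlgebra.gen k (I → k) (ArrowSpace k Q) v *
            vertex k Q (K.tgt 0 c)) : K.idx 0 → PathAlgebra k Q) c' * K.elt 0 c' =
              ∑ b, κ b • K.elt 1 b := by
          rw [← hκ, Finset.sum_eq_single c]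
          · rw [Pi.single_eq_same]
          · intro c' _ hc
            rw [Pi.single_eq_of_ne hc, zero_mul]
          · intro hc
            exact absurd (Finset.mem_univ c) hc
        refine Eq.trans ?_ h2.symm
        simp only [K.elt_eq_dR, Finset.sum_mul, Finset.smul_sum, smul_mul_assoc]
        exact Finset.sum_comm
    have h3 : K.cut X 0 (Pi.single c (toQuiverAlgebra M
          (a * BimodTensorAlgebra.gen k (I → k) (ArrowSpace k Q) v) ⊗ₜ y)) =
        K.diff X 0 (K.cut X 1 fun b => κ b • (toQuiverAlgebra M a ⊗ₜ y)) +
          ∑ c', K.cut X 0 (Pi.single c' (toQuiverAlgebra M a ⊗ₜ ∑ b, κ b • K.mL 0 c' b • y)) := by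
      rw [diff_cut, ← map_sum, ← map_add, Finset.univ_sum_single]
      funext c'
      rw [cut_apply, cut_apply, Pi.add_apply, diff_apply]
      have h4 : ∑ b, K.coef X 0 c' b (κ b • (toQuiverAlgebra M a ⊗ₜ y)) +
          toQuiverAlgebra M a ⊗ₜ ∑ b, κ b • K.mL 0 c' b • y =
            (toQuiverAlgebra M a * toQuiverAlgebra M (∑ b, κ b • K.dR 0 c' b)) ⊗ₜ[k] y := by
        rw [TensorProduct.tmul_sum, ← Finset.sum_add_distrib, map_sum, Finset.mul_sum,
          TensorProduct.sum_tmul]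
        refine Finset.sum_congr rfl fun b _ => ?_
        rw [coef_apply, map_smul, map_smul, twist_tmul, twist_tmul, map_smul, mul_smul_comm,
          one_smul, mul_one, zero_add, pow_one, TensorProduct.tmul_smul (κ b), ← TensorProduct.smul_tmul']
        have hneg : ∀ w w' : QuiverAlgebra M ⊗[k] X, w' + (-1 : k) • w + w = w' := fun w w' => by
          module
        exact hneg _ _
      rw [h4, congrFun h1 c', ← map_mul]
      by_cases hc : c' = c
      · subst hc
        rw [Pi.single_eq_same, Pi.single_eq_same, twist_tmul, twist_tmul, idem, ← map_mul,
          ← map_mul, mul_assoc, mul_assoc, mul_assoc, vertex_mul_self]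
      · rw [Pi.single_eq_of_ne hc, Pi.single_eq_of_ne hc, mul_zero, map_zero,
          map_zero, TensorProduct.zero_tmul, map_zero]
    rw [h3]
    exact Submodule.add_mem _ (Submodule.mem_sup_left ⟨_, rfl⟩)
      (Submodule.sum_mem _ fun c' _ => ha c' _)

theorem cut_mem_boundariesSup (z : K.idx 0 → QuiverAlgebra M ⊗[k] X) :
    K.cut X 0 z ∈ K.boundariesSup X := by
  classical
  suffices h : (K.boundariesSup X).mkQ ∘ₗ K.cut X 0 = 0 from
    (Submodule.Quotient.mk_eq_zero _).1 (LinearMap.congr_fun h z)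
  refine LinearMap.pi_ext' fun c => TensorProduct.ext' fun a y => ?_
  obtain ⟨x, rfl⟩ := toQuiverAlgebra_surjective a
  exact (Submodule.Quotient.mk_eq_zero _).2 (K.cut_single_mem x c y)

/-- Modulo boundaries `z` is a cut of `1 ⊗ y`. The augmentation kills boundaries, and on the
remainder it is injective: multiplying by `e_{t c}` isolates the entry at `c`, because different
basis elements of `K_0` sit at different vertices. -/
theorem exists_eq_diff_zero (z : K.idx 0 → QuiverAlgebra M ⊗[k] X) (hz : K.cut X 0 z = z)
    (h : K.aug X z = 0) : ∃ u, K.diff X 0 (K.cut X 1 u) = z := by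
  classical
  obtain ⟨_, ⟨u, rfl⟩, _, ⟨y, rfl⟩, hu⟩ := Submodule.mem_sup.1 (K.cut_mem_boundariesSup z)
  change K.diff X 0 (K.cut X 1 u) + K.cut X 0 (fun c => 1 ⊗ₜ y c) = _ at hu
  refine ⟨u, ?_⟩
  rw [hz] at hu
  suffices h0 : (K.cut X 0 fun c => 1 ⊗ₜ y c) = 0 by rw [← hu, h0, add_zero]
  rw [← hu, map_add, aug_diff, zero_add, aug_cut, aug_apply] at h
  simp only [twist_tmul, tensorAct_tmul, one_mul, one_smul] at h
  funext c
  obtain ⟨hs, κ, hκ, hc⟩ := K.elt_zero c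
  have h1 := congrArg (idem M (K.tgt 0 c) • ·) h
  simp only [smul_zero, Finset.smul_sum, ← mul_smul] at h1
  rw [Finset.sum_eq_single c] at h1
  · rw [hc, map_smul, mul_smul_comm, smul_assoc, smul_eq_zero_iff_right hκ] at h1
    change (idem M (K.tgt 0 c) * idem M (K.tgt 0 c)) • y c = 0 at h1
    rw [IsQuadratic.idem_mul_self] at h1
    rw [cut_apply, twist_tmul, hs, h1, TensorProduct.tmul_zero]
    rfl
  · intro c' _ hne
    obtain ⟨-, κ', -, hc'⟩ := K.elt_zero c'
    rw [hc', idem, ← map_mul, mul_smul_comm, vertex_mul_vertex,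
      if_neg fun h' => hne (K.tgt_zero_injective h').symm, smul_zero, map_zero, zero_smul]
  · intro hc
    exact absurd (Finset.mem_univ c) hc

end KoszulSystem

/-! ### Koszul resolutions with module coefficients -/

variable {k : Type u} [Field k] {I : Type u} {Q : QuiverOn I} {M : Submodule k (PathAlgebra k Q)}

variable (M) in
/-- An `R`-module structure on `Λ ⊗ X` compatible with the operators of the Koszul complex with
coefficients in `X`, which resolves the `R`-module `Z ≅ X`. -/
structure KoszulCoefficients (R X Z : Type u) [Ring R] [AddCommGroup X] [Module k X]
    [Module (QuiverAlgebra M) X] [IsScalarTower k (QuiverAlgebra M) X] [AddCommGroup Z] [Module R Z]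
    [Module R (QuiverAlgebra M ⊗[k] X)] where
  /-- the identification of the resolved module -/
  equiv : X ≃+ Z
  twist_smul : ∀ r a (ρ : R) (w : QuiverAlgebra M ⊗[k] X),
    twist k _ X r a (ρ • w) = ρ • twist k _ X r a w
  act_smul : ∀ (ρ : R) (w : QuiverAlgebra M ⊗[k] X),
    equiv (tensorAct k _ X (ρ • w)) = ρ • equiv (tensorAct k _ X w)
  projective : Module.Projective R (QuiverAlgebra M ⊗[k] X)

namespace KoszulCoefficients

variable {R X Z : Type u} [Ring R] [AddCommGroup X] [Module k X]
  [Module (QuiverAlgebra M) X] [IsScalarTower k (QuiverAlgebra M) X] [AddCommGroup Z] [Module R Z]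
  [Module R (QuiverAlgebra M ⊗[k] X)] (D : KoszulCoefficients M R X Z) (K : KoszulSystem M)

theorem cut_smul (D : KoszulCoefficients M R X Z) (K : KoszulSystem M) (l : ℕ) (ρ : R)
    (z : K.idx l → QuiverAlgebra M ⊗[k] X) :
    K.cut X l (ρ • z) = ρ • K.cut X l z :=
  funext fun b => D.twist_smul _ _ ρ (z b)

theorem diff_smul (D : KoszulCoefficients M R X Z) (K : KoszulSystem M) (l : ℕ) (ρ : R)
    (z : K.idx (l + 1) → QuiverAlgebra M ⊗[k] X) :
    K.diff X l (ρ • z) = ρ • K.diff X l z := by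
  funext c
  rw [Pi.smul_apply, K.diff_apply, K.diff_apply, Finset.smul_sum]
  refine Finset.sum_congr rfl fun b _ => ?_
  rw [K.coef_apply, K.coef_apply, Pi.smul_apply, D.twist_smul, D.twist_smul, smul_add]
  congr 1
  rcases neg_one_pow_eq_or k (l + 1) with h | h
  · rw [h, one_smul, one_smul]
  · rw [h]
    have hneg : ∀ w : QuiverAlgebra M ⊗[k] X, (-1 : k) • w = -w := fun w => by module
    rw [hneg, hneg, smul_neg]

/-- The terms `⨁_b Λ e_{t b} ⊗ e_{s b} X` of the Koszul complex. -/
def term (l : ℕ) : Submodule R (K.idx l → QuiverAlgebra M ⊗[k] X) where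
  carrier := {z | K.cut X l z = z}
  zero_mem' := map_zero _
  add_mem' := fun {x y} hx hy => by
    change K.cut X l (x + y) = x + y
    rw [map_add, hx, hy]
  smul_mem' := fun ρ z hz => by
    change K.cut X l (ρ • z) = ρ • z
    rw [D.cut_smul, hz]

theorem mem_term {l : ℕ} {z : K.idx l → QuiverAlgebra M ⊗[k] X} :
    z ∈ D.term K l ↔ K.cut X l z = z := Iff.rfl

/-- The projection onto the terms of the Koszul complex. -/
def termProj (l : ℕ) : (K.idx l → QuiverAlgebra M ⊗[k] X) →ₗ[R] D.term K l where
  toFun z := ⟨K.cut X l z, K.cut_cut l z⟩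
  map_add' x y := Subtype.ext (map_add _ x y)
  map_smul' ρ z := Subtype.ext (D.cut_smul K l ρ z)

theorem termProj_coe (l : ℕ) (z : D.term K l) : D.termProj K l z = z := Subtype.ext z.2

/-- The idempotent `cut` exhibits the term as a direct summand of finitely many copies of `Λ ⊗ X`.
-/
theorem projective_term (l : ℕ) : Module.Projective R (D.term K l) := by
  classical
  have := D.projective
  have : Module.Projective R (K.idx l → QuiverAlgebra M ⊗[k] X) :=
    Module.Projective.of_equiv (DirectSum.linearEquivFunOnFintype R (K.idx l)
      fun _ => QuiverAlgebra M ⊗[k] X)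
  exact Module.Projective.of_split (D.term K l).subtype (D.termProj K l)
    (LinearMap.ext fun z => D.termProj_coe K l z)

variable [Finite Q.Arrow]

/-- The differentials of the Koszul complex. -/
def termDiff (l : ℕ) : D.term K (l + 1) →ₗ[R] D.term K l where
  toFun z := ⟨K.diff X l z, by
    rw [mem_term, ← K.diff_cut]
    exact congrArg (K.diff X l) z.2⟩
  map_add' x y := Subtype.ext (map_add _ (x : K.idx (l + 1) → QuiverAlgebra M ⊗[k] X) y)
  map_smul' ρ z := Subtype.ext (D.diff_smul K l ρ z)

/-- The augmentation of the Koszul complex. -/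
def termAug : D.term K 0 →ₗ[R] Z where
  toFun z := D.equiv (K.aug X z)
  map_add' x y := by
    rw [Submodule.coe_add, map_add, map_add]
  map_smul' ρ z := by
    rw [Submodule.coe_smul, K.aug_apply, K.aug_apply, map_sum, map_sum, Finset.smul_sum]
    refine Finset.sum_congr rfl fun c _ => ?_
    rw [Pi.smul_apply, D.twist_smul, D.act_smul]
    rfl

variable [Finite I] [FiniteDimensional k (QuiverAlgebra M)]

/-- The Koszul resolution. -/
def resolution (hM : IsQuadratic M) (hK : K.LeftExact) : LinearResolution R Z where
  P l := ModuleCat.of R (D.term K l)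
  d := D.termDiff K
  ε := D.termAug K
  projective := D.projective_term K
  surjective z := by
    obtain ⟨w, hw⟩ := K.aug_surjective (D.equiv.symm z)
    exact ⟨⟨_, K.cut_cut 0 w⟩, (congrArg D.equiv hw).trans (D.equiv.apply_symm_apply z)⟩
  exact_zero z := by
    refine ⟨fun h => ?_, ?_⟩
    · obtain ⟨u, hu⟩ := K.exists_eq_diff_zero z.1 z.2 (D.equiv.map_eq_zero_iff.1 h)
      exact ⟨⟨_, K.cut_cut 1 u⟩, Subtype.ext hu⟩
    · rintro ⟨u, rfl⟩
      exact (congrArg D.equiv (K.aug_diff u.1)).trans (map_zero _)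
  exact_succ l z := by
    refine ⟨fun h => ?_, ?_⟩
    · obtain ⟨u, hu⟩ := hK.exists_eq_diff hM l z.1 z.2 (congrArg Subtype.val h)
      exact ⟨⟨_, K.cut_cut (l + 2) u⟩, Subtype.ext hu⟩
    · rintro ⟨u, rfl⟩
      exact Subtype.ext (K.diff_diff hM l u.1)

end KoszulCoefficients

/-! ### Ext groups as cokernels of the dual Koszul differential -/

variable {k : Type u} [Field k] {I : Type u} {Q : QuiverOn I} {M : Submodule k (PathAlgebra k Q)}

theorem mem_projBimod_iff {A : Type u} [Ring A] [Algebra k A] {x y : A} (hx : x * x = x)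
    (hy : y * y = y) {u : Env k A} : u ∈ projBimod k x y ↔ u * (x ⊗ₜ[k] op y) = u := by
  refine Submodule.mem_span_singleton.trans ⟨?_, fun h => ⟨u, h⟩⟩
  rintro ⟨v, rfl⟩
  rw [smul_eq_mul, mul_assoc, Algebra.TensorProduct.tmul_mul_tmul, hx, ← op_mul, hy]

/-- The components of an element of `⨁_b Λ e_{s b} ⊗ e_{t b} Λ`. -/
def comps {B : Type u} {s t : B → I} (u : sumBimod M s t) (b : B) : Env k (QuiverAlgebra M) := u b

theorem comps_smul {B : Type u} {s t : B → I} (a : Env k (QuiverAlgebra M)) (u : sumBimod M s t)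
    (b : B) : comps (a • u) b = a * comps u b := rfl

theorem comps_injective {B : Type u} {s t : B → I} {u v : sumBimod M s t}
    (h : comps u = comps v) : u = v :=
  funext fun b => Subtype.ext (congrFun h b)

theorem comps_sum_smul {B C : Type u} [Fintype C] {s t : B → I} (v : C → Env k (QuiverAlgebra M))
    (u : C → sumBimod M s t) (b : B) : comps (∑ c, v c • u c) b = ∑ c, v c * comps (u c) b := by
  have h : (∑ c, v c • u c) b = ∑ c, v c • u c b := Finset.sum_apply b _ _
  rw [comps, h, AddSubmonoidClass.coe_finsetSum]
  rfl

theorem comps_mul {B : Type u} {s t : B → I} (u : sumBimod M s t) (b : B) :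
    comps u b * (idem M (s b) ⊗ₜ[k] op (idem M (t b))) = comps u b :=
  (mem_projBimod_iff (IsQuadratic.idem_mul_self _) (IsQuadratic.idem_mul_self _)).1 (u b).2

/-- The element of `⨁_b Λ e_{s b} ⊗ e_{t b} Λ` with components `v b (e_{s b} ⊗ e_{t b})`. -/
def ofComps {B : Type u} (s t : B → I) (v : B → Env k (QuiverAlgebra M)) : sumBimod M s t :=
  fun b => v b • projGen k (idem M (s b)) (idem M (t b))

theorem comps_ofComps {B : Type u} (s t : B → I) (v : B → Env k (QuiverAlgebra M)) :
    comps (ofComps s t v) = fun b => v b * (idem M (s b) ⊗ₜ[k] op (idem M (t b))) := rfl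

namespace KoszulCoefficients

variable {R X Z : Type u} [Ring R] [AddCommGroup X] [Module k X]
  [Module (QuiverAlgebra M) X] [IsScalarTower k (QuiverAlgebra M) X] [AddCommGroup Z] [Module R Z]
  [Module R (QuiverAlgebra M ⊗[k] X)] (D : KoszulCoefficients M R X Z)
  {Y : Type u} [AddCommGroup Y] [Module R Y]

variable (M R X Y) in
/-- An identification of `Hom_R(Λ ⊗ X, Y)` with `Λ^e` under which the operators of the Koszul
complex become multiplications. -/
structure HomData where
  /-- the identification -/
  hom : Env k (QuiverAlgebra M) ≃+ (QuiverAlgebra M ⊗[k] X →ₗ[R] Y)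
  hom_mul : ∀ u r a w, hom (u * (a ⊗ₜ op r)) w = hom u (twist k _ X r a w)

variable (H : HomData M R X Y) (K : KoszulSystem M)

/-- The linear form on a term of the Koszul complex with given components. -/
def form {l : ℕ} (u : K.idx l → Env k (QuiverAlgebra M)) : D.term K l →ₗ[R] Y :=
  ∑ b, H.hom (u b) ∘ₗ LinearMap.proj b ∘ₗ (D.term K l).subtype

theorem form_apply {l : ℕ} (u : K.idx l → Env k (QuiverAlgebra M)) (z : D.term K l) :
    D.form H K u z = ∑ b, H.hom (u b) (z.1 b) := by
  simp only [form, LinearMap.coe_sum, Finset.sum_apply]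
  rfl

theorem form_add {l : ℕ} (u v : K.idx l → Env k (QuiverAlgebra M)) :
    D.form H K (u + v) = D.form H K u + D.form H K v := by
  refine LinearMap.ext fun z => ?_
  rw [LinearMap.add_apply]
  simp only [form_apply, Pi.add_apply, map_add, LinearMap.add_apply, Finset.sum_add_distrib]

/-- The elements of a term are fixed by `cut`, so a form depends only on its components cut by the
idempotents; hence forms are parametrized by `sumBimod`. -/
theorem form_mul {l : ℕ} (u : K.idx l → Env k (QuiverAlgebra M)) :
    D.form H K (fun b => u b * (idem M (K.src l b) ⊗ₜ[k] op (idem M (K.tgt l b)))) =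
      D.form H K u := by
  refine LinearMap.ext fun z => ?_
  rw [form_apply, form_apply]
  refine Finset.sum_congr rfl fun b _ => ?_
  rw [H.hom_mul]
  exact congrArg (H.hom (u b)) (congrFun z.2 b)

theorem exists_form_eq {l : ℕ} (f : D.term K l →ₗ[R] Y) :
    ∃ u : sumBimod M (K.src l) (K.tgt l), D.form H K (comps u) = f := by
  classical
  let ψ : K.idx l → (QuiverAlgebra M ⊗[k] X →ₗ[R] Y) := fun b =>
    f ∘ₗ D.termProj K l ∘ₗ LinearMap.single R (fun _ => QuiverAlgebra M ⊗[k] X) b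
  refine ⟨ofComps _ _ fun b => H.hom.symm (ψ b), ?_⟩
  rw [comps_ofComps]
  refine (D.form_mul H K fun b => H.hom.symm (ψ b)).trans (LinearMap.ext fun z => ?_)
  have h : ∀ b, H.hom (H.hom.symm (ψ b)) (z.1 b) = f (D.termProj K l (Pi.single b (z.1 b))) :=
    fun b => by rw [AddEquiv.apply_symm_apply]; rfl
  rw [form_apply, Finset.sum_congr rfl fun b _ => h b, ← map_sum, ← map_sum,
    Finset.univ_sum_single, termProj_coe]

theorem form_injective {l : ℕ} {u v : sumBimod M (K.src l) (K.tgt l)}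
    (h : D.form H K (comps u) =
      D.form H K (comps v)) : u = v := by
  classical
  have key : ∀ (u : sumBimod M (K.src l) (K.tgt l)) b w,
      D.form H K (comps u) (D.termProj K l (Pi.single b w)) =
        H.hom (comps u b) w := by
    intro u b w
    rw [form_apply, Finset.sum_eq_single b]
    · change H.hom _ (K.cut X l (Pi.single b w) b) = _
      rw [K.cut_apply, Pi.single_eq_same, ← H.hom_mul, comps_mul]
    · intro b' _ hb
      change H.hom _ (K.cut X l (Pi.single b w) b') = _
      rw [K.cut_apply, Pi.single_eq_of_ne hb, map_zero, map_zero]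
    · intro hb
      exact absurd (Finset.mem_univ b) hb
  refine comps_injective (funext fun b => H.hom.injective (LinearMap.ext fun w => ?_))
  rw [← key, ← key, h]

variable [Finite Q.Arrow]

/-- By `hom_mul` the operator with parameters `r`, `a` becomes right multiplication by `a ⊗ op r`.
The coefficients of the differential thus turn into those of the dual Koszul elements, with the two
tensor factors exchanged. -/
theorem form_comp_termDiff {l : ℕ} (v : K.idx l → Env k (QuiverAlgebra M)) :
    D.form H K v ∘ₗ D.termDiff K l = D.form H K (comps (∑ c, v c •
      dualKoszulElement M (l + 1) (K.dL l) (K.dR l) (K.src (l + 1)) (K.tgt (l + 1)) c)) := by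
  have h1 : ∀ b, comps (∑ c, v c •
      dualKoszulElement M (l + 1) (K.dL l) (K.dR l) (K.src (l + 1)) (K.tgt (l + 1)) c) b =
      (∑ c, v c * (1 ⊗ₜ op (K.mR l c b) + (-1) ^ (l + 1) • (K.mL l c b ⊗ₜ 1))) *
        (idem M (K.src (l + 1) b) ⊗ₜ[k] op (idem M (K.tgt (l + 1) b))) := by
    intro b
    rw [comps_sum_smul, Finset.sum_mul]
    refine Finset.sum_congr rfl fun c _ => ?_
    rw [mul_assoc]
    rfl
  rw [funext h1, form_mul]
  refine LinearMap.ext fun z => ?_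
  rw [LinearMap.comp_apply, form_apply, form_apply]
  have h3 : ∀ c, (D.termDiff K l z).1 c = ∑ b, K.coef X l c b (z.1 b) := fun c =>
    K.diff_apply l z.1 c
  simp only [h3, map_sum, LinearMap.sum_apply]
  rw [Finset.sum_comm]
  refine Finset.sum_congr rfl fun b _ => Finset.sum_congr rfl fun c _ => ?_
  rw [K.coef_apply, map_add, mul_add, map_add, LinearMap.add_apply, ← H.hom_mul]
  congr 1
  rcases Nat.even_or_odd (l + 1) with h | h
  · rw [h.neg_one_pow, h.neg_one_pow, one_smul, one_smul, ← op_one, H.hom_mul]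
  · have hneg : ∀ w : QuiverAlgebra M ⊗[k] X, (-1 : k) • w = -w := fun w => by module
    have hneg' : ∀ x : Env k (QuiverAlgebra M), v c * -x = -(v c * x) := fun x =>
      eq_neg_of_add_eq_zero_left (by rw [← mul_add, neg_add_cancel, mul_zero])
    rw [h.neg_one_pow, h.neg_one_pow, hneg, neg_one_smul, hneg', map_neg, map_neg,
      LinearMap.neg_apply, ← op_one, H.hom_mul]

variable [Finite I] [FiniteDimensional k (QuiverAlgebra M)]

theorem comp_d_eq_zero (hM : IsQuadratic M) (hK : K.LeftExact) {n : ℕ}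
    (hn : IsEmpty (K.idx (n + 1))) (f : D.term K n →ₗ[R] Y) :
    f ∘ₗ (D.resolution K hM hK).d n = 0 :=
  LinearMap.ext fun z => by
    have hz : z = 0 := Subtype.ext (funext fun b => hn.elim b)
    rw [hz, map_zero, map_zero]

/-- The class in `Ext` attached to an element of `⨁_b Λ e_{s b} ⊗ e_{t b} Λ`, when the Koszul
complex stops in degree `n`. -/
def extOf (hM : IsQuadratic M) (hK : K.LeftExact) {n : ℕ} (hn : IsEmpty (K.idx (n + 1))) :
    sumBimod M (K.src n) (K.tgt n) →+ ExtGroup (R := R) Z Y n :=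
  AddMonoidHom.mk' (fun u => (D.resolution K hM hK).extClass (D.form H K (comps u))
    (D.comp_d_eq_zero K hM hK hn _)) fun u v => by
    refine Eq.trans ?_ ((D.resolution K hM hK).extClass_add _ _ (D.comp_d_eq_zero K hM hK hn _)
      (D.comp_d_eq_zero K hM hK hn _))
    congr 1
    exact D.form_add H K _ _

theorem extOf_apply (hM : IsQuadratic M) (hK : K.LeftExact) {n : ℕ} (hn : IsEmpty (K.idx (n + 1)))
    (u : sumBimod M (K.src n) (K.tgt n)) : D.extOf H K hM hK hn u =
      (D.resolution K hM hK).extClass (D.form H K (comps u)) (D.comp_d_eq_zero K hM hK hn _) := rfl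

theorem extOf_surjective (hM : IsQuadratic M) (hK : K.LeftExact) {n : ℕ}
    (hn : IsEmpty (K.idx (n + 1))) : Function.Surjective (D.extOf H K hM hK hn) := by
  intro x
  obtain ⟨f, hf, rfl⟩ := (D.resolution K hM hK).extClass_surjective x
  obtain ⟨u, rfl⟩ := D.exists_form_eq H K f
  exact ⟨u, rfl⟩

/-- A coboundary is a form on the preceding term composed with the differential, which
`form_comp_termDiff` writes as a combination of dual Koszul elements; components of forms are
unique. -/
theorem extOf_eq_zero_iff (hM : IsQuadratic M) (hK : K.LeftExact) {m : ℕ}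
    (hn : IsEmpty (K.idx (m + 2))) (u : sumBimod M (K.src (m + 1)) (K.tgt (m + 1))) :
    D.extOf H K hM hK hn u = 0 ↔
      u ∈ dualKoszulSubmodule M (m + 1) (K.dL m) (K.dR m) (K.src (m + 1)) (K.tgt (m + 1)) := by
  refine ((D.resolution K hM hK).extClass_eq_zero_iff (D.form H K (comps u))
    (D.comp_d_eq_zero K hM hK hn _)).trans ⟨?_, fun h => ?_⟩
  · rintro ⟨g, hg⟩
    obtain ⟨v, rfl⟩ := D.exists_form_eq H K g
    have h1 := (D.form_comp_termDiff H K (comps v)).symm.trans hg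
    rw [← D.form_injective H K h1]
    exact Submodule.sum_mem _ fun c _ => Submodule.smul_mem _ _ (Submodule.subset_span ⟨c, rfl⟩)
  · obtain ⟨v, rfl⟩ := (Submodule.mem_span_range_iff_exists_fun _).1 h
    exact ⟨D.form H K v, D.form_comp_termDiff H K v⟩

theorem extOf_comp (hM : IsQuadratic M) (hK : K.LeftExact) {n : ℕ}
    (hn : IsEmpty (K.idx (n + 1))) (g : Y →ₗ[R] Y) (v : Env k (QuiverAlgebra M))
    (hg : ∀ u w, g (H.hom u w) = H.hom (v * u) w) (u : sumBimod M (K.src n) (K.tgt n)) :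
    (D.extOf H K hM hK hn u).comp (Abelian.Ext.mk₀ (ModuleCat.ofHom g)) (add_zero n) =
      D.extOf H K hM hK hn (v • u) := by
  refine ((D.resolution K hM hK).extClass_comp (D.form H K (comps u))
    (D.comp_d_eq_zero K hM hK hn _) g).trans ?_
  rw [extOf_apply]
  congr 1
  refine LinearMap.ext fun z => ?_
  refine (congrArg g (D.form_apply H K _ z)).trans ((map_sum g _ _).trans ?_)
  refine Eq.trans ?_ (D.form_apply H K _ z).symm
  exact Finset.sum_congr rfl fun b _ => hg _ _

/-- An endomorphism of `Λ ⊗ X` that commutes with all the operators acts entrywise on the whole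
Koszul resolution, so it is a chain map lifting `g`. -/
theorem comp_extOf (hM : IsQuadratic M) (hK : K.LeftExact) {n : ℕ}
    (hn : IsEmpty (K.idx (n + 1))) (g : Z →ₗ[R] Z)
    (φ : QuiverAlgebra M ⊗[k] X →ₗ[R] QuiverAlgebra M ⊗[k] X) (v : Env k (QuiverAlgebra M))
    (hφ : ∀ r a w, φ (twist k _ X r a w) = twist k _ X r a (φ w))
    (hg : ∀ w, D.equiv (tensorAct k _ X (φ w)) = g (D.equiv (tensorAct k _ X w)))
    (hv : ∀ u w, H.hom u (φ w) = H.hom (v * u) w) (u : sumBimod M (K.src n) (K.tgt n)) :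
    (Abelian.Ext.mk₀ (ModuleCat.ofHom g)).comp (D.extOf H K hM hK hn u) (zero_add n) =
      D.extOf H K hM hK hn (v • u) := by
  let φ' : ∀ l, D.term K l →ₗ[R] D.term K l := fun l =>
    { toFun := fun z => ⟨fun b => φ (z.1 b), funext fun b =>
        (hφ _ _ _).symm.trans (congrArg φ (congrFun z.2 b))⟩
      map_add' := fun x y => Subtype.ext (funext fun b => map_add φ _ _)
      map_smul' := fun ρ x => Subtype.ext (funext fun b => map_smul φ _ _) }
  have h1 : ∀ l, φ' l ∘ₗ D.termDiff K l = D.termDiff K l ∘ₗ φ' (l + 1) := by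
    intro l
    refine LinearMap.ext fun z => Subtype.ext (funext fun c => ?_)
    refine (congrArg φ (K.diff_apply l z.1 c)).trans
      (Eq.trans ?_ (K.diff_apply l (fun b => φ (z.1 b)) c).symm)
    rw [map_sum]
    refine Finset.sum_congr rfl fun b _ => ?_
    rw [K.coef_apply, K.coef_apply, map_add, hφ]
    congr 1
    rcases Nat.even_or_odd (l + 1) with h | h
    · rw [h.neg_one_pow, one_smul, one_smul, hφ]
    · have hneg : ∀ w : QuiverAlgebra M ⊗[k] X, (-1 : k) • w = -w := fun w => by module
      rw [h.neg_one_pow, hneg, hneg, map_neg, hφ]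
  have h2 : D.termAug K ∘ₗ φ' 0 = g ∘ₗ D.termAug K := by
    refine LinearMap.ext fun z => ?_
    refine (congrArg D.equiv (K.aug_apply fun b => φ (z.1 b))).trans
      (Eq.trans ?_ (congrArg (fun x => g (D.equiv x)) (K.aug_apply z.1)).symm)
    simp only [map_sum, ← hg, hφ]
  refine ((D.resolution K hM hK).comp_extClass g φ' h1 h2 (D.form H K (comps u))
    (D.comp_d_eq_zero K hM hK hn _)).trans ?_
  rw [extOf_apply]
  congr 1
  refine LinearMap.ext fun z => ?_
  refine (D.form_apply H K _ (φ' n z)).trans (Eq.trans ?_ (D.form_apply H K _ z).symm)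
  exact Finset.sum_congr rfl fun b _ => hv _ _

end KoszulCoefficients

/-! ### The enveloping algebra and `Ext^n_{Λ^e}(Λ, Λ^e)` -/

section Env

variable {k : Type u} [Field k] {A : Type u} [Ring A] [Algebra k A]

theorem envFlip_tmul (a b : A) : envFlip k A (a ⊗ₜ op b) = b ⊗ₜ op a := rfl

theorem env_induction {P : Env k A → Prop} (h0 : P 0) (hadd : ∀ x y, P x → P y → P (x + y))
    (h : ∀ a b : A, P (a ⊗ₜ op b)) (u : Env k A) : P u := by
  induction u using TensorProduct.induction_on with
  | zero => exact h0
  | add x y hx hy => exact hadd x y hx hy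
  | tmul a b => exact h a (unop b)

theorem env_tmul_mul (a b c d : A) :
    (a ⊗ₜ[k] op b) * (c ⊗ₜ[k] op d) = (a * c) ⊗ₜ op (d * b) :=
  Algebra.TensorProduct.tmul_mul_tmul _ _ _ _

theorem envFlip_envFlip (u : Env k A) : envFlip k A (envFlip k A u) = u := by
  induction u using env_induction with
  | h0 => rw [map_zero, map_zero]
  | hadd x y hx hy => rw [map_add, map_add, hx, hy]
  | h a b => rw [envFlip_tmul, envFlip_tmul]

theorem envFlip_mul (u v : Env k A) :
    envFlip k A (u * v) = envFlip k A v * envFlip k A u := by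
  induction u using env_induction with
  | h0 => rw [zero_mul, map_zero, mul_zero]
  | hadd x y hx hy => rw [add_mul, map_add, map_add, hx, hy, mul_add]
  | h a b =>
    induction v using env_induction with
    | h0 => rw [mul_zero, map_zero, zero_mul]
    | hadd x y hx hy => rw [mul_add, map_add, map_add, hx, hy, add_mul]
    | h c d => simp only [env_tmul_mul, envFlip_tmul]

theorem twist_eq_mul (r a : A) (w : Env k A) : twist k A Aᵐᵒᵖ r a w = w * (r ⊗ₜ op a) := by
  induction w using env_induction with
  | h0 => rw [map_zero, zero_mul]
  | hadd x y hx hy => rw [map_add, hx, hy, add_mul]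
  | h b c => rw [env_tmul_mul]; rfl

theorem env_smul_envSelf (a b : A) (x : A) :
    (a ⊗ₜ[k] op b) • (show EnvSelf A from x) = (show EnvSelf A from a * (x * b)) :=
  letI : Module (A ⊗[k] Aᵐᵒᵖ) A := TensorProduct.Algebra.module
  TensorProduct.Algebra.smul_def (R := k) (M := A) a (op b) x

theorem unop_tensorAct_mul (ρ w : Env k A) :
    (show EnvSelf A from unop (tensorAct k A Aᵐᵒᵖ (ρ * w))) =
      ρ • (show EnvSelf A from unop (tensorAct k A Aᵐᵒᵖ w)) := by
  induction w using env_induction with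
  | h0 => rw [mul_zero, map_zero]; exact (smul_zero (A := EnvSelf A) ρ).symm
  | hadd x y hx hy =>
    rw [mul_add, map_add, map_add]
    exact (congrArg₂ (· + ·) hx hy).trans (smul_add ρ _ _).symm
  | h c d =>
    induction ρ using env_induction with
    | h0 => rw [zero_mul, map_zero]; exact (zero_smul (Env k A) (show EnvSelf A from unop (tensorAct k A Aᵐᵒᵖ (c ⊗ₜ op d)))).symm
    | hadd x y hx hy =>
      rw [add_mul, map_add]
      exact (congrArg₂ (· + ·) hx hy).trans (add_smul x y _).symm
    | h a b =>
      rw [env_tmul_mul]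
      refine Eq.trans ?_ (env_smul_envSelf a b (c * d)).symm
      change a * c * (d * b) = a * (c * d * b)
      simp only [mul_assoc]

end Env

section EnvCoefficients

variable {k : Type u} [Field k] {I : Type u} {Q : QuiverOn I} (M : Submodule k (PathAlgebra k Q))

/-- The coefficients for the Koszul bimodule resolution of `Λ`. -/
def envCoefficients : KoszulCoefficients M (Env k (QuiverAlgebra M)) (QuiverAlgebra M)ᵐᵒᵖ
    (EnvSelf (QuiverAlgebra M)) where
  equiv := MulOpposite.opAddEquiv.symm
  twist_smul r a ρ w := by
    rw [smul_eq_mul, smul_eq_mul, twist_eq_mul, twist_eq_mul, mul_assoc]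
  act_smul ρ w := unop_tensorAct_mul ρ w
  projective := inferInstance

/-- The identification of `Hom_{Λ^e}(Λ^e, Λ^e)` with `Λ^e`. -/
def envHomData : KoszulCoefficients.HomData M (Env k (QuiverAlgebra M)) (QuiverAlgebra M)ᵐᵒᵖ
    (Env k (QuiverAlgebra M)) where
  hom :=
    { toFun := fun u => LinearMap.toSpanSingleton _ _ (envFlip k _ u)
      invFun := fun f => envFlip k _ (f 1)
      left_inv := fun u => by
        change envFlip k _ (LinearMap.toSpanSingleton _ _ (envFlip k _ u) 1) = u
        rw [LinearMap.toSpanSingleton_apply, one_smul, envFlip_envFlip]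
      right_inv := fun f => LinearMap.ext fun w => by
        change LinearMap.toSpanSingleton _ _ (envFlip k _ (envFlip k _ (f 1))) w = f w
        rw [LinearMap.toSpanSingleton_apply, envFlip_envFlip, ← map_smul, smul_eq_mul, mul_one]
      map_add' := fun u v => LinearMap.ext fun w => by
        rw [map_add]
        exact smul_add w _ _ }
  hom_mul u r a w := by
    change w * envFlip k _ (u * a ⊗ₜ op r) = twist k _ _ r a w * envFlip k _ u
    rw [envFlip_mul, envFlip_tmul, twist_eq_mul, mul_assoc]

variable {M} [Finite I] [Finite Q.Arrow] [FiniteDimensional k (QuiverAlgebra M)]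
  (K : KoszulSystem M)

/-- The Koszul complex with coefficients in `Λ` resolves the bimodule `Λ`. The inner actions
multiply values of cocycles in `Λ^e` from the right; `envFlip` reverses products, so on components
these become the outer left multiplications. -/
theorem exists_envExt_equiv (hM : IsQuadratic M) (hK : K.LeftExact) {m : ℕ}
    (hn : IsEmpty (K.idx (m + 2))) :
    ∃ Ψ : EnvExt k (QuiverAlgebra M) (m + 1) ≃+
        (sumBimod M (K.src (m + 1)) (K.tgt (m + 1)) ⧸
          dualKoszulSubmodule M (m + 1) (K.dL m) (K.dR m) (K.src (m + 1)) (K.tgt (m + 1))),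
      ∀ (a : QuiverAlgebra M) (x : EnvExt k (QuiverAlgebra M) (m + 1)),
        Ψ (a • x) = (a ⊗ₜ[k] (1 : (QuiverAlgebra M)ᵐᵒᵖ)) • Ψ x ∧
        Ψ (MulOpposite.op a • x) = ((1 : QuiverAlgebra M) ⊗ₜ[k] MulOpposite.op a) • Ψ x := by
  let D := envCoefficients M
  let H := envHomData M
  let N := dualKoszulSubmodule M (m + 1) (K.dL m) (K.dR m) (K.src (m + 1)) (K.tgt (m + 1))
  let G : sumBimod M (K.src (m + 1)) (K.tgt (m + 1)) →+ EnvExt k (QuiverAlgebra M) (m + 1) :=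
    D.extOf H K hM hK hn
  have hG : ∀ u, G u = 0 ↔ u ∈ N := D.extOf_eq_zero_iff H K hM hK hn
  let E : (sumBimod M (K.src (m + 1)) (K.tgt (m + 1)) ⧸ N) ≃+ EnvExt k (QuiverAlgebra M) (m + 1) :=
    AddEquiv.ofBijective (QuotientAddGroup.lift N.toAddSubgroup G fun u hu => (hG u).2 hu) (by
      refine ⟨?_, fun x => ?_⟩
      · intro x y hxy
        obtain ⟨u, rfl⟩ := Submodule.Quotient.mk_surjective N x
        obtain ⟨v, rfl⟩ := Submodule.Quotient.mk_surjective N y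
        refine (Submodule.Quotient.eq N).2 ((hG _).1 ?_)
        rw [map_sub, sub_eq_zero]
        exact hxy
      · obtain ⟨u, rfl⟩ := D.extOf_surjective H K hM hK hn x
        exact ⟨Submodule.Quotient.mk u, rfl⟩)
  have hE : ∀ u, E (Submodule.Quotient.mk u) = G u := fun u => rfl
  have hl : ∀ a u, a • G u = G ((a ⊗ₜ[k] (1 : (QuiverAlgebra M)ᵐᵒᵖ)) • u) := fun a u =>
    D.extOf_comp H K hM hK hn (innerLeft k _ a) (a ⊗ₜ 1) (fun u w => by
      change (w * envFlip k _ u) * (1 ⊗ₜ op a) = w * envFlip k _ (a ⊗ₜ 1 * u)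
      rw [envFlip_mul, mul_assoc]
      rfl) u
  have hr : ∀ a u, op a • G u = G (((1 : QuiverAlgebra M) ⊗ₜ[k] op a) • u) := fun a u =>
    D.extOf_comp H K hM hK hn (innerRight k _ (op a)) (1 ⊗ₜ op a) (fun u w => by
      change (w * envFlip k _ u) * (a ⊗ₜ 1) = w * envFlip k _ (1 ⊗ₜ op a * u)
      rw [envFlip_mul, mul_assoc]
      rfl) u
  refine ⟨E.symm, fun a x => ?_⟩
  obtain ⟨y, rfl⟩ := E.surjective x
  obtain ⟨u, rfl⟩ := Submodule.Quotient.mk_surjective N y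
  rw [hE, hl, hr, AddEquiv.symm_apply_eq, AddEquiv.symm_apply_eq, ← hE u, E.symm_apply_apply]
  exact ⟨rfl, rfl⟩

end EnvCoefficients

/-! ### The bimodule `DΛ` and `Ext^n_Λ(DΛ, Λ)` -/

section Dual

variable (k : Type u) [Field k] (A : Type u) [Ring A] [Algebra k A]

instance : Module k (LinDual k A) := Module.compHom (LinDual k A) (algebraMap k A)

instance : IsScalarTower k A (LinDual k A) where
  smul_assoc c a ξ := by
    rw [Algebra.smul_def, mul_smul]
    rfl

/-- The evaluation pairing between `A` and `DA`. -/
def evalDual : A →ₗ[k] LinDual k A →ₗ[k] k :=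
  LinearMap.mk₂ k (fun x ξ => (show A →ₗ[k] k from ξ) x)
    (fun x y ξ => map_add (show A →ₗ[k] k from ξ) x y)
    (fun c x ξ => map_smul (show A →ₗ[k] k from ξ) c x) (fun _ _ _ => rfl)
    (fun c x ξ => by
      change (show A →ₗ[k] k from ξ) (x * algebraMap k A c) = c • (show A →ₗ[k] k from ξ) x
      rw [← Algebra.commutes, ← Algebra.smul_def, map_smul])

theorem evalDual_smul (a x : A) (ξ : LinDual k A) :
    evalDual k A x (a • ξ) = evalDual k A (x * a) ξ := rfl

theorem evalDual_op_smul (a x : A) (ξ : LinDual k A) :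
    evalDual k A x (op a • ξ) = evalDual k A (a * x) ξ := rfl

/-- The pairing `(x ⊗ op y, a ⊗ ξ) ↦ ξ(x) a y`. -/
def dualPairing : Env k A →ₗ[k] A ⊗[k] LinDual k A →ₗ[k] A :=
  TensorProduct.lift (LinearMap.mk₂ k
    (fun x y => LinearMap.mulRight k (unop y) ∘ₗ (TensorProduct.rid k A).toLinearMap ∘ₗ
      LinearMap.lTensor A (evalDual k A x))
    (fun x x' y => by
      rw [map_add, LinearMap.lTensor_add, LinearMap.comp_add, LinearMap.comp_add])
    (fun c x y => by
      rw [map_smul, LinearMap.lTensor_smul, LinearMap.comp_smul, LinearMap.comp_smul])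
    (fun x y y' => LinearMap.ext fun w => mul_add _ _ _)
    (fun c x y => LinearMap.ext fun w => mul_smul_comm _ _ _))

theorem dualPairing_tmul (x y a : A) (ξ : LinDual k A) :
    dualPairing k A (x ⊗ₜ op y) (a ⊗ₜ ξ) = (evalDual k A x ξ • a) * y := rfl

theorem dualPairing_smul (u : Env k A) (a : A) (w : A ⊗[k] LinDual k A) :
    dualPairing k A u (a • w) = a * dualPairing k A u w := by
  induction w using TensorProduct.induction_on with
  | zero => rw [smul_zero, map_zero, mul_zero]
  | add x y hx hy => rw [smul_add, map_add, map_add, hx, hy, mul_add]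
  | tmul b ξ =>
    induction u using env_induction with
    | h0 => rw [map_zero]; exact (mul_zero a).symm
    | hadd x y hx hy => rw [map_add, LinearMap.add_apply, LinearMap.add_apply, hx, hy, mul_add]
    | h x y =>
      rw [TensorProduct.smul_tmul', dualPairing_tmul, dualPairing_tmul, smul_eq_mul,
        ← mul_smul_comm, mul_assoc]

theorem dualPairing_mul (u : Env k A) (a r : A) (w : A ⊗[k] LinDual k A) :
    dualPairing k A (u * (a ⊗ₜ op r)) w = dualPairing k A u (twist k A _ r a w) := by
  induction w using TensorProduct.induction_on with
  | zero => rw [map_zero, map_zero, map_zero]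
  | add x y hx hy => rw [map_add, map_add, map_add, hx, hy]
  | tmul b ξ =>
    induction u using env_induction with
    | h0 => rw [zero_mul, map_zero]; rfl
    | hadd x y hx hy =>
      rw [add_mul, map_add, map_add, LinearMap.add_apply, LinearMap.add_apply, hx, hy]
    | h x y =>
      rw [env_tmul_mul, dualPairing_tmul, twist_tmul, dualPairing_tmul, evalDual_smul,
        smul_mul_assoc, smul_mul_assoc, mul_assoc]

theorem dualPairing_mul_left (u : Env k A) (b : A) (w : A ⊗[k] LinDual k A) :
    dualPairing k A ((1 ⊗ₜ op b) * u) w = dualPairing k A u w * b := by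
  induction w using TensorProduct.induction_on with
  | zero => rw [map_zero, map_zero, zero_mul]
  | add x y hx hy => rw [map_add, map_add, hx, hy, add_mul]
  | tmul c ξ =>
    induction u using env_induction with
    | h0 => rw [mul_zero, map_zero]; exact (zero_mul _).symm
    | hadd x y hx hy =>
      rw [mul_add, map_add, map_add, LinearMap.add_apply, LinearMap.add_apply, hx, hy, add_mul]
    | h x y => rw [env_tmul_mul, dualPairing_tmul, dualPairing_tmul, one_mul, mul_assoc]

/-- The map `a ⊗ ξ ↦ a ⊗ ξ b`. -/
def tensorRightMul (b : A) : A ⊗[k] LinDual k A →ₗ[A] A ⊗[k] LinDual k A :=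
  TensorProduct.AlgebraTensorModule.map LinearMap.id
    { toFun := fun ξ => op b • ξ
      map_add' := smul_add _
      map_smul' := fun c ξ => smul_comm (op b) (algebraMap k A c) ξ }

theorem tensorRightMul_tmul (b a : A) (ξ : LinDual k A) :
    tensorRightMul k A b (a ⊗ₜ ξ) = a ⊗ₜ (op b • ξ) := rfl

theorem dualPairing_tensorRightMul (u : Env k A) (b : A) (w : A ⊗[k] LinDual k A) :
    dualPairing k A u (tensorRightMul k A b w) = dualPairing k A ((b ⊗ₜ 1) * u) w := by
  induction w using TensorProduct.induction_on with
  | zero => rw [map_zero, map_zero, map_zero]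
  | add x y hx hy => rw [map_add, map_add, map_add, hx, hy]
  | tmul c ξ =>
    induction u using env_induction with
    | h0 => rw [mul_zero, map_zero]; rfl
    | hadd x y hx hy =>
      rw [mul_add, map_add, map_add, LinearMap.add_apply, LinearMap.add_apply, hx, hy]
    | h x y =>
      rw [← op_one, env_tmul_mul, tensorRightMul_tmul, dualPairing_tmul, dualPairing_tmul, mul_one,
        evalDual_op_smul]

theorem tensorRightMul_twist (r a b : A) (w : A ⊗[k] LinDual k A) :
    tensorRightMul k A b (twist k A _ r a w) = twist k A _ r a (tensorRightMul k A b w) := by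
  induction w using TensorProduct.induction_on with
  | zero => rw [map_zero, map_zero, map_zero]
  | add x y hx hy => rw [map_add, map_add, map_add, map_add, hx, hy]
  | tmul c ξ =>
    rw [tensorRightMul_tmul, twist_tmul, twist_tmul, tensorRightMul_tmul, smul_comm]

theorem tensorAct_tensorRightMul (b : A) (w : A ⊗[k] LinDual k A) :
    tensorAct k A _ (tensorRightMul k A b w) = op b • tensorAct k A _ w := by
  induction w using TensorProduct.induction_on with
  | zero => rw [map_zero, map_zero, smul_zero]
  | add x y hx hy => rw [map_add, map_add, map_add, hx, hy, smul_add]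
  | tmul c ξ => rw [tensorRightMul_tmul, tensorAct_tmul, tensorAct_tmul, ← smul_comm]

variable [FiniteDimensional k A]

theorem exists_dual_basis : ∃ (ι : Type u) (_ : Fintype ι) (e : ι → A) (f : ι → LinDual k A),
    (∀ x, ∑ i, evalDual k A x (f i) • e i = x) ∧ ∀ ξ, ∑ i, evalDual k A (e i) ξ • f i = ξ := by
  let β := Module.Free.chooseBasis k A
  have h1 : ∀ x, ∑ i, (β.coord i) x • β i = x := fun x => β.sum_repr x
  refine ⟨_, inferInstance, β, fun i => β.coord i, h1, fun ξ => ?_⟩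
  have hext : ∀ {ξ η : LinDual k A}, (∀ x, evalDual k A x ξ = evalDual k A x η) → ξ = η :=
    fun h => LinearMap.ext h
  refine hext fun x => ?_
  nth_rewrite 2 [← h1 x]
  rw [map_sum, map_sum, LinearMap.sum_apply]
  refine Finset.sum_congr rfl fun i _ => ?_
  rw [map_smul, LinearMap.smul_apply, smul_eq_mul, mul_comm]
  exact map_smul (evalDual k A x) _ _

/-- The identification of `Hom_A(A ⊗ DA, A)` with `A^e`. -/
def dualHom : Env k A ≃+ (A ⊗[k] LinDual k A →ₗ[A] A) :=
  AddEquiv.ofBijective (AddMonoidHom.mk' (fun u =>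
    { toFun := dualPairing k A u
      map_add' := map_add _
      map_smul' := dualPairing_smul k A u }) fun u v => LinearMap.ext fun w => by
        change dualPairing k A (u + v) w = dualPairing k A u w + dualPairing k A v w
        rw [map_add, LinearMap.add_apply]) (by
    obtain ⟨ι, _, e, f, he, hf⟩ := exists_dual_basis k A
    -- Dual bases recover `u` from its values on the `1 ⊗ f i`. The same formula, applied to an
    -- arbitrary linear `g`, gives the preimage in the proof of surjectivity.
    have key : ∀ u : Env k A, ∑ i, e i ⊗ₜ[k] op (dualPairing k A u (1 ⊗ₜ f i)) = u := by
      intro u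
      induction u using env_induction with
      | h0 =>
        refine Finset.sum_eq_zero fun i _ => ?_
        rw [map_zero, LinearMap.zero_apply, MulOpposite.op_zero, TensorProduct.tmul_zero]
      | hadd x y hx hy =>
        refine Eq.trans ?_ (congrArg₂ (· + ·) hx hy)
        rw [← Finset.sum_add_distrib]
        refine Finset.sum_congr rfl fun i _ => ?_
        rw [map_add, LinearMap.add_apply, MulOpposite.op_add, TensorProduct.tmul_add]
      | h x y =>
        nth_rewrite 2 [← he x]
        rw [TensorProduct.sum_tmul]
        refine Finset.sum_congr rfl fun i _ => ?_
        rw [dualPairing_tmul, smul_mul_assoc, one_mul, op_smul, TensorProduct.tmul_smul,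
          TensorProduct.smul_tmul']
    refine ⟨fun u v h => ?_, fun g => ⟨∑ i, e i ⊗ₜ[k] op (g (1 ⊗ₜ f i)), ?_⟩⟩
    · rw [← key u, ← key v]
      refine Finset.sum_congr rfl fun i _ => ?_
      rw [show dualPairing k A u (1 ⊗ₜ f i) = dualPairing k A v (1 ⊗ₜ f i) from
        LinearMap.congr_fun h _]
    · refine LinearMap.ext fun w => ?_
      change dualPairing k A _ w = g w
      rw [map_sum, LinearMap.sum_apply]
      induction w using TensorProduct.induction_on with
      | zero => simp only [map_zero, Finset.sum_const_zero]
      | add x y hx hy => simp only [map_add, Finset.sum_add_distrib, hx, hy]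
      | tmul a ξ =>
        have h1 : a ⊗ₜ ξ = ∑ i, (evalDual k A (e i) ξ • a) • ((1 : A) ⊗ₜ[k] f i) := by
          nth_rewrite 1 [← hf ξ]
          rw [TensorProduct.tmul_sum]
          refine Finset.sum_congr rfl fun i _ => ?_
          rw [TensorProduct.smul_tmul', smul_eq_mul, mul_one, TensorProduct.smul_tmul]
        rw [h1, map_sum]
        refine Finset.sum_congr rfl fun i _ => ?_
        rw [← h1, dualPairing_tmul, map_smul, smul_eq_mul])

end Dual

section DualCoefficients

variable {k : Type u} [Field k] {I : Type u} {Q : QuiverOn I} (M : Submodule k (PathAlgebra k Q))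

/-- The coefficients for the Koszul resolution of the left module `DΛ`. -/
def dualCoefficients : KoszulCoefficients M (QuiverAlgebra M) (LinDual k (QuiverAlgebra M))
    (LinDual k (QuiverAlgebra M)) where
  equiv := AddEquiv.refl _
  twist_smul r a ρ w := by
    induction w using TensorProduct.induction_on with
    | zero => rw [smul_zero, map_zero, smul_zero]
    | add x y hx hy => rw [smul_add, map_add, map_add, hx, hy, smul_add]
    | tmul b ξ =>
      rw [TensorProduct.smul_tmul', twist_tmul, twist_tmul, TensorProduct.smul_tmul', smul_eq_mul,
        smul_eq_mul, mul_assoc]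
  act_smul ρ w := by
    change tensorAct k _ _ (ρ • w) = ρ • tensorAct k _ _ w
    induction w using TensorProduct.induction_on with
    | zero => rw [smul_zero, map_zero, smul_zero]
    | add x y hx hy => rw [smul_add, map_add, map_add, hx, hy, smul_add]
    | tmul b ξ =>
      rw [TensorProduct.smul_tmul', tensorAct_tmul, tensorAct_tmul, smul_eq_mul, mul_smul]
  projective := inferInstance

variable [FiniteDimensional k (QuiverAlgebra M)]

/-- The identification of `Hom_Λ(Λ ⊗ DΛ, Λ)` with `Λ^e`. -/
def dualHomData : KoszulCoefficients.HomData M (QuiverAlgebra M) (LinDual k (QuiverAlgebra M))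
    (QuiverAlgebra M) where
  hom := dualHom k (QuiverAlgebra M)
  hom_mul u r a w := dualPairing_mul k _ u a r w

variable {M} [Finite I] [Finite Q.Arrow] (K : KoszulSystem M)

/-- This is the Ext computation with coefficients in `DΛ`. The left action comes from right
multiplication on `DΛ`, which lifts to the resolution as `Λ ⊗ (· a)`; the right action is
composition with right multiplication on the target `Λ`. -/
theorem exists_dualExt_presentation (hM : IsQuadratic M) (hK : K.LeftExact) {m : ℕ}
    (hn : IsEmpty (K.idx (m + 2))) :
    ∃ G : sumBimod M (K.src (m + 1)) (K.tgt (m + 1)) →+ DualExt k (QuiverAlgebra M) (m + 1),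
      Function.Surjective G ∧
      (∀ u, G u = 0 ↔ u ∈
        dualKoszulSubmodule M (m + 1) (K.dL m) (K.dR m) (K.src (m + 1)) (K.tgt (m + 1))) ∧
      (∀ (a : QuiverAlgebra M) u, a • G u = G ((a ⊗ₜ[k] (1 : (QuiverAlgebra M)ᵐᵒᵖ)) • u)) ∧
      ∀ (a : QuiverAlgebra M) u, op a • G u = G (((1 : QuiverAlgebra M) ⊗ₜ[k] op a) • u) := by
  let D := dualCoefficients M
  let H := dualHomData M
  refine ⟨D.extOf H K hM hK hn, D.extOf_surjective H K hM hK hn, D.extOf_eq_zero_iff H K hM hK hn,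
    fun a u => ?_, fun a u => ?_⟩
  · exact D.comp_extOf H K hM hK hn
      (Module.toModuleEnd (QuiverAlgebra M) (S := (QuiverAlgebra M)ᵐᵒᵖ) (LinDual k _) (op a))
      (tensorRightMul k _ a) _ (fun r b w => tensorRightMul_twist k _ r b a w)
      (fun w => tensorAct_tensorRightMul k _ a w) (fun u w => dualPairing_tensorRightMul k _ u a w) u
  · exact D.extOf_comp H K hM hK hn
      (Module.toModuleEnd (QuiverAlgebra M) (S := (QuiverAlgebra M)ᵐᵒᵖ) (QuiverAlgebra M) (op a)) _
      (fun u w => (dualPairing_mul_left k _ u a w).symm) u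

end DualCoefficients

/-! ### The image of the dual Koszul differential -/

namespace KoszulSystem

variable {k : Type u} [Field k] {I : Type u} {Q : QuiverOn I} {M : Submodule k (PathAlgebra k Q)}
  (K : KoszulSystem M)

/-- The coefficient of the dual Koszul differential. -/
def dualCoef (l : ℕ) (c : K.idx l) (b : K.idx (l + 1)) : Env k (QuiverAlgebra M) :=
  1 ⊗ₜ op (K.mR l c b) + (-1) ^ (l + 1) • (K.mL l c b ⊗ₜ 1)

theorem comps_koszulDiff (l : ℕ) (b c) :
    comps (koszulDiff M (l + 1) (K.dL l) (K.dR l) (K.src l) (K.tgt l) b) c =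
      envFlip k _ ((idem M (K.src l c) ⊗ₜ[k] op (idem M (K.tgt l c))) * K.dualCoef l c b) := by
  rw [envFlip_mul, dualCoef, map_add, map_zsmul]
  rfl

variable [Finite Q.Arrow]

/-- The idempotents of `p_c` on one side can be traded for those of `q_b` on the other, because a
nonzero derivative forces the remaining endpoints of `p_c` and `q_b` to agree. So the dual Koszul
elements are the flips of the entries of the differential. -/
theorem idem_mul_dualCoef (l : ℕ) (c b) :
    (idem M (K.src l c) ⊗ₜ[k] op (idem M (K.tgt l c))) * K.dualCoef l c b =
      K.dualCoef l c b * (idem M (K.src (l + 1) b) ⊗ₜ[k] op (idem M (K.tgt (l + 1) b))) := by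
  have h1 : (idem M (K.src l c) ⊗ₜ[k] op (idem M (K.tgt l c))) * (1 ⊗ₜ op (K.mR l c b)) =
      (1 ⊗ₜ op (K.mR l c b)) * (idem M (K.src (l + 1) b) ⊗ₜ op (idem M (K.tgt (l + 1) b))) := by
    rw [env_tmul_mul, env_tmul_mul, mul_one, one_mul, mR_mul_idem, idem_mul_mR]
    by_cases h : K.src l c = K.src (l + 1) b
    · rw [h]
    · rw [K.mR_eq_zero h, MulOpposite.op_zero, TensorProduct.tmul_zero, TensorProduct.tmul_zero]
  have h2 : (idem M (K.src l c) ⊗ₜ[k] op (idem M (K.tgt l c))) * (K.mL l c b ⊗ₜ op 1) =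
      (K.mL l c b ⊗ₜ op 1) * (idem M (K.src (l + 1) b) ⊗ₜ op (idem M (K.tgt (l + 1) b))) := by
    rw [env_tmul_mul, env_tmul_mul, mul_one, one_mul, mL_mul_idem, idem_mul_mL]
    by_cases h : K.tgt l c = K.tgt (l + 1) b
    · rw [h]
    · rw [K.mL_eq_zero h, TensorProduct.zero_tmul, TensorProduct.zero_tmul]
  rw [dualCoef, mul_add, add_mul, h1, mul_smul_comm, smul_mul_assoc]
  exact congrArg (fun w => _ + (-1) ^ (l + 1) • w) h2

theorem comps_dualKoszulElement (l : ℕ) (c b) :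
    comps (dualKoszulElement M (l + 1) (K.dL l) (K.dR l) (K.src (l + 1)) (K.tgt (l + 1)) c) b =
      (idem M (K.src l c) ⊗ₜ[k] op (idem M (K.tgt l c))) * K.dualCoef l c b :=
  (K.idem_mul_dualCoef l c b).symm

/-- A linear map into `Λ^e` multiplies components from the right by its values on generators. After
`envFlip`, which reverses products, these values become left coefficients of the dual Koszul
elements. -/
theorem mem_dualKoszulSubmodule_iff (l : ℕ) (x : sumBimod M (K.src (l + 1)) (K.tgt (l + 1))) :
    x ∈ dualKoszulSubmodule M (l + 1) (K.dL l) (K.dR l) (K.src (l + 1)) (K.tgt (l + 1)) ↔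
      ∃ φ : sumBimod M (K.tgt l) (K.src l) →ₗ[Env k (QuiverAlgebra M)] Env k (QuiverAlgebra M),
        ∀ b, (x b : Env k (QuiverAlgebra M)) =
          envFlip k (QuiverAlgebra M)
            (φ (koszulDiff M (l + 1) (K.dL l) (K.dR l) (K.src l) (K.tgt l) b)) := by
  classical
  constructor
  · intro h
    obtain ⟨v, rfl⟩ := (Submodule.mem_span_range_iff_exists_fun _).1 h
    refine ⟨{ toFun := fun z => ∑ c, comps z c * envFlip k _ (v c)
              map_add' := fun y z => ?_
              map_smul' := fun ρ z => ?_ }, fun b => ?_⟩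
    · rw [← Finset.sum_add_distrib]
      exact Finset.sum_congr rfl fun c _ => add_mul _ _ _
    · rw [RingHom.id_apply, smul_eq_mul, Finset.mul_sum]
      exact Finset.sum_congr rfl fun c _ => mul_assoc _ _ _
    · refine (comps_sum_smul v _ b).trans ?_
      change _ = envFlip k _ (∑ c, comps (koszulDiff M (l + 1) (K.dL l) (K.dR l) (K.src l)
        (K.tgt l) b) c * envFlip k _ (v c))
      rw [map_sum]
      refine Finset.sum_congr rfl fun c _ => ?_
      rw [envFlip_mul, envFlip_envFlip, comps_koszulDiff, envFlip_envFlip,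
        comps_dualKoszulElement]
  · rintro ⟨φ, hφ⟩
    -- These are the standard generators; `φ` is determined by its values on them.
    let g : ∀ c, sumBimod M (K.tgt l) (K.src l) := fun c => ofComps _ _ (Pi.single c 1)
    have hgb : ∀ c b, comps (g c) b = (Pi.single c 1 : K.idx l → Env k (QuiverAlgebra M)) b *
        (idem M (K.tgt l b) ⊗ₜ[k] op (idem M (K.src l b))) := fun c b => rfl
    have hg : ∀ z : sumBimod M (K.tgt l) (K.src l), z = ∑ c, comps z c • g c := by
      intro z
      refine comps_injective (funext fun b => ?_)
      rw [comps_sum_smul, Finset.sum_eq_single b]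
      · rw [hgb, Pi.single_eq_same, one_mul, comps_mul]
      · intro c _ hc
        rw [hgb, Pi.single_eq_of_ne (Ne.symm hc), zero_mul, mul_zero]
      · intro hb
        exact absurd (Finset.mem_univ b) hb
    have hx : x = ∑ c, envFlip k _ (φ (g c)) •
        dualKoszulElement M (l + 1) (K.dL l) (K.dR l) (K.src (l + 1)) (K.tgt (l + 1)) c := by
      refine comps_injective (funext fun b => ?_)
      rw [comps_sum_smul]
      refine (hφ b).trans ?_
      rw [hg (koszulDiff M (l + 1) (K.dL l) (K.dR l) (K.src l) (K.tgt l) b), map_sum, map_sum]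
      refine Finset.sum_congr rfl fun c _ => ?_
      rw [map_smul, smul_eq_mul, envFlip_mul, comps_koszulDiff, envFlip_envFlip,
        comps_dualKoszulElement]
    rw [hx]
    exact Submodule.sum_mem _ fun c _ => Submodule.smul_mem _ _ (Submodule.subset_span ⟨c, rfl⟩)

end KoszulSystem

/-! ### The extended quiver -/

section ExtendedQuiver

variable {k : Type u} [Field k] {I : Type u} {Q : QuiverOn I} {B C : Type u} (s t : B → I)

theorem pathAlgebra_algHom_ext [Finite Q.Arrow] {R : Type u} [Ring R] [Algebra k R]
    {f g : PathAlgebra k Q →ₐ[k] R}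
    (hb : ∀ c, f (BimodTensorAlgebra.base k (I → k) (ArrowSpace k Q) c) =
      g (BimodTensorAlgebra.base k (I → k) (ArrowSpace k Q) c))
    (ha : ∀ a, f (arrow k Q a) = g (arrow k Q a)) : f = g := by
  cases nonempty_fintype Q.Arrow
  refine BimodTensorAlgebra.algHom_ext hb fun v => ?_
  rw [gen_eq_sum, map_sum, map_sum]
  exact Finset.sum_congr rfl fun a _ => by rw [map_smul, map_smul, ha]

theorem inclPath_base (c : I → k) :
    inclPath s t (BimodTensorAlgebra.base k (I → k) (ArrowSpace k Q) c) =
      BimodTensorAlgebra.base k (I → k) _ c :=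
  BimodTensorAlgebra.lift_base _ _ _ _ c

theorem inclPath_gen (v : ArrowSpace k Q) :
    inclPath s t (BimodTensorAlgebra.gen k (I → k) (ArrowSpace k Q) v) =
      BimodTensorAlgebra.gen k (I → k) _ (inclArrow s t v) :=
  BimodTensorAlgebra.lift_gen _ _ _ _ v

theorem inclPath_vertex (i : I) :
    inclPath s t (vertex k Q i) = vertex k (extendQuiver Q s t) i :=
  inclPath_base s t _

theorem arrowVec_inl_inl [DecidableEq Q.Arrow] (a a' : Q.Arrow) :
    arrowVec (Q := extendQuiver Q s t) k (Sum.inl a) (Sum.inl a') = if a' = a then 1 else 0 := by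
  classical
  refine (arrowVec_apply (Q := extendQuiver Q s t) (Sum.inl a) (Sum.inl a')).trans ?_
  by_cases h : a' = a
  · exact (if_pos (congrArg Sum.inl h)).trans (if_pos h).symm
  · exact (if_neg fun h' => h (Sum.inl.inj h')).trans (if_neg h).symm

theorem arrowVec_inl_inr (a : Q.Arrow) (b : B) :
    arrowVec (Q := extendQuiver Q s t) k (Sum.inl a) (Sum.inr b) = 0 := by
  classical
  exact (arrowVec_apply (Q := extendQuiver Q s t) (Sum.inl a) (Sum.inr b)).trans
    (if_neg Sum.inr_ne_inl)

theorem arrowVec_inr_inl (b : B) (a : Q.Arrow) :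
    arrowVec (Q := extendQuiver Q s t) k (Sum.inr b) (Sum.inl a) = 0 := by
  classical
  exact (arrowVec_apply (Q := extendQuiver Q s t) (Sum.inr b) (Sum.inl a)).trans
    (if_neg Sum.inl_ne_inr)

theorem arrowVec_inr_inr [DecidableEq B] (b b' : B) :
    arrowVec (Q := extendQuiver Q s t) k (Sum.inr b) (Sum.inr b') = if b' = b then 1 else 0 := by
  classical
  refine (arrowVec_apply (Q := extendQuiver Q s t) (Sum.inr b) (Sum.inr b')).trans ?_
  by_cases h : b' = b
  · exact (if_pos (congrArg Sum.inr h)).trans (if_pos h).symm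
  · exact (if_neg fun h' => h (Sum.inr.inj h')).trans (if_neg h).symm

theorem inclPath_arrow (a : Q.Arrow) :
    inclPath s t (arrow k Q a) = arrow k (extendQuiver Q s t) (Sum.inl a) := by
  classical
  refine (inclPath_gen s t _).trans (congrArg _ ?_)
  funext x
  rcases x with a' | b
  · exact (arrowVec_apply a a').trans (arrowVec_inl_inl s t a a').symm
  · exact (arrowVec_inl_inr s t a b).symm

theorem inclPath_mem_arrowSpan {x : PathAlgebra k Q} (hx : x ∈ arrowSpan k Q) :
    inclPath s t x ∈ arrowSpan k (extendQuiver Q s t) := by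
  obtain ⟨v, rfl⟩ := mem_arrowSpan.1 hx
  rw [inclPath_gen]
  exact gen_mem_arrowSpan _

theorem vertex_mul_newArrow (b : B) : vertex k (extendQuiver Q s t) (s b) * newArrow s t b =
    (newArrow s t b : PathAlgebra k (extendQuiver Q s t)) :=
  vertex_mul_arrow (Q := extendQuiver Q s t) (Sum.inr b)

theorem newArrow_mul_vertex (b : B) : newArrow s t b * vertex k (extendQuiver Q s t) (t b) =
    (newArrow s t b : PathAlgebra k (extendQuiver Q s t)) :=
  arrow_mul_vertex (Q := extendQuiver Q s t) (Sum.inr b)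

theorem allRelations_subset [Fintype B] {M : Submodule k (PathAlgebra k Q)} (hM : IsQuadratic M)
    (n : ℕ) {δL δR : C → B → PathAlgebra k Q} (hL : ∀ c b, δL c b ∈ arrowSpan k Q)
    (hR : ∀ c b, δR c b ∈ arrowSpan k Q) :
    ∀ r ∈ allRelations s t M n δL δR, r ∈ arrowSpan k (extendQuiver Q s t) ^ 2 := by
  have hnew : ∀ b, newArrow s t b ∈ arrowSpan k (extendQuiver Q s t) := fun b =>
    gen_mem_arrowSpan _
  rintro _ (⟨x, hx, rfl⟩ | ⟨c, rfl⟩)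
  · have h : arrowSpan k Q ^ 2 ≤
        (arrowSpan k (extendQuiver Q s t) ^ 2).comap (inclPath s t).toLinearMap := by
      rw [pow_two (arrowSpan k Q), Submodule.mul_le]
      intro y hy z hz
      change inclPath s t (y * z) ∈ arrowSpan k (extendQuiver Q s t) ^ 2
      rw [map_mul, pow_two]
      exact Submodule.mul_mem_mul (inclPath_mem_arrowSpan s t hy) (inclPath_mem_arrowSpan s t hz)
    exact h (hM.1 hx)
  · rw [pow_two, newRelation]
    have h1 : ∑ b, newArrow s t b * inclPath s t (δR c b) ∈
        arrowSpan k (extendQuiver Q s t) * arrowSpan k (extendQuiver Q s t) :=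
      Submodule.sum_mem _ fun b _ =>
        Submodule.mul_mem_mul (hnew b) (inclPath_mem_arrowSpan s t (hR c b))
    have h2 : ∑ b, inclPath s t (δL c b) * newArrow s t b ∈
        arrowSpan k (extendQuiver Q s t) * arrowSpan k (extendQuiver Q s t) :=
      Submodule.sum_mem _ fun b _ =>
        Submodule.mul_mem_mul (inclPath_mem_arrowSpan s t (hL c b)) (hnew b)
    refine Submodule.add_mem _ h1 ?_
    rcases neg_one_pow_eq_or (PathAlgebra k (extendQuiver Q s t)) n with h | h
    · rwa [h, one_mul]
    · rw [h, neg_one_mul]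
      exact Submodule.neg_mem _ h2

end ExtendedQuiver

/-! ### The map from the extended path algebra to a tensor algebra -/

section Presentation

variable {k : Type u} [Field k] {I : Type u} {Q : QuiverOn I} {B C : Type u} (s t : B → I)
  {M : Submodule k (PathAlgebra k Q)}

/-- The generator `e_{s b} ⊗ e_{t b}` of the summand with index `b`. -/
def summandGen [DecidableEq B] (b : B) : sumBimod M s t := ofComps s t (Pi.single b 1)

theorem eq_sum_summandGen [DecidableEq B] [Fintype B] (u : sumBimod M s t) :
    u = ∑ b, comps u b • summandGen s t b := by
  have hgb : ∀ c b, comps (summandGen (M := M) s t c) b =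
      (Pi.single c 1 : B → Env k (QuiverAlgebra M)) b *
        (idem M (s b) ⊗ₜ[k] op (idem M (t b))) := fun c b => rfl
  refine comps_injective (funext fun b => ?_)
  rw [comps_sum_smul, Finset.sum_eq_single b]
  · rw [hgb, Pi.single_eq_same, one_mul, comps_mul]
  · intro c _ hc
    rw [hgb, Pi.single_eq_of_ne (Ne.symm hc), zero_mul, mul_zero]
  · intro hb
    exact absurd (Finset.mem_univ b) hb

variable {E : Type u} [AddCommGroup E] [Module (QuiverAlgebra M) E] [Module (QuiverAlgebra M)ᵐᵒᵖ E]

/-- Used with `x ∈ S`, to check that the images of the new arrows respect the left `S`-action: only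
the value of `x` at the vertex `i` matters for an element cut by `e_i`. -/
theorem base_smul_gen {x : PathAlgebra k Q} {i : I} {κ : k} (hx : x * vertex k Q i = κ • vertex k Q i)
    {ξ : E} (hξ : idem M i • ξ = ξ) :
    BimodTensorAlgebra.base k (QuiverAlgebra M) E (toQuiverAlgebra M x) *
      BimodTensorAlgebra.gen k (QuiverAlgebra M) E ξ =
        κ • BimodTensorAlgebra.gen k (QuiverAlgebra M) E ξ := by
  conv_lhs => rw [← hξ, ← BimodTensorAlgebra.base_mul_gen, ← mul_assoc, ← map_mul, idem, ← map_mul,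
    hx, map_smul, map_smul, smul_mul_assoc]
  rw [BimodTensorAlgebra.base_mul_gen]
  exact congrArg (fun η => κ • BimodTensorAlgebra.gen k (QuiverAlgebra M) E η) hξ

theorem gen_smul_base {x : PathAlgebra k Q} {i : I} {κ : k} (hx : vertex k Q i * x = κ • vertex k Q i)
    {ξ : E} (hξ : op (idem M i) • ξ = ξ) :
    BimodTensorAlgebra.gen k (QuiverAlgebra M) E ξ *
      BimodTensorAlgebra.base k (QuiverAlgebra M) E (toQuiverAlgebra M x) =
        κ • BimodTensorAlgebra.gen k (QuiverAlgebra M) E ξ := by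
  conv_lhs => rw [← hξ, ← BimodTensorAlgebra.gen_mul_base, mul_assoc, ← map_mul, idem, ← map_mul,
    hx, map_smul, map_smul, mul_smul_comm]
  rw [BimodTensorAlgebra.gen_mul_base]
  exact congrArg (fun η => κ • BimodTensorAlgebra.gen k (QuiverAlgebra M) E η) hξ

section Forward

variable [Fintype B] (γ : B → E)

/-- The additive map underlying `toTensor` on arrows. -/
def arrowsToTensor : ArrowSpace k (extendQuiver Q s t) →+
    BimodTensorAlgebra k (QuiverAlgebra M) E :=
  AddMonoidHom.mk' (fun w : Q.Arrow ⊕ B → k =>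
    BimodTensorAlgebra.base k (QuiverAlgebra M) E (toQuiverAlgebra M
      (BimodTensorAlgebra.gen k (I → k) (ArrowSpace k Q) (fun a => w (Sum.inl a)))) +
    ∑ b, w (Sum.inr b) • BimodTensorAlgebra.gen k (QuiverAlgebra M) E (γ b)) fun v w => by
      have h1 : (∑ b, (v + w) (Sum.inr b) • BimodTensorAlgebra.gen k (QuiverAlgebra M) E (γ b)) =
          (∑ b, v (Sum.inr b) • BimodTensorAlgebra.gen k (QuiverAlgebra M) E (γ b)) +
            ∑ b, w (Sum.inr b) • BimodTensorAlgebra.gen k (QuiverAlgebra M) E (γ b) := by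
        rw [← Finset.sum_add_distrib]
        exact Finset.sum_congr rfl fun b _ => add_smul _ _ _
      have h2 : BimodTensorAlgebra.gen k (I → k) (ArrowSpace k Q)
          (fun a => (v + w) (Sum.inl a)) =
          BimodTensorAlgebra.gen k (I → k) (ArrowSpace k Q) (fun a => v (Sum.inl a)) +
            BimodTensorAlgebra.gen k (I → k) (ArrowSpace k Q) (fun a => w (Sum.inl a)) :=
        map_add (BimodTensorAlgebra.gen k (I → k) (ArrowSpace k Q)) _ _
      rw [h1, h2, map_add, map_add]
      abel

theorem arrowsToTensor_apply (w : ArrowSpace k (extendQuiver Q s t)) :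
    arrowsToTensor (M := M) s t γ w =
      BimodTensorAlgebra.base k (QuiverAlgebra M) E (toQuiverAlgebra M
        (BimodTensorAlgebra.gen k (I → k) (ArrowSpace k Q) (fun a => w (Sum.inl a)))) +
      ∑ b, (w (Sum.inr b) : k) • BimodTensorAlgebra.gen k (QuiverAlgebra M) E (γ b) := rfl

variable (hs : ∀ b, idem M (s b) • γ b = γ b) (ht : ∀ b, op (idem M (t b)) • γ b = γ b)

/-- The homomorphism from the path algebra of the extended quiver to `T_Λ E` sending the new arrows
to given elements of `E`. -/
def toTensor : PathAlgebra k (extendQuiver Q s t) →ₐ[k] BimodTensorAlgebra k (QuiverAlgebra M) E :=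
  BimodTensorAlgebra.lift
    (((BimodTensorAlgebra.base k (QuiverAlgebra M) E).comp (toQuiverAlgebra M)).comp
      (BimodTensorAlgebra.base k (I → k) (ArrowSpace k Q)))
    (arrowsToTensor s t γ)
    (by
      intro c w
      rw [arrowsToTensor_apply, arrowsToTensor_apply, mul_add]
      congr 1
      · change _ = BimodTensorAlgebra.base k _ E (toQuiverAlgebra M _) * _
        rw [← map_mul, ← map_mul]
        exact congrArg (fun z => BimodTensorAlgebra.base k _ E (toQuiverAlgebra M z))
          (BimodTensorAlgebra.base_mul_gen (k := k) (V := ArrowSpace k Q) c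
            fun a => w (Sum.inl a)).symm
      · rw [Finset.mul_sum]
        refine Finset.sum_congr rfl fun b _ => ?_
        rw [mul_smul_comm]
        refine Eq.trans ?_ (congrArg (fun z => (w (Sum.inr b) : k) • z)
          (base_smul_gen (base_mul_vertex c (s b)) (hs b))).symm
        rw [smul_smul]
        exact congrArg (fun z : k => z • _) (mul_comm (c (s b)) (w (Sum.inr b))))
    (by
      intro c w
      rw [arrowsToTensor_apply, arrowsToTensor_apply, add_mul]
      congr 1
      · change _ = _ * BimodTensorAlgebra.base k _ E (toQuiverAlgebra M _)
        rw [← map_mul, ← map_mul]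
        exact congrArg (fun z => BimodTensorAlgebra.base k _ E (toQuiverAlgebra M z))
          (BimodTensorAlgebra.gen_mul_base (k := k) (V := ArrowSpace k Q) c
            fun a => w (Sum.inl a)).symm
      · rw [Finset.sum_mul]
        refine Finset.sum_congr rfl fun b _ => ?_
        rw [smul_mul_assoc]
        refine Eq.trans ?_ (congrArg (fun z => (w (Sum.inr b) : k) • z)
          (gen_smul_base (vertex_mul_base c (t b)) (ht b))).symm
        rw [smul_smul]
        rfl)

theorem toTensor_base (c : I → k) :
    toTensor s t γ hs ht (BimodTensorAlgebra.base k (I → k) _ c) =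
      BimodTensorAlgebra.base k (QuiverAlgebra M) E (toQuiverAlgebra M
        (BimodTensorAlgebra.base k (I → k) (ArrowSpace k Q) c)) :=
  BimodTensorAlgebra.lift_base _ _ _ _ c

theorem toTensor_gen (w : ArrowSpace k (extendQuiver Q s t)) :
    toTensor s t γ hs ht (BimodTensorAlgebra.gen k (I → k) _ w) = arrowsToTensor s t γ w :=
  BimodTensorAlgebra.lift_gen _ _ _ _ w

theorem toTensor_inclPath (x : PathAlgebra k Q) : toTensor s t γ hs ht (inclPath s t x) =
    BimodTensorAlgebra.base k (QuiverAlgebra M) E (toQuiverAlgebra M x) := by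
  suffices h : (toTensor s t γ hs ht).comp (inclPath s t) =
      (BimodTensorAlgebra.base k (QuiverAlgebra M) E).comp (toQuiverAlgebra M) from
    AlgHom.congr_fun h x
  refine BimodTensorAlgebra.algHom_ext (fun c => ?_) fun v => ?_
  · rw [AlgHom.comp_apply, inclPath_base, toTensor_base]
    rfl
  · rw [AlgHom.comp_apply, inclPath_gen, toTensor_gen, arrowsToTensor_apply]
    refine Eq.trans (congrArg (_ + ·) (Finset.sum_eq_zero fun b _ => ?_)) (add_zero _)
    exact zero_smul k _

theorem toTensor_newArrow (b : B) : toTensor s t γ hs ht (newArrow s t b) =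
    BimodTensorAlgebra.gen k (QuiverAlgebra M) E (γ b) := by
  classical
  refine (toTensor_gen s t γ hs ht (arrowVec k (Sum.inr b))).trans
    ((arrowsToTensor_apply s t γ _).trans ?_)
  have h0 : (fun a => arrowVec (Q := extendQuiver Q s t) k (Sum.inr b) (Sum.inl a)) =
      (0 : ArrowSpace k Q) := funext fun a => arrowVec_inr_inl s t b a
  have h1 : (∑ c, arrowVec (Q := extendQuiver Q s t) k (Sum.inr b) (Sum.inr c) •
      BimodTensorAlgebra.gen k (QuiverAlgebra M) E (γ c)) =
      BimodTensorAlgebra.gen k (QuiverAlgebra M) E (γ b) := by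
    rw [Finset.sum_eq_single b]
    · exact (congrArg (· • _) ((arrowVec_inr_inr s t b b).trans (if_pos rfl))).trans (one_smul k _)
    · exact fun c _ hc =>
        (congrArg (· • _) ((arrowVec_inr_inr s t b c).trans (if_neg hc))).trans (zero_smul k _)
    · exact fun hb => absurd (Finset.mem_univ b) hb
  refine (congrArg₂ (fun v z => BimodTensorAlgebra.base k (QuiverAlgebra M) E
    (toQuiverAlgebra M (BimodTensorAlgebra.gen k (I → k) (ArrowSpace k Q) v)) + z) h0 h1).trans ?_
  rw [map_zero, map_zero, map_zero, zero_add]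

end Forward

end Presentation

/-! ### Presentation of the tensor algebra by new arrows and relations -/

section Sandwich

variable {k : Type u} [Field k] {A : Type u} [Ring A] [Algebra k A] {R : Type u} [Ring R]
  [Algebra k R]

/-- The linear map `a ⊗ op b ↦ f a * r * f b`. -/
def sandwich (f : A →ₐ[k] R) (r : R) : Env k A →ₗ[k] R :=
  (LinearMap.mul' k R).comp (TensorProduct.map ((LinearMap.mulRight k r).comp f.toLinearMap)
    (f.toLinearMap.comp (opLinearEquiv k).symm.toLinearMap))

theorem sandwich_tmul (f : A →ₐ[k] R) (r : R) (a b : A) :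
    sandwich f r (a ⊗ₜ op b) = f a * r * f b := rfl

theorem sandwich_tmul_mul (f : A →ₐ[k] R) (r : R) (a b : A) (w : Env k A) :
    sandwich f r ((a ⊗ₜ op b) * w) = f a * sandwich f r w * f b := by
  induction w using env_induction with
  | h0 => rw [mul_zero, map_zero, mul_zero, zero_mul]
  | hadd x y hx hy => rw [mul_add, map_add, map_add, hx, hy, mul_add, add_mul]
  | h c d =>
    rw [env_tmul_mul, sandwich_tmul, sandwich_tmul, map_mul, map_mul]
    simp only [mul_assoc]

end Sandwich

theorem neg_one_pow_zsmul {R : Type u} [Ring R] (n : ℕ) (x : R) : (-1 : ℤ) ^ n • x = (-1) ^ n * x := by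
  rw [zsmul_eq_mul]
  push_cast
  rfl

section Presentation

variable {k : Type u} [Field k] {I : Type u} {Q : QuiverOn I} {B C : Type u} {s t : B → I}
  {M : Submodule k (PathAlgebra k Q)} {n : ℕ} {δL δR : C → B → PathAlgebra k Q}

section Generators

variable {E : Type u} [AddCommGroup E] [Module (QuiverAlgebra M) E]
  [Module (QuiverAlgebra M)ᵐᵒᵖ E] {G : sumBimod M s t →+ E}

theorem idem_tmul_smul_summandGen [DecidableEq B] (b : B) :
    (idem M (s b) ⊗ₜ[k] op (1 : QuiverAlgebra M)) • summandGen s t b = summandGen (M := M) s t b := by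
  refine comps_injective (funext fun c => ?_)
  rw [comps_smul, summandGen, comps_ofComps]
  by_cases h : c = b
  · subst h
    simp only [Pi.single_eq_same, one_mul]
    rw [env_tmul_mul, IsQuadratic.idem_mul_self, mul_one]
  · simp only [Pi.single_eq_of_ne h, zero_mul, mul_zero]

theorem tmul_idem_smul_summandGen [DecidableEq B] (b : B) :
    ((1 : QuiverAlgebra M) ⊗ₜ[k] op (idem M (t b))) • summandGen s t b =
      summandGen (M := M) s t b := by
  refine comps_injective (funext fun c => ?_)
  rw [comps_smul, summandGen, comps_ofComps]
  by_cases h : c = b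
  · subst h
    simp only [Pi.single_eq_same, one_mul]
    rw [env_tmul_mul, IsQuadratic.idem_mul_self, one_mul]
  · simp only [Pi.single_eq_of_ne h, zero_mul, mul_zero]

theorem dualKoszulElement_eq_sum [DecidableEq B] [Fintype B] (c : C) :
    dualKoszulElement M n δL δR s t c = ∑ b,
      ((1 : QuiverAlgebra M) ⊗ₜ[k] op (toQuiverAlgebra M (δR c b)) +
        (-1 : ℤ) ^ n • (toQuiverAlgebra M (δL c b) ⊗ₜ[k] (1 : (QuiverAlgebra M)ᵐᵒᵖ))) •
          summandGen s t b := by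
  refine comps_injective (funext fun b => ?_)
  rw [comps_sum_smul, Finset.sum_eq_single b]
  · rw [summandGen, comps_ofComps]
    simp only [Pi.single_eq_same, one_mul]
    rfl
  · intro c _ hc
    rw [summandGen, comps_ofComps]
    simp only [Pi.single_eq_of_ne (Ne.symm hc), zero_mul, mul_zero]
  · exact fun hb => absurd (Finset.mem_univ b) hb

theorem gen_tmul_smul
    (hl : ∀ (a : QuiverAlgebra M) u, a • G u = G ((a ⊗ₜ[k] (1 : (QuiverAlgebra M)ᵐᵒᵖ)) • u))
    (hr : ∀ (a : QuiverAlgebra M) u, op a • G u = G (((1 : QuiverAlgebra M) ⊗ₜ[k] op a) • u))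
    (a b : QuiverAlgebra M) (u : sumBimod M s t) :
    BimodTensorAlgebra.gen k (QuiverAlgebra M) E (G ((a ⊗ₜ[k] op b) • u)) =
      BimodTensorAlgebra.base k (QuiverAlgebra M) E a *
        BimodTensorAlgebra.gen k (QuiverAlgebra M) E (G u) *
          BimodTensorAlgebra.base k (QuiverAlgebra M) E b := by
  rw [BimodTensorAlgebra.base_mul_gen, BimodTensorAlgebra.gen_mul_base, hl, hr, smul_smul]
  have h : (a ⊗ₜ[k] op b) = ((1 : QuiverAlgebra M) ⊗ₜ[k] op b) * (a ⊗ₜ[k] op 1) := by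
    rw [env_tmul_mul, one_mul, one_mul]
  rw [h]
  rfl

theorem gen_smul_eq_sandwich
    (hl : ∀ (a : QuiverAlgebra M) u, a • G u = G ((a ⊗ₜ[k] (1 : (QuiverAlgebra M)ᵐᵒᵖ)) • u))
    (hr : ∀ (a : QuiverAlgebra M) u, op a • G u = G (((1 : QuiverAlgebra M) ⊗ₜ[k] op a) • u))
    (w : Env k (QuiverAlgebra M)) (u : sumBimod M s t) :
    BimodTensorAlgebra.gen k (QuiverAlgebra M) E (G (w • u)) =
      sandwich (BimodTensorAlgebra.base k (QuiverAlgebra M) E)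
        (BimodTensorAlgebra.gen k (QuiverAlgebra M) E (G u)) w := by
  induction w using env_induction with
  | h0 =>
    have h : (0 : Env k (QuiverAlgebra M)) • u = 0 := Module.zero_smul _
    refine (congrArg (fun z => BimodTensorAlgebra.gen k (QuiverAlgebra M) E (G z)) h).trans ?_
    rw [map_zero, map_zero, map_zero]
  | hadd x y hx hy => rw [add_smul, map_add, map_add, map_add, hx, hy]
  | h a b => rw [gen_tmul_smul hl hr, sandwich_tmul]

/-- The image of the dual Koszul element of `p` in the tensor algebra is `r_p` with every `a_q`
replaced by the class of the `q`-th generator. As `G` kills that element, the relation `r_p` holds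
there. -/
theorem gen_dualKoszulElement [DecidableEq B] [Fintype B]
    (hl : ∀ (a : QuiverAlgebra M) u, a • G u = G ((a ⊗ₜ[k] (1 : (QuiverAlgebra M)ᵐᵒᵖ)) • u))
    (hr : ∀ (a : QuiverAlgebra M) u, op a • G u = G (((1 : QuiverAlgebra M) ⊗ₜ[k] op a) • u))
    (c : C) :
    BimodTensorAlgebra.gen k (QuiverAlgebra M) E (G (dualKoszulElement M n δL δR s t c)) =
      ∑ b, BimodTensorAlgebra.gen k (QuiverAlgebra M) E (G (summandGen s t b)) *
        BimodTensorAlgebra.base k (QuiverAlgebra M) E (toQuiverAlgebra M (δR c b)) +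
      (-1) ^ n * ∑ b, BimodTensorAlgebra.base k (QuiverAlgebra M) E (toQuiverAlgebra M (δL c b)) *
        BimodTensorAlgebra.gen k (QuiverAlgebra M) E (G (summandGen s t b)) := by
  rw [dualKoszulElement_eq_sum, map_sum, map_sum, Finset.mul_sum, ← Finset.sum_add_distrib]
  refine Finset.sum_congr rfl fun b _ => ?_
  rw [gen_smul_eq_sandwich hl hr, map_add, map_zsmul, neg_one_pow_zsmul, sandwich_tmul, map_one,
    one_mul]
  congr 2
  refine (sandwich_tmul _ _ _ 1).trans ?_
  rw [map_one, mul_one]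

end Generators

section Backward

variable [Fintype B] (s t M n δL δR)

/-- The homomorphism from `Λ` to the quotient of the path algebra of the extended quiver. -/
def toExtended : QuiverAlgebra M →ₐ[k] QuotAlg (allRelations s t M n δL δR) :=
  QuotAlg.lift ((QuotAlg.mk k _).comp (inclPath s t)) fun x hx =>
    QuotAlg.mk_eq_zero (Or.inl ⟨x, hx, rfl⟩)

theorem toExtended_mk (x : PathAlgebra k Q) : toExtended s t M n δL δR (toQuiverAlgebra M x) =
    QuotAlg.mk k _ (inclPath s t x) :=
  QuotAlg.lift_mk _ _ x

/-- The class of a new arrow. -/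
def newClass (b : B) : QuotAlg (allRelations s t M n δL δR) := QuotAlg.mk k _ (newArrow s t b)

theorem idem_mul_newClass (b : B) :
    toExtended s t M n δL δR (idem M (s b)) * newClass s t M n δL δR b =
      newClass s t M n δL δR b := by
  rw [idem, toExtended_mk, newClass, ← map_mul, inclPath_vertex, vertex_mul_newArrow]

theorem newClass_mul_idem (b : B) :
    newClass s t M n δL δR b * toExtended s t M n δL δR (idem M (t b)) =
      newClass s t M n δL δR b := by
  rw [idem, toExtended_mk, newClass, ← map_mul, inclPath_vertex, newArrow_mul_vertex]

/-- The bimodule map sending the generators of the summands to the classes of the new arrows. -/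
def sumToExtended : sumBimod M s t →+ QuotAlg (allRelations s t M n δL δR) :=
  AddMonoidHom.mk' (fun u => ∑ b, sandwich (toExtended s t M n δL δR)
    (newClass s t M n δL δR b) (comps u b)) fun u v => by
      rw [← Finset.sum_add_distrib]
      exact Finset.sum_congr rfl fun b _ => map_add _ _ _

theorem sumToExtended_apply (u : sumBimod M s t) : sumToExtended s t M n δL δR u =
    ∑ b, sandwich (toExtended s t M n δL δR) (newClass s t M n δL δR b) (comps u b) := rfl

theorem sumToExtended_tmul_smul (x y : QuiverAlgebra M) (u : sumBimod M s t) :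
    sumToExtended s t M n δL δR ((x ⊗ₜ[k] op y) • u) =
      toExtended s t M n δL δR x * sumToExtended s t M n δL δR u * toExtended s t M n δL δR y := by
  rw [sumToExtended_apply, sumToExtended_apply, Finset.mul_sum, Finset.sum_mul]
  exact Finset.sum_congr rfl fun b _ => sandwich_tmul_mul _ _ _ _ _

theorem sumToExtended_summandGen [DecidableEq B] (b : B) :
    sumToExtended s t M n δL δR (summandGen s t b) = newClass s t M n δL δR b := by
  have hs : ∀ c, toExtended s t M n δL δR (idem M (s c)) * newClass s t M n δL δR c *
      toExtended s t M n δL δR (idem M (t c)) = newClass s t M n δL δR c := fun c => by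
    rw [idem_mul_newClass, newClass_mul_idem]
  rw [sumToExtended_apply, summandGen, comps_ofComps]
  dsimp only
  rw [Finset.sum_eq_single b]
  · rw [Pi.single_eq_same, one_mul, sandwich_tmul, hs]
  · intro c _ hc
    rw [Pi.single_eq_of_ne hc, zero_mul, map_zero]
  · exact fun hb => absurd (Finset.mem_univ b) hb

/-- Conversely, replacing the generators by the classes of the new arrows turns the dual Koszul
element into the class of `r_p`, which is zero in the quotient. -/
theorem sumToExtended_dualKoszulElement (c : C) :
    sumToExtended s t M n δL δR (dualKoszulElement M n δL δR s t c) = 0 := by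
  classical
  have h : QuotAlg.mk k (allRelations s t M n δL δR) (newRelation s t n δL δR c) = 0 :=
    QuotAlg.mk_eq_zero (Or.inr ⟨c, rfl⟩)
  rw [← h, newRelation, map_add, map_mul, map_pow, map_neg, map_one, map_sum, map_sum,
    Finset.mul_sum, ← Finset.sum_add_distrib, dualKoszulElement_eq_sum, map_sum]
  refine Finset.sum_congr rfl fun b _ => ?_
  have hl : ∀ x : QuiverAlgebra M, sumToExtended s t M n δL δR
      ((x ⊗ₜ[k] (1 : (QuiverAlgebra M)ᵐᵒᵖ)) • summandGen s t b) =
        toExtended s t M n δL δR x * newClass s t M n δL δR b := fun x => by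
    refine (sumToExtended_tmul_smul s t M n δL δR x 1 _).trans ?_
    rw [map_one, mul_one, sumToExtended_summandGen]
  rw [add_smul, map_add, sumToExtended_tmul_smul, sumToExtended_summandGen, map_one, one_mul,
    smul_assoc, map_zsmul, neg_one_pow_zsmul, hl, toExtended_mk, toExtended_mk, map_mul, map_mul]
  rfl

theorem sumToExtended_eq_zero {u : sumBimod M s t} (hu : u ∈ dualKoszulSubmodule M n δL δR s t) :
    sumToExtended s t M n δL δR u = 0 := by
  induction hu using Submodule.span_induction with
  | mem x hx =>
    obtain ⟨c, rfl⟩ := hx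
    exact sumToExtended_dualKoszulElement s t M n δL δR c
  | zero => exact map_zero _
  | add x y _ _ hx hy => rw [map_add, hx, hy, add_zero]
  | smul w x _ hx =>
    induction w using env_induction with
    | h0 =>
      have h : (0 : Env k (QuiverAlgebra M)) • x = 0 := Module.zero_smul _
      exact (congrArg _ h).trans (map_zero _)
    | hadd v w hv hw => rw [add_smul, map_add, hv, hw, add_zero]
    | h a b => rw [sumToExtended_tmul_smul, hx, mul_zero, zero_mul]

end Backward

/-- A tensor algebra `T_Λ E` on a bimodule presented by the new arrows and relations is the quotient
of the path algebra of the extended quiver by all the relations. -/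
theorem exists_quotAlg_equiv [Fintype B] [Finite Q.Arrow] {E : Type u} [AddCommGroup E]
    [Module (QuiverAlgebra M) E] [Module (QuiverAlgebra M)ᵐᵒᵖ E] (G : sumBimod M s t →+ E)
    (hG : Function.Surjective G) (hker : ∀ u, G u = 0 ↔ u ∈ dualKoszulSubmodule M n δL δR s t)
    (hl : ∀ (a : QuiverAlgebra M) u, a • G u = G ((a ⊗ₜ[k] (1 : (QuiverAlgebra M)ᵐᵒᵖ)) • u))
    (hr : ∀ (a : QuiverAlgebra M) u, op a • G u = G (((1 : QuiverAlgebra M) ⊗ₜ[k] op a) • u)) :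
    ∃ Φ : QuotAlg (allRelations s t M n δL δR) ≃ₐ[k] BimodTensorAlgebra k (QuiverAlgebra M) E,
      (∀ x : PathAlgebra k Q, Φ (QuotAlg.mk k (allRelations s t M n δL δR) (inclPath s t x)) =
        BimodTensorAlgebra.base k (QuiverAlgebra M) E (toQuiverAlgebra M x)) ∧
      ∀ b, ∃ ξ : E, Φ (QuotAlg.mk k (allRelations s t M n δL δR) (newArrow s t b)) =
        BimodTensorAlgebra.gen k (QuiverAlgebra M) E ξ := by
  classical
  have hs : ∀ b, idem M (s b) • G (summandGen s t b) = G (summandGen s t b) := fun b => by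
    rw [hl]
    exact congrArg G (idem_tmul_smul_summandGen b)
  have ht : ∀ b, op (idem M (t b)) • G (summandGen s t b) = G (summandGen s t b) := fun b => by
    rw [hr, tmul_idem_smul_summandGen]
  let T := toTensor s t (fun b => G (summandGen s t b)) hs ht
  have hT : ∀ x ∈ allRelations s t M n δL δR, T x = 0 := by
    rintro _ (⟨x, hx, rfl⟩ | ⟨c, rfl⟩)
    · refine (toTensor_inclPath s t _ hs ht x).trans ?_
      rw [toQuiverAlgebra, QuotAlg.mk_eq_zero hx, map_zero]
    · have h := gen_dualKoszulElement (n := n) (δL := δL) (δR := δR) hl hr c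
      rw [(hker _).2 (Submodule.subset_span ⟨c, rfl⟩), map_zero] at h
      rw [h, newRelation, map_add, map_mul, map_pow, map_neg, map_one, map_sum, map_sum]
      simp only [map_mul]
      congr 1
      · exact Finset.sum_congr rfl fun b _ => congrArg₂ (· * ·) (toTensor_newArrow s t _ hs ht b)
          (toTensor_inclPath s t _ hs ht _)
      · refine congrArg _ (Finset.sum_congr rfl fun b _ => ?_)
        exact congrArg₂ (· * ·) (toTensor_inclPath s t _ hs ht _) (toTensor_newArrow s t _ hs ht b)
  let F := QuotAlg.lift T hT
  have hFi : ∀ x, F (QuotAlg.mk k _ (inclPath s t x)) =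
      BimodTensorAlgebra.base k (QuiverAlgebra M) E (toQuiverAlgebra M x) := fun x =>
    (QuotAlg.lift_mk T hT _).trans (toTensor_inclPath s t _ hs ht x)
  have hFn : ∀ b, F (QuotAlg.mk k _ (newArrow s t b)) =
      BimodTensorAlgebra.gen k (QuiverAlgebra M) E (G (summandGen s t b)) := fun b =>
    (QuotAlg.lift_mk T hT _).trans (toTensor_newArrow s t _ hs ht b)
  -- The kernel of `G` is generated by the dual Koszul elements, so `sumToExtended` descends along
  -- `G` to a bimodule map on `E`, independently of the section `σ`.
  have hw : ∀ u v, G u = G v → sumToExtended s t M n δL δR u = sumToExtended s t M n δL δR v := by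
    intro u v h
    rw [← sub_eq_zero, ← map_sub]
    exact sumToExtended_eq_zero s t M n δL δR ((hker _).1 (by rw [map_sub, h, sub_self]))
  choose σ hσ using hG
  have hσG : ∀ u, sumToExtended s t M n δL δR (σ (G u)) = sumToExtended s t M n δL δR u :=
    fun u => hw _ _ (hσ _)
  let g : E →+ QuotAlg (allRelations s t M n δL δR) :=
    AddMonoidHom.mk' (fun ξ => sumToExtended s t M n δL δR (σ ξ)) fun ξ η => by
      rw [← map_add]
      exact hw _ _ (by rw [map_add, hσ, hσ, hσ])
  have hg : ∀ u, g (G u) = sumToExtended s t M n δL δR u := hσG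
  let H : BimodTensorAlgebra k (QuiverAlgebra M) E →ₐ[k] QuotAlg (allRelations s t M n δL δR) :=
    BimodTensorAlgebra.lift (toExtended s t M n δL δR) g
      (fun a ξ => by
        rw [← hσ ξ, hl, hg, hg]
        refine (sumToExtended_tmul_smul s t M n δL δR a 1 _).trans ?_
        rw [map_one, mul_one])
      (fun a ξ => by
        rw [← hσ ξ, hr, hg, hg, sumToExtended_tmul_smul, map_one, one_mul])
  have hHb : ∀ a, H (BimodTensorAlgebra.base k (QuiverAlgebra M) E a) =
      toExtended s t M n δL δR a := fun a => BimodTensorAlgebra.lift_base _ _ _ _ a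
  have hHg : ∀ u, H (BimodTensorAlgebra.gen k (QuiverAlgebra M) E (G u)) =
      sumToExtended s t M n δL δR u := fun u =>
    (BimodTensorAlgebra.lift_gen _ _ _ _ (G u)).trans (hg u)
  have hFt : ∀ a, F (toExtended s t M n δL δR a) =
      BimodTensorAlgebra.base k (QuiverAlgebra M) E a := fun a => by
    obtain ⟨x, rfl⟩ := QuotAlg.mk_surjective (k := k) a
    exact (congrArg F (toExtended_mk s t M n δL δR x)).trans (hFi x)
  have hFs : ∀ b w, F (sandwich (toExtended s t M n δL δR) (newClass s t M n δL δR b) w) =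
      sandwich (BimodTensorAlgebra.base k (QuiverAlgebra M) E)
        (BimodTensorAlgebra.gen k (QuiverAlgebra M) E (G (summandGen s t b))) w := fun b w => by
    induction w using env_induction with
    | h0 => rw [map_zero, map_zero, map_zero]
    | hadd x y hx hy => rw [map_add, map_add, map_add, hx, hy]
    | h x y =>
      rw [sandwich_tmul, sandwich_tmul, map_mul, map_mul, hFt, hFt, newClass, hFn]
  -- Both composites are checked on generators. An element of `E` is the image of a combination of
  -- summand generators, on which `H` and then `F` return the same sandwiches.
  have h1 : F.comp H = AlgHom.id k _ := by
    refine BimodTensorAlgebra.algHom_ext (fun a => ?_) fun ξ => ?_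
    · rw [AlgHom.comp_apply, hHb, hFt]
      rfl
    · rw [← hσ ξ, AlgHom.comp_apply, hHg, sumToExtended_apply, map_sum]
      conv_rhs => rw [eq_sum_summandGen s t (σ ξ), map_sum, map_sum, AlgHom.id_apply]
      exact Finset.sum_congr rfl fun b _ =>
        (hFs b _).trans (gen_smul_eq_sandwich hl hr _ _).symm
  have h2 : H.comp F = AlgHom.id k _ := by
    suffices h : (H.comp F).comp (QuotAlg.mk k _) = QuotAlg.mk k (allRelations s t M n δL δR) from
      QuotAlg.algHom_ext fun x => AlgHom.congr_fun h x
    have hi : ∀ x, H (F (QuotAlg.mk k _ (inclPath s t x))) = QuotAlg.mk k _ (inclPath s t x) :=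
      fun x => by rw [hFi, hHb, toExtended_mk]
    have : Finite (extendQuiver Q s t).Arrow := inferInstanceAs (Finite (Q.Arrow ⊕ B))
    refine pathAlgebra_algHom_ext (fun c => ?_) fun a => ?_
    · have h := hi (BimodTensorAlgebra.base k (I → k) (ArrowSpace k Q) c)
      rw [inclPath_base] at h
      exact h
    · rcases a with a | b
      · have h := hi (arrow k Q a)
        rw [inclPath_arrow] at h
        exact h
      · change H (F (QuotAlg.mk k _ (newArrow s t b))) = QuotAlg.mk k _ (newArrow s t b)
        rw [hFn, hHg, sumToExtended_summandGen]
        rfl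
  exact ⟨AlgEquiv.ofAlgHom F H h1 h2, hFi, fun b => ⟨_, hFn b⟩⟩

end Presentation

/-! ### Assembly for prescribed bases -/

variable {k : Type u} [Field k] {I : Type u} [Finite I] {Q : QuiverOn I} [Finite Q.Arrow]
  {M : Submodule k (PathAlgebra k Q)}

/-- The resolutions need bases of all the `K_l`, whereas only two are prescribed; the others are
chosen arbitrarily. -/
theorem IsQuadratic.exists_koszulSystem_basis_eq (hM : IsQuadratic M) (m : ℕ)
    (Dp : PathBasisData (koszulSpace M m)) (Dq : PathBasisData (koszulSpace M (m + 1))) :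
    ∃ K : KoszulSystem M, K.basis m = Dp ∧ K.basis (m + 1) = Dq := by
  choose B hB q s t hq using hM.exists_isPathBasis_koszulSpace
  obtain ⟨K, hK⟩ := hM.exists_koszulSystem (Function.update (Function.update
    (fun l => (⟨B l, hB l, q l, s l, t l, hq l⟩ : PathBasisData (koszulSpace M l))) m Dp) (m + 1) Dq)
  refine ⟨K, ?_, ?_⟩
  · rw [hK, Function.update_of_ne (Nat.succ_ne_self m).symm, Function.update_self]
  · rw [hK, Function.update_self]

/-- The bimodule `Ext` and the preprojective algebra of a Koszul algebra of global dimension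
`m + 1`. -/
theorem KoszulSystem.preprojective_presentation (K : KoszulSystem M) (hM : IsQuadratic M)
    [FiniteDimensional k (QuiverAlgebra M)] (hKoszul : IsKoszul (lengthGrading M)) (m : ℕ)
    (hdim : globalDimension (QuiverAlgebra M) = (m + 1 : ℕ))
    {Dp : PathBasisData (koszulSpace M m)} {Dq : PathBasisData (koszulSpace M (m + 1))}
    (hp : K.basis m = Dp) (hq : K.basis (m + 1) = Dq) (δL δR : Dp.idx → Dq.idx → PathAlgebra k Q)
    (hL : IsLeftDerivative Dq.elt Dp.elt Dp.src δL)
    (hR : IsRightDerivative Dq.elt Dp.elt Dp.tgt δR) :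
    (∀ x : sumBimod M Dq.src Dq.tgt, x ∈ dualKoszulSubmodule M (m + 1) δL δR Dq.src Dq.tgt ↔
      ∃ φ : sumBimod M Dp.tgt Dp.src →ₗ[Env k (QuiverAlgebra M)] Env k (QuiverAlgebra M),
        ∀ b, (x b : Env k (QuiverAlgebra M)) =
          envFlip k (QuiverAlgebra M) (φ (koszulDiff M (m + 1) δL δR Dp.src Dp.tgt b))) ∧
    (∃ Ψ : EnvExt k (QuiverAlgebra M) (m + 1) ≃+
        (sumBimod M Dq.src Dq.tgt ⧸ dualKoszulSubmodule M (m + 1) δL δR Dq.src Dq.tgt),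
      ∀ (a : QuiverAlgebra M) (x : EnvExt k (QuiverAlgebra M) (m + 1)),
        Ψ (a • x) = (a ⊗ₜ[k] (1 : (QuiverAlgebra M)ᵐᵒᵖ)) • Ψ x ∧
        Ψ (MulOpposite.op a • x) = ((1 : QuiverAlgebra M) ⊗ₜ[k] MulOpposite.op a) • Ψ x) ∧
    (∀ r ∈ allRelations Dq.src Dq.tgt M (m + 1) δL δR,
      r ∈ arrowSpan k (extendQuiver Q Dq.src Dq.tgt) ^ 2) ∧
    (∃ Φ : QuotAlg (allRelations Dq.src Dq.tgt M (m + 1) δL δR) ≃ₐ[k]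
        Preprojective k (QuiverAlgebra M) (m + 1),
      (∀ x : PathAlgebra k Q,
        Φ (QuotAlg.mk k (allRelations Dq.src Dq.tgt M (m + 1) δL δR) (inclPath Dq.src Dq.tgt x)) =
          BimodTensorAlgebra.base k (QuiverAlgebra M) (DualExt k (QuiverAlgebra M) (m + 1))
            (toQuiverAlgebra M x)) ∧
      ∀ b, ∃ ξ : DualExt k (QuiverAlgebra M) (m + 1),
        Φ (QuotAlg.mk k (allRelations Dq.src Dq.tgt M (m + 1) δL δR)
            (newArrow Dq.src Dq.tgt b)) =
          BimodTensorAlgebra.gen k (QuiverAlgebra M) (DualExt k (QuiverAlgebra M) (m + 1)) ξ) := by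
  subst hp hq
  -- Uniqueness of derivatives identifies the given ones with those of the system.
  obtain rfl : δL = K.dL m := (existsUnique_isLeftDerivative hM (K.isBasis (m + 1))
    (K.isBasis m)).unique hL (K.isLeft m)
  obtain rfl : δR = K.dR m := (existsUnique_isRightDerivative hM (K.isBasis (m + 1))
    (K.isBasis m)).unique hR (K.isRight m)
  have hK := K.leftExact_of_isKoszul hM hKoszul
  have hn : IsEmpty (K.idx (m + 2)) := K.isEmpty_idx hM hKoszul hdim
  obtain ⟨G, hG, hker, hl, hr⟩ := exists_dualExt_presentation K hM hK hn
  exact ⟨K.mem_dualKoszulSubmodule_iff m, exists_envExt_equiv K hM hK hn,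
    allRelations_subset _ _ hM _ (fun c b => ((hL b).1 c).1) (fun c b => ((hR b).1 c).1),
    exists_quotAlg_equiv G hG hker hl hr⟩

end HigherPreproj

end

theorem mainTheorem5 {k : Type u} [Field k] [IsAlgClosed k] [CharZero k]
    {I : Type u} [Finite I] (Q : QuiverOn I) [Finite Q.Arrow]
    (M : Submodule k (PathAlgebra k Q)) (hM : IsQuadratic M)
    (n : ℕ) (hn : 1 ≤ n)
    (hKoszul : IsKoszul (lengthGrading M))
    (hInf : IsRepresentationInfinite k (QuiverAlgebra M) n)
    {B C : Type u} [Fintype B] [Fintype C]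
    (q : B → PathAlgebra k Q) (sq tq : B → I) (hq : IsPathBasis (koszulSpace M n) q sq tq)
    (p : C → PathAlgebra k Q) (sp tp : C → I)
    (hp : IsPathBasis (koszulSpace M (n - 1)) p sp tp) :
    (∃! δL : C → B → PathAlgebra k Q, IsLeftDerivative q p sp δL) ∧
    (∃! δR : C → B → PathAlgebra k Q, IsRightDerivative q p tp δR) ∧
    ∀ δL δR : C → B → PathAlgebra k Q,
      IsLeftDerivative q p sp δL → IsRightDerivative q p tp δR →
      (∀ x : sumBimod M sq tq, x ∈ dualKoszulSubmodule M n δL δR sq tq ↔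
        ∃ φ : sumBimod M tp sp →ₗ[Env k (QuiverAlgebra M)] Env k (QuiverAlgebra M),
          ∀ b, (x b : Env k (QuiverAlgebra M)) =
            envFlip k (QuiverAlgebra M) (φ (koszulDiff M n δL δR sp tp b))) ∧
      (∃ Ψ : EnvExt k (QuiverAlgebra M) n ≃+
          (sumBimod M sq tq ⧸ dualKoszulSubmodule M n δL δR sq tq),
        ∀ (a : QuiverAlgebra M) (x : EnvExt k (QuiverAlgebra M) n),
          Ψ (a • x) = (a ⊗ₜ[k] (1 : (QuiverAlgebra M)ᵐᵒᵖ)) • Ψ x ∧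
          Ψ (MulOpposite.op a • x) = ((1 : QuiverAlgebra M) ⊗ₜ[k] MulOpposite.op a) • Ψ x) ∧
      (∀ r ∈ allRelations sq tq M n δL δR, r ∈ arrowSpan k (extendQuiver Q sq tq) ^ 2) ∧
      (∃ Φ : QuotAlg (allRelations sq tq M n δL δR) ≃ₐ[k] Preprojective k (QuiverAlgebra M) n,
        (∀ x : PathAlgebra k Q,
          Φ (QuotAlg.mk k (allRelations sq tq M n δL δR) (inclPath sq tq x)) =
            BimodTensorAlgebra.base k (QuiverAlgebra M) (DualExt k (QuiverAlgebra M) n)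
              (toQuiverAlgebra M x)) ∧
        ∀ b, ∃ ξ : DualExt k (QuiverAlgebra M) n,
          Φ (QuotAlg.mk k (allRelations sq tq M n δL δR) (newArrow sq tq b)) =
            BimodTensorAlgebra.gen k (QuiverAlgebra M) (DualExt k (QuiverAlgebra M) n) ξ) := by
  
  -- As `n ≥ 1`, the subtraction `n - 1` does not truncate.
  obtain ⟨m, rfl⟩ : ∃ m, n = m + 1 := ⟨n - 1, by omega⟩
  rw [Nat.add_sub_cancel] at hp
  refine ⟨existsUnique_isLeftDerivative hM hq hp, existsUnique_isRightDerivative hM hq hp,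
    fun δL δR hL hR => ?_⟩
  obtain ⟨hfin, hdim, -⟩ := hInf
  obtain ⟨K, hKp, hKq⟩ := hM.exists_koszulSystem_basis_eq m ⟨C, inferInstance, p, sp, tp, hp⟩
    ⟨B, inferInstance, q, sq, tq, hq⟩
  exact K.preprojective_presentation hM hKoszul m hdim hKp hKq δL δR hL hR
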